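/- Let $d\in\mathbb N$ and let $O\subsetneq\mathbb R^d$ be an open set with $0\in O$. Put $$q(x)=\inf_{y\in O^c}|x-y|-\inf_{y\in O}|x-y|\quad(x\in\mathbb R^d),\qquad O_r=\{x\in\mathbb R^d\mid q(x)>r\}\quad(r\ge 0).$$ For $y\in\partial O$ let $$\delta(y)=\sup\{r\ge0\mid \text{there is } z\in O^c \text{ with } \overline O\cap\overline B(z,r)=\{y\}\}\in[0,\infty],$$ and for $r>0$ let $$\Sigma_r=\overline{\{y\in\partial O\mid\delta(y)<r\}},\qquad A_r=\{x\in\mathbb R^d\mid\overline B(x,r)\cap\Sigma_r\neq\emptyset\},$$ where $\overline B(x,r)$ is the closed Euclidean ball. On $W=C([0,\infty)\to\mathbb R^d)$ with its Borel $\sigma$-field let $\hat P_x$ $(x\in\mathbb R^d)$ be the probability measure under which the coordinate process $(\omega_t)_{t\ge0}$ is $d$-dimensional Brownian motion started at $x$. Write $\sigma_A=\inf\{t\ge0\mid\omega_t\in A\}$ for closed $A\subset\mathbb R^d$, and $\tau_r=\inf\{t\ge0\mid\omega_t\notin O_r\}$ for $r>0$, with $\inf\emptyset=\infty$. There is a constant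 $\hat C_1>0$ such that, for all $x\in\mathbb R^d$ and $r>0$, the function $t\mapsto\hat P_x[\tau_r\le t]$ is differentiable on $(0,\infty)$ and $$\frac{d}{dt}\hat P_x[\tau_r\le t]\le\hat C_1t^{-1}\quad\text{for all }t>0.$$ For every such constant $\hat C_1$, and with $\hat C_2=4\hat C_1+2$, for all $\gamma>0$, $u>0$, $r\in(0,\gamma]$ and $x\in\overline O$, $$\hat P_x\Bigl[0\le\inf_{t\in[0,u]}q(\omega_t)\le r,\ \sigma_{A_\gamma}>u\Bigr]\le\Bigl(\frac{d-1}{\gamma}+\hat C_2u^{-1/2}\Bigr)r.$$ -/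

import Mathlib

open Set MeasureTheory ProbabilityTheory
open scoped NNReal ENNReal

noncomputable section

namespace PathEstimate

/-- `ℝᵈ` with its Euclidean norm. -/
abbrev Eucl (d : ℕ) : Type := EuclideanSpace ℝ (Fin d)

/-- The path space `W = C([0,∞) → ℝᵈ)`, with the topology of locally uniform convergence. -/
abbrev PathSpace (d : ℕ) : Type := C(ℝ≥0, Eucl d)

/-- The Borel `σ`-field of `W`. -/
instance instMeasurableSpacePathSpace (d : ℕ) : MeasurableSpace (PathSpace d) :=
  borel (PathSpace d)

instance instBorelSpacePathSpace (d : ℕ) : BorelSpace (PathSpace d) := ⟨rfl⟩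

/-- Under the probability measure `P` on `W`, the coordinate process is a `d`-dimensional Brownian
motion starting at `x`: the coordinates are independent, and the `i`-th one minus `x i` is a
one-dimensional standard Brownian motion (started at `0`). -/
structure IsBrownianLaw {d : ℕ} (x : Eucl d) (P : Measure (PathSpace d)) : Prop where
  isProbabilityMeasure : IsProbabilityMeasure P
  isBrownianReal : ∀ i : Fin d,
    IsBrownianReal (fun (t : ℝ≥0) (ω : PathSpace d) => ω t i - x i) P
  iIndepFun_coord : iIndepFun (fun (i : Fin d) (ω : PathSpace d) (t : ℝ≥0) => ω t i) P

/-- The signed distance `q(x) = inf_{y ∉ O} |x - y| - inf_{y ∈ O} |x - y|`. -/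
def signedDist {d : ℕ} (O : Set (Eucl d)) (x : Eucl d) : ℝ :=
  Metric.infDist x Oᶜ - Metric.infDist x O

/-- `δ(y) ∈ [0,∞]`, the supremum of the radii `r ≥ 0` such that some closed ball of radius `r`,
with centre in the complement of `O`, meets the closure of `O` exactly in the point `y`. -/
def extBallRadius {d : ℕ} (O : Set (Eucl d)) (y : Eucl d) : ℝ≥0∞ :=
  sSup {R : ℝ≥0∞ | ∃ r : ℝ≥0, R = r ∧
    ∃ z ∈ Oᶜ, closure O ∩ Metric.closedBall z (r : ℝ) = {y}}

/-- `Σ_r`, the closure of `{y ∈ ∂O | δ(y) < r}`. -/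
def sigmaSet {d : ℕ} (O : Set (Eucl d)) (r : ℝ) : Set (Eucl d) :=
  closure {y | y ∈ frontier O ∧ extBallRadius O y < ENNReal.ofReal r}

/-- `A_r`, the set of all `x` whose closed ball of radius `r` meets `Σ_r`. -/
def sigmaNhd {d : ℕ} (O : Set (Eucl d)) (r : ℝ) : Set (Eucl d) :=
  {x | (Metric.closedBall x r ∩ sigmaSet O r).Nonempty}

/-- `σ_A = inf {t ≥ 0 | ω_t ∈ A}`, with `inf ∅ = ∞`. -/
def hitTime {d : ℕ} (A : Set (Eucl d)) : PathSpace d → WithTop ℝ≥0 :=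
  hittingAfter (fun (t : ℝ≥0) (ω : PathSpace d) => ω t) A 0

/-- `τ_r = inf {t ≥ 0 | ω_t ∉ O_r}`, where `O_r = {x | q(x) > r}`. -/
def exitTime {d : ℕ} (O : Set (Eucl d)) (r : ℝ) : PathSpace d → WithTop ℝ≥0 :=
  hitTime {x | r < signedDist O x}ᶜ

/-- The distribution function `t ↦ P[τ_r ≤ t]` of the exit time from `O_r` (used for `t > 0`). -/
def exitCDF {d : ℕ} (O : Set (Eucl d)) (P : Measure (PathSpace d)) (r t : ℝ) : ℝ :=
  P.real {ω | exitTime O r ω ≤ ((t.toNNReal : ℝ≥0) : WithTop ℝ≥0)}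

/-- `C > 0` is a constant for which all the distribution functions `t ↦ P_x[τ_r ≤ t]` are
differentiable on `(0,∞)` with derivative at most `C / t`, uniformly in `x` and `r > 0`. -/
def IsExitRateConst {d : ℕ} (O : Set (Eucl d)) (P : Eucl d → Measure (PathSpace d))
    (C : ℝ) : Prop :=
  0 < C ∧ ∀ (x : Eucl d) (r t : ℝ), 0 < r → 0 < t →
    DifferentiableAt ℝ (exitCDF O (P x) r) t ∧ deriv (exitCDF O (P x) r) t ≤ C * t⁻¹

/-- The event that `0 ≤ inf_{t ∈ [0,u]} q(ω_t) ≤ r` and `σ_{A_γ} > u`. -/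
def nearBoundaryEvent {d : ℕ} (O : Set (Eucl d)) (γ r : ℝ) (u : ℝ≥0) : Set (PathSpace d) :=
  {ω | 0 ≤ (⨅ t : Icc (0 : ℝ≥0) u, signedDist O (ω t)) ∧
    (⨅ t : Icc (0 : ℝ≥0) u, signedDist O (ω t)) ≤ r ∧
    (u : WithTop ℝ≥0) < hitTime (sigmaNhd O γ) ω}

end PathEstimate

end

/-! Two separate arguments carry the theorem.

Existence of the rate constant. `P_x[τ_r > t]` is the total mass of the heat kernel killed on
leaving the open set `O_r`. Time reversal makes these kernels symmetric, so on `L²` they form a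
self-adjoint contraction semigroup. Such a semigroup consists of the powers of its value at time
one, hence has a Taylor expansion in operator norm with remainder `8 a² / t²`
(`exists_semigroup_taylor`). The function `1` is not in `L²`, so space is cut into shells of width
`√(2t)` around the starting point. On the `k`-th shell the expansion holds with a constant that
grows polynomially in `k`, while the Gaussian tail makes the mass there decay faster than any power.
The interpolation `hasDerivAt_of_landau` sums the shells and gives a bound `C / t` with `C`
depending on `d` only (`exists_hasDerivAt_killedKernel`).

Boundary estimate. Brownian motion started at distance `w` from a ball of radius `R` avoids it up to
time `s` with probability at most `((d - 1) / R + 3 / √(8 s)) w` (`measureReal_avoid_ball_le`).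
Indeed `exp(-2mw) (1 - lw)₊³` with `m = (d - 1) / (2R)` and `l = (8t)^(-1/2)` is a subsolution of
the heat equation outside the ball, so it bounds the hitting probability from below, and its slope
at `w = 0` is `-(2m + 3l)`. Exterior balls at boundary points outside `Σ_γ` turn this into a bound
on the probability of staying in the closure of `O` (`measureReal_mem_closure_le`).

A path starting with `q > r` that comes `r`-close to the boundary without leaving the closure of `O`
must survive from distance `r` during the remaining time `u - τ_r`. The probability is thus at most
the integral of `((d - 1) / γ + 3 / √(8 (u - t))) r` against the law of `τ_r`. That law has mass at
most `1` on `[0, u/2]` and density at most `2 C / u` on `[u/2, u]`, which gives `(3 C + 3/2) / √u`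
for the singular part. The Markov property is used only at deterministic grid times; the error is
controlled by the oscillation of `q` along the path over one mesh step, and tends to zero with the
mesh. -/

namespace PathEstimate

/-! ### The Borel field of path space and measures on it. -/

theorem mapsTo_iff_exists_dense_infEDist {X Y : Type*} [TopologicalSpace X] [PseudoEMetricSpace Y]
    {K U : Set _} {D : Set X} (hK : IsCompact K) (hU : IsOpen U) (hD : D ⊆ K) (hKD : K ⊆ closure D)
    (f : C(X, Y)) :
    MapsTo f K U ↔ ∃ n : ℕ, ∀ x ∈ D, ((n : ℝ≥0∞) + 1)⁻¹ ≤ Metric.infEDist (f x) Uᶜ := by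
  constructor
  -- The extended distance is infinite when `Uᶜ` is empty, so `U = univ` is not a special case.
  · intro h
    have hc : IsCompact (f '' K) := hK.image f.continuous
    obtain ⟨δ, hδ, hδ'⟩ := Metric.exists_pos_forall_lt_edist hc hU.isClosed_compl
      (disjoint_compl_right_iff_subset.2 h.image_subset)
    obtain ⟨n, hn⟩ := ENNReal.exists_inv_nat_lt (ENNReal.coe_pos.2 hδ).ne'
    refine ⟨n, fun x hx => Metric.le_infEDist.2 fun y hy => ?_⟩
    refine le_trans ?_ (hn.trans (hδ' _ (mem_image_of_mem f (hD hx)) y hy)).le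
    exact ENNReal.inv_le_inv.2 le_self_add
  · rintro ⟨n, hn⟩ x hx
    have hcl : IsClosed {x | ((n : ℝ≥0∞) + 1)⁻¹ ≤ Metric.infEDist (f x) Uᶜ} :=
      isClosed_le continuous_const (Metric.continuous_infEDist.comp f.continuous)
    have h1 : ((n : ℝ≥0∞) + 1)⁻¹ ≤ Metric.infEDist (f x) Uᶜ :=
      closure_minimal (fun x hx => hn x hx) hcl (hKD hx)
    by_contra hxU
    rw [Metric.infEDist_zero_of_mem (show f x ∈ Uᶜ from hxU)] at h1
    simp at h1

/-- A subbasic set of the compact-open topology is a countable combination of conditions on single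
evaluations, because `K` may be replaced by a countable dense subset. Hence measurability and
equality of laws can be checked on evaluations. -/
theorem pathSpace_borel_eq_comap (d : ℕ) :
    instMeasurableSpacePathSpace d =
      MeasurableSpace.comap (fun (ω : PathSpace d) (t : ℝ≥0) => ω t) inferInstance := by
  apply le_antisymm
  · change borel (PathSpace d) ≤ _
    rw [borel_eq_generateFrom_of_subbasis (ContinuousMap.compactOpen_eq)]
    refine MeasurableSpace.generateFrom_le ?_
    rintro _ ⟨K, hK : IsCompact K, U, hU : IsOpen U, rfl⟩
    change @MeasurableSet _ (MeasurableSpace.comap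
      (fun (ω : PathSpace d) (t : ℝ≥0) => ω t) inferInstance) {f : PathSpace d | MapsTo f K U}
    obtain ⟨D, hDK, hDc, hKD⟩ :=
      (TopologicalSpace.IsSeparable.of_separableSpace K).exists_countable_dense_subset
    have : {f : PathSpace d | MapsTo f K U} =
        ⋃ n : ℕ, ⋂ x ∈ D, {f : PathSpace d | ((n : ℝ≥0∞) + 1)⁻¹ ≤ Metric.infEDist (f x) Uᶜ} := by
      ext f
      simp [mapsTo_iff_exists_dense_infEDist hK hU hDK hKD f]
    rw [this]
    let _ : MeasurableSpace (PathSpace d) :=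
      MeasurableSpace.comap (fun (ω : PathSpace d) (t : ℝ≥0) => ω t) inferInstance
    have he : ∀ t : ℝ≥0, Measurable (fun ω : PathSpace d => ω t) := fun t =>
      (measurable_pi_apply t).comp (comap_measurable _)
    refine MeasurableSet.iUnion fun n => MeasurableSet.biInter hDc fun x _ => ?_
    exact measurableSet_le measurable_const (measurable_infEDist.comp (he x))
  · rw [← measurable_iff_comap_le]
    exact measurable_pi_lambda _ fun t => (continuous_eval_const t).measurable

theorem measurable_path_eval {d : ℕ} (t : ℝ≥0) : Measurable (fun ω : PathSpace d => ω t) :=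
  (continuous_eval_const t).measurable

theorem measurable_path_coe (d : ℕ) :
    Measurable (fun (ω : PathSpace d) (t : ℝ≥0) => ω t) :=
  measurable_pi_lambda _ fun t => measurable_path_eval t

theorem measurable_path_of_eval {α : Type*} [MeasurableSpace α] {d : ℕ} {f : α → PathSpace d}
    (h : ∀ t, Measurable fun a => f a t) : Measurable f := by
  rw [measurable_iff_comap_le, pathSpace_borel_eq_comap, MeasurableSpace.comap_comp,
    ← measurable_iff_comap_le]
  exact measurable_pi_lambda _ h

theorem path_measure_ext {d : ℕ} {P Q : Measure (PathSpace d)}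
    (h : P.map (fun ω t => ω t) = Q.map (fun (ω : PathSpace d) t => ω t)) : P = Q := by
  ext s hs
  rw [pathSpace_borel_eq_comap] at hs
  obtain ⟨A, hA, rfl⟩ := hs
  rw [← Measure.map_apply (measurable_path_coe d) hA, h,
    Measure.map_apply (measurable_path_coe d) hA]

/-! ### Path transformations and the invariance of Brownian laws. -/

/-- The path stopped at the deterministic time `t`. -/
def stopAt {d : ℕ} (t : ℝ≥0) (ω : PathSpace d) : PathSpace d :=
  ω.comp ⟨fun s => min s t, by fun_prop⟩

/-- The path of increments after the deterministic time `t`. -/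
def incrAt {d : ℕ} (t : ℝ≥0) (ω : PathSpace d) : PathSpace d :=
  ⟨fun s => ω (t + s) - ω t, by fun_prop⟩

/-- The path reversed on `[0, t]`. -/
def revAt {d : ℕ} (t : ℝ≥0) (ω : PathSpace d) : PathSpace d :=
  ⟨fun s => ω (t - s) - ω t + (ω (max s t) - ω t), by fun_prop⟩

/-- The path translated by the vector `x`. -/
def translate {d : ℕ} (x : Eucl d) (ω : PathSpace d) : PathSpace d :=
  ⟨fun s => x + ω s, by fun_prop⟩

@[simp] theorem stopAt_apply {d : ℕ} (t s : ℝ≥0) (ω : PathSpace d) :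
    stopAt t ω s = ω (min s t) := rfl

@[simp] theorem incrAt_apply {d : ℕ} (t s : ℝ≥0) (ω : PathSpace d) :
    incrAt t ω s = ω (t + s) - ω t := rfl

@[simp] theorem revAt_apply {d : ℕ} (t s : ℝ≥0) (ω : PathSpace d) :
    revAt t ω s = ω (t - s) - ω t + (ω (max s t) - ω t) := rfl

@[simp] theorem translate_apply {d : ℕ} (x : Eucl d) (s : ℝ≥0) (ω : PathSpace d) :
    translate x ω s = x + ω s := rfl

theorem measurable_stopAt {d : ℕ} (t : ℝ≥0) : Measurable (stopAt (d := d) t) :=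
  measurable_path_of_eval fun s => measurable_path_eval (min s t)

theorem measurable_incrAt {d : ℕ} (t : ℝ≥0) : Measurable (incrAt (d := d) t) :=
  measurable_path_of_eval fun s => (measurable_path_eval (t + s)).sub (measurable_path_eval t)

theorem measurable_revAt {d : ℕ} (t : ℝ≥0) : Measurable (revAt (d := d) t) :=
  measurable_path_of_eval fun s => ((measurable_path_eval (t - s)).sub (measurable_path_eval t)).add
    ((measurable_path_eval (max s t)).sub (measurable_path_eval t))

theorem measurable_translate_uncurry {d : ℕ} :
    Measurable (fun p : Eucl d × PathSpace d => translate p.1 p.2) :=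
  measurable_path_of_eval fun s => measurable_fst.add ((measurable_path_eval s).comp measurable_snd)

theorem measurable_translate {d : ℕ} (x : Eucl d) : Measurable (translate x) :=
  measurable_translate_uncurry.comp measurable_prodMk_left

variable {d : ℕ}

theorem measurable_coord (i : Fin d) :
    Measurable (fun (ω : PathSpace d) (t : ℝ≥0) => ω t i) :=
  measurable_pi_lambda _ fun t => (EuclideanSpace.proj (𝕜 := ℝ) i).continuous.measurable.comp
    (measurable_path_eval t)

theorem measurable_eval_coord (i : Fin d) (t : ℝ≥0) :
    Measurable (fun (ω : PathSpace d) => ω t i) :=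
  (measurable_pi_apply t).comp (measurable_coord i)

/-- The law of a path is determined by the laws of its coordinate processes if these are
independent. -/
theorem path_measure_ext_coord {P Q : Measure (PathSpace d)}
    (hP : iIndepFun (fun (i : Fin d) (ω : PathSpace d) (t : ℝ≥0) => ω t i) P)
    (hQ : iIndepFun (fun (i : Fin d) (ω : PathSpace d) (t : ℝ≥0) => ω t i) Q)
    (h : ∀ i : Fin d, P.map (fun ω t => ω t i) = Q.map (fun (ω : PathSpace d) t => ω t i)) :
    P = Q := by
  have hP' := hP.map_fun_eq_pi_map fun i => (measurable_coord i).aemeasurable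
  have hQ' := hQ.map_fun_eq_pi_map fun i => (measurable_coord i).aemeasurable
  have hPQ : P.map (fun (ω : PathSpace d) (i : Fin d) (t : ℝ≥0) => ω t i)
      = Q.map (fun ω i t => ω t i) := by
    rw [hP', hQ']; simp_rw [h]
  let g : (Fin d → ℝ≥0 → ℝ) → ℝ≥0 → Eucl d := fun z t => WithLp.toLp 2 fun i => z i t
  have hg : Measurable g := measurable_pi_lambda _ fun t =>
    (WithLp.measurable_toLp 2 _).comp (measurable_pi_lambda _ fun i => by fun_prop)
  apply path_measure_ext
  have hm : Measurable (fun (ω : PathSpace d) (i : Fin d) (t : ℝ≥0) => ω t i) :=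
    measurable_pi_lambda _ fun i => measurable_coord i
  have := congrArg (Measure.map g) hPQ
  rw [Measure.map_map hg hm, Measure.map_map hg hm] at this
  exact this

theorem IsBrownianLaw.map_coord_eq {x : Eucl d} {P Q : Measure (PathSpace d)}
    (hP : IsBrownianLaw x P) (hQ : IsBrownianLaw x Q) (i : Fin d) :
    P.map (fun ω t => ω t i) = Q.map (fun (ω : PathSpace d) t => ω t i) := by
  have := hP.isProbabilityMeasure
  have := hQ.isProbabilityMeasure
  have hm : Measurable (fun (ω : PathSpace d) (t : ℝ≥0) => ω t i - x i) :=
    measurable_pi_lambda _ fun t => (measurable_eval_coord i t).sub_const _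
  have key : P.map (fun ω t => ω t i - x i) = Q.map (fun (ω : PathSpace d) t => ω t i - x i) := by
    have h1 := isProjectiveLimit_map (P := P) (X := fun t (ω : PathSpace d) => ω t i - x i)
      hm.aemeasurable
    have h2 := isProjectiveLimit_map (P := Q) (X := fun t (ω : PathSpace d) => ω t i - x i)
      hm.aemeasurable
    have h3 : (fun I : Finset ℝ≥0 => P.map (fun ω => I.restrict (fun t => ω t i - x i))) =
        fun I : Finset ℝ≥0 =>
          Q.map (fun ω : PathSpace d => I.restrict (fun t => ω t i - x i)) := by
      funext I
      rw [((hP.isBrownianReal i).hasLaw I).map_eq, ((hQ.isBrownianReal i).hasLaw I).map_eq]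
    rw [h3] at h1
    have : ∀ I : Finset ℝ≥0, IsFiniteMeasure
      (Q.map (fun ω : PathSpace d => I.restrict (fun t => ω t i - x i))) := fun I => inferInstance
    exact h1.unique h2
  have hadd : Measurable (fun (z : ℝ≥0 → ℝ) t => z t + x i) :=
    measurable_pi_lambda _ fun t => (measurable_pi_apply t).add_const _
  have := congrArg (Measure.map (fun (z : ℝ≥0 → ℝ) t => z t + x i)) key
  rw [Measure.map_map hadd hm, Measure.map_map hadd hm] at this
  simpa [Function.comp_def] using this

/-- The finite-dimensional laws of each coordinate are prescribed and the coordinates are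
independent. Invariance under shifts, translations and reversal is obtained from this uniqueness. -/
theorem IsBrownianLaw.unique {x : Eucl d} {P Q : Measure (PathSpace d)}
    (hP : IsBrownianLaw x P) (hQ : IsBrownianLaw x Q) : P = Q :=
  path_measure_ext_coord hP.iIndepFun_coord hQ.iIndepFun_coord (hP.map_coord_eq hQ)

/-- A measurable map on paths acting coordinatewise and preserving one-dimensional Brownian motion
maps Brownian laws to Brownian laws. -/
theorem IsBrownianLaw.map_coordinatewise {x y : Eucl d} {P : Measure (PathSpace d)}
    (hP : IsBrownianLaw x P) {F : PathSpace d → PathSpace d} (hF : Measurable F)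
    (G : Fin d → (ℝ≥0 → ℝ) → ℝ≥0 → ℝ) (hG : ∀ i, Measurable (G i))
    (hFG : ∀ ω i, (fun t => F ω t i) = G i (fun t => ω t i))
    (hpre : ∀ i, IsPreBrownianReal (fun t (ω : PathSpace d) => F ω t i - y i) P) :
    IsBrownianLaw y (P.map F) := by
  have := hP.isProbabilityMeasure
  refine ⟨Measure.isProbabilityMeasure_map hF.aemeasurable, fun i => ⟨⟨fun I => ?_⟩, ?_⟩, ?_⟩
  · have hm : Measurable fun ω : PathSpace d => I.restrict (fun t => ω t i - y i) :=
      measurable_pi_lambda _ fun t => (measurable_eval_coord i t).sub_const _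
    refine ⟨hm.aemeasurable, ?_⟩
    rw [Measure.map_map hm hF]
    exact ((hpre i).hasLaw I).map_eq
  · exact Filter.Eventually.of_forall fun ω => by fun_prop
  · have := Measure.isProbabilityMeasure_map (μ := P) hF.aemeasurable
    rw [iIndepFun_iff_map_fun_eq_pi_map fun i => (measurable_coord i).aemeasurable]
    have h1 := (hP.iIndepFun_coord.comp G hG).map_fun_eq_pi_map fun i =>
      ((hG i).comp (measurable_coord i)).aemeasurable
    rw [Measure.map_map (measurable_pi_lambda _ fun i => measurable_coord i) hF]
    simp_rw [Measure.map_map (measurable_coord _) hF]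
    convert h1 using 2
    · funext ω i; exact hFG ω i
    · funext i; congr 1; funext ω; exact hFG ω i

theorem IsBrownianLaw.translate {x : Eucl d} {P : Measure (PathSpace d)}
    (hP : IsBrownianLaw x P) (y : Eucl d) :
    IsBrownianLaw (y + x) (P.map (translate y)) := by
  refine hP.map_coordinatewise (measurable_translate y) (fun i z t => y i + z t)
    (fun i => measurable_pi_lambda _ fun t => (measurable_pi_apply t).const_add _)
    (fun ω i => rfl) fun i => ?_
  convert (hP.isBrownianReal i).toIsPreBrownianReal using 3
  simp [PathEstimate.translate]

theorem IsBrownianLaw.incrAt {x : Eucl d} {P : Measure (PathSpace d)}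
    (hP : IsBrownianLaw x P) (t : ℝ≥0) : IsBrownianLaw 0 (P.map (incrAt t)) := by
  refine hP.map_coordinatewise (measurable_incrAt t) (fun i z s => z (t + s) - z t)
    (fun i => measurable_pi_lambda _ fun t => by fun_prop) (fun ω i => rfl) fun i => ?_
  convert (hP.isBrownianReal i).toIsPreBrownianReal.shift t using 3
  simp [PathEstimate.incrAt]

/-- This is the bilinear expansion of the covariance of the reversed process, for each position of
`t` relative to `s ≤ u`; `max (t - s) 0` is truncated subtraction. -/
theorem reverse_covariance_identity {s t u : ℝ} (hs : 0 ≤ s) (ht : 0 ≤ t) (hsu : s ≤ u) :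
    min (max (t - s) 0) (max (t - u) 0) - min (max (t - s) 0) t - min t (max (t - u) 0) + min t t +
        (min (max (t - s) 0) (max u t) - min (max (t - s) 0) t - min t (max u t) + min t t) +
      (min (max s t) (max (t - u) 0) - min (max s t) t - min t (max (t - u) 0) + min t t +
        (min (max s t) (max u t) - min (max s t) t - min t (max u t) + min t t)) = s := by
  have h0 := min_self t
  rcases le_total u t with h1 | h1
  · have h2 := hsu.trans h1
    rw [max_eq_left (sub_nonneg.2 h1), max_eq_left (sub_nonneg.2 h2), max_eq_right h1,
      max_eq_right h2, min_eq_right (by linarith : t - u ≤ t - s),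
      min_eq_left (by linarith : t - s ≤ t), min_eq_right (by linarith : t - u ≤ t), h0]
    ring
  · rcases le_total s t with h2 | h2
    · rw [max_eq_left (sub_nonneg.2 h2), max_eq_right (sub_nonpos.2 h1), max_eq_left h1,
        max_eq_right h2, min_eq_right (by linarith : (0 : ℝ) ≤ t - s),
        min_eq_left (by linarith : t - s ≤ t), min_eq_right ht,
        min_eq_left (by linarith : t - s ≤ u), min_eq_left h1, h0]
      ring
    · rw [max_eq_right (sub_nonpos.2 h2), max_eq_right (sub_nonpos.2 h1), max_eq_left h1,
        max_eq_left h2, min_eq_right (hs : (0 : ℝ) ≤ s), min_eq_right ht, min_eq_left ht,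
        min_eq_left (ht.trans h1), min_eq_left h1, min_eq_right h2, min_eq_left hsu, h0,
        min_self]
      ring

/-- For `s ≤ t` the second bracket vanishes and the process runs backwards from time `t`; for `s ≥
t` the first bracket is constant and the later increments of `B` are appended. The process is
therefore defined for all times, and being centred Gaussian it is identified by its covariance. -/
theorem _root_.ProbabilityTheory.IsPreBrownianReal.reverse {Ω : Type*} {mΩ : MeasurableSpace Ω}
    {B : ℝ≥0 → Ω → ℝ} {P : Measure Ω} (hB : IsPreBrownianReal B P) (t : ℝ≥0) :
    IsPreBrownianReal (fun s ω => B (t - s) ω - B t ω + (B (max s t) ω - B t ω)) P := by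
  classical
  have := hB.isGaussianProcess.isProbabilityMeasure
  have hL : ∀ s, MemLp (B s) 2 P := fun s => (hB.isGaussianProcess.hasGaussianLaw_eval s).memLp_two
  have hd : ∀ s u, MemLp (fun ω => B s ω - B u ω) 2 P := fun s u => (hL s).sub (hL u)
  refine IsGaussianProcess.isPreBrownianReal_of_covariance ?_ (fun s => ?_) (fun s u hsu => ?_)
  · refine hB.isGaussianProcess.of_isGaussianProcess fun s => ⟨{t - s, t, max s t},
      { toFun x := x ⟨t - s, by simp⟩ - x ⟨t, by simp⟩ + (x ⟨max s t, by simp⟩ - x ⟨t, by simp⟩)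
        map_add' x y := by simp; ring
        map_smul' c x := by simp; ring }, by simp⟩
  · have hi : ∀ s, Integrable (B s) P := hB.integrable_eval
    rw [integral_add, integral_sub, integral_sub]
    · simp [hB.integral_eval]
    all_goals first | exact hi _ | exact (hi _).sub (hi _)
  · change cov[(fun ω => B (t - s) ω - B t ω) + (fun ω => B (max s t) ω - B t ω),
      (fun ω => B (t - u) ω - B t ω) + (fun ω => B (max u t) ω - B t ω); P] = _
    rw [covariance_add_left (hd _ _) (hd _ _) ((hd _ _).add (hd _ _)),
      covariance_add_right (hd _ _) (hd _ _) (hd _ _),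
      covariance_add_right (hd _ _) (hd _ _) (hd _ _)]
    simp only [covariance_fun_sub_fun_sub (hL _) (hL _) (hL _) (hL _), hB.covariance_fun_eval]
    have hc : ∀ a b : ℝ≥0, ((a - b : ℝ≥0) : ℝ) = max (a - b : ℝ) 0 := fun a b => NNReal.coe_sub_def
    have hsu' : (s : ℝ) ≤ u := hsu
    have hs0 : (0 : ℝ) ≤ s := s.2
    have ht0 : (0 : ℝ) ≤ t := t.2
    push_cast
    simp only [hc]
    exact reverse_covariance_identity hs0 ht0 hsu'

theorem IsBrownianLaw.revAt {P : Measure (PathSpace d)}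
    (hP : IsBrownianLaw 0 P) (t : ℝ≥0) : IsBrownianLaw 0 (P.map (revAt t)) := by
  refine hP.map_coordinatewise (measurable_revAt t)
    (fun i z s => z (t - s) - z t + (z (max s t) - z t))
    (fun i => measurable_pi_lambda _ fun t => by fun_prop) (fun ω i => rfl) fun i => ?_
  convert (hP.isBrownianReal i).toIsPreBrownianReal.reverse t using 3
  simp [PathEstimate.revAt]

/-! ### The Markov property at deterministic times and the law at a fixed time. -/

theorem exists_measurableSet_coord {A : Set (PathSpace d)} (hA : MeasurableSet A) :
    ∃ A' : Set (Fin d → ℝ≥0 → ℝ), MeasurableSet A' ∧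
      ∀ ω : PathSpace d, ω ∈ A ↔ (fun i t => ω t i) ∈ A' := by
  rw [pathSpace_borel_eq_comap] at hA
  obtain ⟨S, hS, rfl⟩ := hA
  let g : (Fin d → ℝ≥0 → ℝ) → ℝ≥0 → Eucl d := fun z t => WithLp.toLp 2 fun i => z i t
  have hg : Measurable g := measurable_pi_lambda _ fun t =>
    (WithLp.measurable_toLp 2 _).comp (measurable_pi_lambda _ fun i => by fun_prop)
  exact ⟨g ⁻¹' S, hg hS, fun ω => Iff.rfl⟩

/-- Past and increments are independent in each coordinate, and the pairs (past, increments) are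
independent across coordinates. The joint law is thus a product over `i` of products, which is
regrouped into the product of the two families. -/
theorem IsBrownianLaw.indepFun_stopAt_incrAt {x : Eucl d} {P : Measure (PathSpace d)}
    (hP : IsBrownianLaw x P) (t : ℝ≥0) :
    IndepFun (PathEstimate.stopAt t) (PathEstimate.incrAt t) P := by
  have := hP.isProbabilityMeasure
  let G₁ : (ℝ≥0 → ℝ) → (ℝ≥0 → ℝ) := fun z s => z (min s t)
  let G₂ : (ℝ≥0 → ℝ) → (ℝ≥0 → ℝ) := fun z s => z (t + s) - z t
  have hG₁ : Measurable G₁ := measurable_pi_lambda _ fun s => by fun_prop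
  have hG₂ : Measurable G₂ := measurable_pi_lambda _ fun s => by fun_prop
  let X : Fin d → PathSpace d → ℝ≥0 → ℝ := fun i ω s => ω s i
  have hX : ∀ i, Measurable (X i) := measurable_coord
  have hind : ∀ i, IndepFun (fun ω => G₁ (X i ω)) (fun ω => G₂ (X i ω)) P := by
    intro i
    have h := ((hP.isBrownianReal i).toIsPreBrownianReal.indepFun_shift t).symm
    have h' := h.comp (φ := fun (z : Set.Iic t → ℝ) (s : ℝ≥0) =>
      z ⟨min s t, Set.mem_Iic.2 (min_le_right _ _)⟩ + x i) (ψ := id)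
      (measurable_pi_lambda _ fun s => (measurable_pi_apply _).add_const _) measurable_id
    convert h' using 1
    · funext ω s; simp [G₁, X]
    · funext ω s; simp [G₂, X]
  let Y₁ : PathSpace d → Fin d → ℝ≥0 → ℝ := fun ω i => G₁ (X i ω)
  let Y₂ : PathSpace d → Fin d → ℝ≥0 → ℝ := fun ω i => G₂ (X i ω)
  have hY₁ : Measurable Y₁ := measurable_pi_lambda _ fun i => hG₁.comp (hX i)
  have hY₂ : Measurable Y₂ := measurable_pi_lambda _ fun i => hG₂.comp (hX i)
  have hY : IndepFun Y₁ Y₂ P := by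
    rw [indepFun_iff_map_prod_eq_prod_map_map hY₁.aemeasurable hY₂.aemeasurable]
    have e₁ := (hP.iIndepFun_coord.comp (fun _ => G₁) fun _ => hG₁).map_fun_eq_pi_map
      fun i => (hG₁.comp (hX i)).aemeasurable
    have e₂ := (hP.iIndepFun_coord.comp (fun _ => G₂) fun _ => hG₂).map_fun_eq_pi_map
      fun i => (hG₂.comp (hX i)).aemeasurable
    have e₃ := (hP.iIndepFun_coord.comp (fun _ z => (G₁ z, G₂ z))
      fun _ => hG₁.prodMk hG₂).map_fun_eq_pi_map
      fun i => ((hG₁.prodMk hG₂).comp (hX i)).aemeasurable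
    have e₄ : ∀ i, P.map ((fun z => (G₁ z, G₂ z)) ∘ X i) =
        (P.map (G₁ ∘ X i)).prod (P.map (G₂ ∘ X i)) := fun i =>
      (indepFun_iff_map_prod_eq_prod_map_map (hG₁.comp (hX i)).aemeasurable
        (hG₂.comp (hX i)).aemeasurable).1 (hind i)
    have hs₁ : ∀ i, IsProbabilityMeasure (P.map (G₁ ∘ X i)) := fun i =>
      Measure.isProbabilityMeasure_map (hG₁.comp (hX i)).aemeasurable
    have hs₂ : ∀ i, IsProbabilityMeasure (P.map (G₂ ∘ X i)) := fun i =>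
      Measure.isProbabilityMeasure_map (hG₂.comp (hX i)).aemeasurable
    have e₅ := (measurePreserving_arrowProdEquivProdArrow (ℝ≥0 → ℝ) (ℝ≥0 → ℝ) (Fin d)
      (fun i => P.map (G₁ ∘ X i)) (fun i => P.map (G₂ ∘ X i))).map_eq
    have e₃' : P.map (fun ω i => (G₁ (X i ω), G₂ (X i ω))) =
        Measure.pi fun i => (P.map (G₁ ∘ X i)).prod (P.map (G₂ ∘ X i)) := by
      simp_rw [← e₄]; exact e₃
    rw [← e₃', Measure.map_map (f := fun ω i => (G₁ (X i ω), G₂ (X i ω))) (MeasurableEquiv.measurable _)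
      (measurable_pi_lambda _ fun i => (hG₁.prodMk hG₂).comp (hX i))] at e₅
    have e₁' : P.map Y₁ = Measure.pi fun i => P.map (G₁ ∘ X i) := e₁
    have e₂' : P.map Y₂ = Measure.pi fun i => P.map (G₂ ∘ X i) := e₂
    rw [e₁', e₂', ← e₅]
    rfl
  rw [indepFun_iff_measure_inter_preimage_eq_mul] at hY ⊢
  intro A B hA hB
  obtain ⟨A', hA', hAA'⟩ := exists_measurableSet_coord hA
  obtain ⟨B', hB', hBB'⟩ := exists_measurableSet_coord hB
  have h₁ : PathEstimate.stopAt t ⁻¹' A = Y₁ ⁻¹' A' := by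
    ext ω; exact hAA' _
  have h₂ : PathEstimate.incrAt t ⁻¹' B = Y₂ ⁻¹' B' := by
    ext ω; exact hBB' _
  rw [h₁, h₂]
  exact hY A' B' hA' hB'

/-- The Markov property at a deterministic time: the stopped path and the path of increments
are independent, the latter being a Brownian path started at the origin. -/
theorem IsBrownianLaw.map_stopAt_incrAt {x : Eucl d} {P Q : Measure (PathSpace d)}
    (hP : IsBrownianLaw x P) (hQ : IsBrownianLaw 0 Q) (t : ℝ≥0) :
    P.map (fun ω => (PathEstimate.stopAt t ω, PathEstimate.incrAt t ω)) =
      (P.map (PathEstimate.stopAt t)).prod Q := by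
  have := hP.isProbabilityMeasure
  rw [(indepFun_iff_map_prod_eq_prod_map_map (measurable_stopAt t).aemeasurable
    (measurable_incrAt t).aemeasurable).1 (hP.indepFun_stopAt_incrAt t), (hP.incrAt t).unique hQ]

theorem IsBrownianLaw.lintegral_markov {x : Eucl d} {P Q : Measure (PathSpace d)}
    (hP : IsBrownianLaw x P) (hQ : IsBrownianLaw 0 Q) (t : ℝ≥0)
    {f : PathSpace d × PathSpace d → ℝ≥0∞} (hf : Measurable f) :
    ∫⁻ ω, f (PathEstimate.stopAt t ω, PathEstimate.incrAt t ω) ∂P =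
      ∫⁻ ω, ∫⁻ ω', f (PathEstimate.stopAt t ω, ω') ∂Q ∂P := by
  have := hQ.isProbabilityMeasure
  rw [← lintegral_map (f := f) hf ((measurable_stopAt t).prodMk (measurable_incrAt t)),
    hP.map_stopAt_incrAt hQ t, lintegral_prod _ hf.aemeasurable,
    lintegral_map hf.lintegral_prod_right' (measurable_stopAt t)]

theorem IsBrownianLaw.map_eval {Q : Measure (PathSpace d)} (hQ : IsBrownianLaw 0 Q) (t : ℝ≥0) :
    Q.map (fun ω => ω t) = (stdGaussian (Eucl d)).map (fun z => (√(t : ℝ)) • z) := by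
  have := hQ.isProbabilityMeasure
  have h1 := (hQ.iIndepFun_coord.comp (fun _ z => z t) fun _ => measurable_pi_apply t)
    |>.map_fun_eq_pi_map fun i => ((measurable_pi_apply t).comp (measurable_coord i)).aemeasurable
  have h2 : ∀ i, Q.map ((fun z : ℝ≥0 → ℝ => z t) ∘ fun (ω : PathSpace d) s => ω s i) =
      (gaussianReal 0 1).map (fun z => √(t : ℝ) * z) := by
    intro i
    have h := ((hQ.isBrownianReal i).hasLaw_eval t).map_eq
    simp only [PiLp.zero_apply, sub_zero] at h
    rw [gaussianReal_map_const_mul]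
    have : Q.map ((fun z : ℝ≥0 → ℝ => z t) ∘ fun (ω : PathSpace d) s => ω s i) =
      Q.map (fun ω => ω t i) := rfl
    rw [this, h]
    congr 1
    · simp
    · ext; simp
  simp_rw [h2] at h1
  rw [← Measure.pi_map_pi (fun i => by fun_prop)] at h1
  rw [← map_pi_eq_stdGaussian, Measure.map_map (by fun_prop) (WithLp.measurable_toLp 2 _)]
  have h3 := congrArg (Measure.map (WithLp.toLp 2 : (Fin d → ℝ) → Eucl d)) h1
  rw [Measure.map_map (WithLp.measurable_toLp 2 _)
    (measurable_pi_lambda _ fun i => (measurable_pi_apply t).comp (measurable_coord i)),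
    Measure.map_map (WithLp.measurable_toLp 2 _) (by fun_prop)] at h3
  exact h3

end PathEstimate

/-! ### The heat kernel of killed Brownian motion: density bound, semigroup law, symmetry. -/

namespace PathEstimate

variable {d : ℕ}

/-- Comparing the measures on boxes suffices, because `OuterMeasure.pi` is the largest outer measure
below the product on boxes. -/
theorem pi_mono_measure {ι : Type*} [Fintype ι] {α : ι → Type*} [∀ i, MeasurableSpace (α i)]
    {μ ν : ∀ i, Measure (α i)} [∀ i, SigmaFinite (μ i)] [∀ i, SigmaFinite (ν i)]
    (h : ∀ i, μ i ≤ ν i) : Measure.pi μ ≤ Measure.pi ν := by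
  refine Measure.le_iff.2 fun s hs => ?_
  rw [Measure.pi_def ν, toMeasure_apply _ _ hs]
  have : (Measure.pi μ).toOuterMeasure ≤ OuterMeasure.pi fun i => (ν i).toOuterMeasure := by
    rw [OuterMeasure.le_pi]
    intro t _
    change Measure.pi μ (univ.pi t) ≤ _
    rw [Measure.pi_pi]
    exact Finset.prod_le_prod' fun i _ => h i (t i)
  exact this s

theorem gaussianReal_le_smul_volume : gaussianReal 0 1 ≤ (volume : Measure ℝ) := by
  rw [gaussianReal_of_var_ne_zero _ one_ne_zero]
  refine Measure.le_iff.2 fun s hs => ?_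
  rw [withDensity_apply _ hs]
  refine (lintegral_mono (g := fun _ => 1) fun x => ?_).trans (by simp)
  rw [gaussianPDF_def, ENNReal.ofReal_le_one, gaussianPDFReal]
  have h1 : Real.exp (-(x - 0) ^ 2 / (2 * ((1 : ℝ≥0) : ℝ))) ≤ 1 :=
    Real.exp_le_one_iff.2 (by rw [neg_div]; exact neg_nonpos.2 (by positivity))
  have h2 : (√(2 * Real.pi * ((1 : ℝ≥0) : ℝ)))⁻¹ ≤ 1 := by
    refine inv_le_one_of_one_le₀ (Real.one_le_sqrt.2 ?_)
    have := Real.pi_gt_three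
    simp; linarith
  exact mul_le_one₀ h2 (Real.exp_nonneg _) h1

theorem stdGaussian_le_volume : stdGaussian (Eucl d) ≤ volume := by
  rw [← map_pi_eq_stdGaussian, ← (PiLp.volume_preserving_toLp (Fin d)).map_eq]
  exact Measure.map_mono (pi_mono_measure fun _ => gaussianReal_le_smul_volume)
    (WithLp.measurable_toLp 2 _)

/-- The Gaussian law of a Brownian path at time `t` has density at most `t ^ (-d / 2)`. -/
theorem stdGaussian_map_smul_le {t : ℝ} (ht : 0 < t) :
    (stdGaussian (Eucl d)).map (fun z => √t • z) ≤
      ENNReal.ofReal (((√t) ^ d)⁻¹) • (volume : Measure (Eucl d)) := by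
  refine (Measure.map_mono stdGaussian_le_volume (by fun_prop)).trans (le_of_eq ?_)
  rw [Measure.map_addHaar_smul _ (Real.sqrt_pos.2 ht).ne', finrank_euclideanSpace_fin,
    abs_of_nonneg (by positivity)]

/-- The paths that stay in `D` up to time `t`. -/
def stay (D : Set (Eucl d)) (t : ℝ≥0) : Set (PathSpace d) := {ω | MapsTo ω (Icc 0 t) D}

theorem mem_stay {D : Set (Eucl d)} {t : ℝ≥0} {ω : PathSpace d} :
    ω ∈ stay D t ↔ ∀ s ≤ t, ω s ∈ D := by
  simp [stay, MapsTo]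

theorem measurableSet_stay {D : Set (Eucl d)} (hD : IsOpen D) (t : ℝ≥0) :
    MeasurableSet (stay D t) :=
  (ContinuousMap.isOpen_setOfPred_mapsTo isCompact_Icc hD).measurableSet

theorem measurable_eval_add (t : ℝ≥0) :
    Measurable fun p : Eucl d × PathSpace d => p.1 + p.2 t :=
  measurable_fst.add ((measurable_path_eval t).comp measurable_snd)

theorem measurableSet_translate_stay {D : Set (Eucl d)} (hD : IsOpen D) (t : ℝ≥0) :
    MeasurableSet {p : Eucl d × PathSpace d | translate p.1 p.2 ∈ stay D t} :=
  measurable_translate_uncurry (measurableSet_stay hD t)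

/-- The heat kernel of Brownian motion killed on leaving the open set `D`, where `Q` is the law of
Brownian motion started at the origin. -/
noncomputable def killedKernel (Q : Measure (PathSpace d)) [IsProbabilityMeasure Q]
    {D : Set (Eucl d)} (hD : IsOpen D) (t : ℝ≥0) : Kernel (Eucl d) (Eucl d) where
  toFun x := (Q.restrict {ω | translate x ω ∈ stay D t}).map fun ω => x + ω t
  measurable' := by
    refine Measure.measurable_of_measurable_coe _ fun B hB => ?_
    have h : ∀ x, (Q.restrict {ω | translate x ω ∈ stay D t}).map (fun ω => x + ω t) B =
        Q (Prod.mk x ⁻¹' ({p : Eucl d × PathSpace d | p.1 + p.2 t ∈ B} ∩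
          {p | translate p.1 p.2 ∈ stay D t})) := by
      intro x
      have hm : Measurable fun ω : PathSpace d => x + ω t := (measurable_path_eval t).const_add x
      rw [Measure.map_apply hm hB, Measure.restrict_apply (hm hB)]
      rfl
    simp_rw [h]
    exact measurable_measure_prodMk_left
      ((measurable_eval_add t hB).inter (measurableSet_translate_stay hD t))

variable (Q : Measure (PathSpace d)) [IsProbabilityMeasure Q] {D : Set (Eucl d)} (hD : IsOpen D)

theorem killedKernel_apply (t : ℝ≥0) (x : Eucl d) :
    killedKernel Q hD t x = (Q.restrict {ω | translate x ω ∈ stay D t}).map fun ω => x + ω t := rfl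

theorem measurableSet_translate_mem_stay {D : Set (Eucl d)} (hD : IsOpen D) (t : ℝ≥0) (x : Eucl d) :
    MeasurableSet {ω | translate x ω ∈ stay D t} :=
  measurable_translate x (measurableSet_stay hD t)

theorem lintegral_killedKernel (t : ℝ≥0) (x : Eucl d) {f : Eucl d → ℝ≥0∞} (hf : Measurable f) :
    ∫⁻ y, f y ∂(killedKernel Q hD t x) =
      ∫⁻ ω, (stay D t).indicator 1 (translate x ω) * f (x + ω t) ∂Q := by
  have hm : Measurable fun ω : PathSpace d => x + ω t := (measurable_path_eval t).const_add x
  rw [killedKernel_apply, lintegral_map hf hm,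
    ← lintegral_indicator (measurableSet_translate_mem_stay hD t x)]
  congr 1 with ω
  by_cases h : translate x ω ∈ stay D t <;> simp [indicator, h]

theorem killedKernel_univ (t : ℝ≥0) (x : Eucl d) :
    killedKernel Q hD t x univ = Q {ω | translate x ω ∈ stay D t} := by
  have hm : Measurable fun ω : PathSpace d => x + ω t := (measurable_path_eval t).const_add x
  rw [killedKernel_apply, Measure.map_apply hm MeasurableSet.univ]
  simp

theorem killedKernel_univ_le_one (t : ℝ≥0) (x : Eucl d) : killedKernel Q hD t x univ ≤ 1 := by
  rw [killedKernel_univ]; exact prob_le_one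

instance isFiniteKernel_killedKernel (t : ℝ≥0) : IsFiniteKernel (killedKernel Q hD t) :=
  ⟨⟨1, ENNReal.one_lt_top, killedKernel_univ_le_one Q hD t⟩⟩

theorem killedKernel_le_map (t : ℝ≥0) (x : Eucl d) :
    killedKernel Q hD t x ≤ (Q.map fun ω => ω t).map (fun z => x + z) := by
  rw [Measure.map_map (measurable_const_add x) (measurable_path_eval t), killedKernel_apply]
  exact Measure.map_mono Measure.restrict_le_self ((measurable_path_eval t).const_add x)

variable {Q}

theorem killedKernel_le_volume (hQ : IsBrownianLaw 0 Q) {t : ℝ≥0} (ht : 0 < t) (x : Eucl d) :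
    killedKernel Q hD t x ≤ ENNReal.ofReal (((√(t : ℝ)) ^ d)⁻¹) • (volume : Measure (Eucl d)) := by
  refine (killedKernel_le_map Q hD t x).trans ?_
  rw [hQ.map_eval t]
  refine (Measure.map_mono (stdGaussian_map_smul_le (NNReal.coe_pos.2 ht))
    (measurable_const_add x)).trans (le_of_eq ?_)
  rw [Measure.map_smul, (measurePreserving_add_left volume x).map_eq]

theorem killedKernel_tail (hQ : IsBrownianLaw 0 Q) {t : ℝ≥0} (ht : 0 < t) (x : Eucl d) (k : ℝ) :
    killedKernel Q hD t x {y | k * √(t : ℝ) ≤ ‖y - x‖} ≤ stdGaussian (Eucl d) {z | k ≤ ‖z‖} := by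
  refine (killedKernel_le_map Q hD t x _).trans (le_of_eq ?_)
  have hs : 0 < √(t : ℝ) := Real.sqrt_pos.2 (NNReal.coe_pos.2 ht)
  have hms : Measurable fun z : Eucl d => √(t : ℝ) • z := by fun_prop
  rw [hQ.map_eval t, Measure.map_map (measurable_const_add x) hms,
    Measure.map_apply ((measurable_const_add x).comp hms)
      (measurableSet_le measurable_const (by fun_prop))]
  congr 1 with z
  simp [norm_smul, abs_of_pos hs, mul_comm k, hs]

/-- The Chapman–Kolmogorov equation, from the Markov property at time `s`: surviving up to `s + t`
splits into survival of the stopped path and survival of the increments restarted at `x + ω s`. -/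
theorem lintegral_killedKernel_add (hQ : IsBrownianLaw 0 Q) (s t : ℝ≥0) (x : Eucl d)
    {f : Eucl d → ℝ≥0∞} (hf : Measurable f) :
    ∫⁻ y, f y ∂(killedKernel Q hD (s + t) x) =
      ∫⁻ y, ∫⁻ z, f z ∂(killedKernel Q hD t y) ∂(killedKernel Q hD s x) := by
  have hf' : Measurable fun y => ∫⁻ z, f z ∂(killedKernel Q hD t y) := hf.lintegral_kernel
  rw [lintegral_killedKernel Q hD _ x hf, lintegral_killedKernel Q hD _ x hf']
  let g : PathSpace d × PathSpace d → ℝ≥0∞ := fun p =>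
    (stay D s).indicator 1 (translate x p.1) *
      ((stay D t).indicator 1 (translate (x + p.1 s) p.2) * f (x + p.1 s + p.2 t))
  have hg : Measurable g := by
    have h1 : Measurable ((stay D s).indicator (1 : PathSpace d → ℝ≥0∞)) :=
      measurable_one.indicator (measurableSet_stay hD s)
    have h2 : Measurable ((stay D t).indicator (1 : PathSpace d → ℝ≥0∞)) :=
      measurable_one.indicator (measurableSet_stay hD t)
    have h3 : Measurable fun p : PathSpace d × PathSpace d => (x + p.1 s, p.2) :=
      (((measurable_path_eval s).comp measurable_fst).const_add x).prodMk measurable_snd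
    exact (h1.comp ((measurable_translate x).comp measurable_fst)).mul
      ((h2.comp (measurable_translate_uncurry.comp h3)).mul
        (hf.comp ((measurable_eval_add t).comp h3)))
  have hl : ∀ ω : PathSpace d,
      (stay D (s + t)).indicator 1 (translate x ω) * f (x + ω (s + t)) =
        g (stopAt s ω, incrAt s ω) := by
    intro ω
    have h : translate x ω ∈ stay D (s + t) ↔ translate x (stopAt s ω) ∈ stay D s ∧
        translate (x + ω s) (incrAt s ω) ∈ stay D t := by
      simp only [mem_stay, translate_apply, stopAt_apply, incrAt_apply]
      constructor
      · refine fun h => ⟨fun u hu => ?_, fun u hu => ?_⟩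
        · rw [min_eq_left hu]; exact h u (hu.trans le_self_add)
        · have := h (s + u) (add_le_add_right hu s)
          simpa [add_assoc] using this
      · rintro ⟨h1, h2⟩ u hu
        rcases le_total u s with hus | hus
        · have := h1 u hus
          rwa [min_eq_left hus] at this
        · obtain ⟨v, rfl⟩ := exists_add_of_le hus
          have := h2 v (le_of_add_le_add_left hu)
          simpa [add_assoc] using this
    have e1 : x + ω s + (ω (s + t) - ω s) = x + ω (s + t) := by abel
    by_cases h1 : translate x (stopAt s ω) ∈ stay D s <;>
      by_cases h2 : translate (x + ω s) (incrAt s ω) ∈ stay D t <;>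
      simp [g, indicator, h, h1, h2, e1]
  simp_rw [hl]
  rw [hQ.lintegral_markov hQ s hg]
  congr 1 with ω
  rw [lintegral_killedKernel Q hD t _ hf, ← lintegral_const_mul']
  · have : translate x (stopAt s ω) ∈ stay D s ↔ translate x ω ∈ stay D s := by
      simp only [mem_stay, translate_apply, stopAt_apply]
      exact forall₂_congr fun u hu => by rw [min_eq_left hu]
    have e0 : stopAt s ω s = ω s := by simp
    simp only [g, e0]
    by_cases h : translate x ω ∈ stay D s <;> simp [indicator, this, h]
  · by_cases h : translate x ω ∈ stay D s <;> simp [indicator, h]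

/-- For a fixed path, the substitution `x ↦ x - ω t` preserves Lebesgue measure and makes the
translated path end at `x`. Read backwards it starts at `x` and visits the same points, so it stays
in `D` under the same condition; the reversed path has the same law. -/
theorem lintegral_volume_killedKernel_symm (hQ : IsBrownianLaw 0 Q) (t : ℝ≥0)
    {F : Eucl d × Eucl d → ℝ≥0∞} (hF : Measurable F) :
    ∫⁻ x, ∫⁻ y, F (x, y) ∂(killedKernel Q hD t x) =
      ∫⁻ x, ∫⁻ y, F (y, x) ∂(killedKernel Q hD t x) := by
  have h1 : Measurable ((stay D t).indicator (1 : PathSpace d → ℝ≥0∞)) :=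
      measurable_one.indicator (measurableSet_stay hD t)
  have hev := measurable_eval_add (d := d) t
  have e1 : ∀ x, ∫⁻ y, F (x, y) ∂(killedKernel Q hD t x) =
      ∫⁻ ω, (stay D t).indicator 1 (translate x ω) * F (x, x + ω t) ∂Q := fun x =>
    lintegral_killedKernel Q hD t x (hF.comp measurable_prodMk_left)
  have e2 : ∀ x, ∫⁻ y, F (y, x) ∂(killedKernel Q hD t x) =
      ∫⁻ ω, (stay D t).indicator 1 (translate x ω) * F (x + ω t, x) ∂Q := fun x =>
    lintegral_killedKernel Q hD t x (hF.comp measurable_prodMk_right)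
  simp_rw [e1, e2]
  have m1 : Measurable fun p : Eucl d × PathSpace d =>
      (stay D t).indicator 1 (translate p.1 p.2) * F (p.1, p.1 + p.2 t) :=
    (h1.comp measurable_translate_uncurry).mul (hF.comp (measurable_fst.prodMk hev))
  have m2 : Measurable fun p : Eucl d × PathSpace d =>
      (stay D t).indicator 1 (translate p.1 p.2) * F (p.1 + p.2 t, p.1) :=
    (h1.comp measurable_translate_uncurry).mul (hF.comp (hev.prodMk measurable_fst))
  rw [lintegral_lintegral_swap m1.aemeasurable]
  have hQ0 : ∀ᵐ ω ∂Q, ω 0 = 0 := by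
    have h : ∀ i : Fin d, ∀ᵐ ω ∂Q, ω 0 i = 0 := fun i => by
      have := (hQ.isBrownianReal i).eval_zero_ae_eq_zero
      simpa using this
    filter_upwards [ae_all_iff.2 h] with ω hω
    ext i; exact hω i
  have h2 : ∀ᵐ ω ∂Q, ∫⁻ x, (stay D t).indicator 1 (translate x ω) * F (x, x + ω t) =
      ∫⁻ x, (stay D t).indicator 1 (translate x (revAt t ω)) * F (x + revAt t ω t, x) := by
    filter_upwards [hQ0] with ω hω
    rw [← lintegral_add_right_eq_self _ (-ω t)]
    congr 1 with x
    have e3 : translate (x + -ω t) ω ∈ stay D t ↔ translate x (revAt t ω) ∈ stay D t := by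
      simp only [mem_stay, translate_apply, revAt_apply]
      constructor
      · intro h s hs
        have := h (t - s) tsub_le_self
        rw [max_eq_right hs]
        convert this using 1
        abel
      · intro h s hs
        have := h (t - s) tsub_le_self
        rw [max_eq_right tsub_le_self, tsub_tsub_cancel_of_le hs] at this
        convert this using 1
        abel
    -- The endpoint of the reversed path is `ω 0 - ω t`, which is why `ω 0 = 0` is needed.
    have e4 : revAt t ω t = -ω t := by simp [hω]
    rw [e4]
    by_cases h : translate x (revAt t ω) ∈ stay D t <;>
      simp [indicator, e3, h]
  rw [lintegral_congr_ae h2]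
  have hr : Q.map (revAt t) = Q := (hQ.revAt t).unique hQ
  have m3 : Measurable fun ω : PathSpace d =>
      ∫⁻ x, (stay D t).indicator 1 (translate x ω) * F (x + ω t, x) :=
    m2.lintegral_prod_left'
  rw [← lintegral_map (f := fun ω : PathSpace d =>
      ∫⁻ x, (stay D t).indicator 1 (translate x ω) * F (x + ω t, x)) m3 (measurable_revAt t), hr,
    lintegral_lintegral_swap]
  exact (m2.comp measurable_swap).aemeasurable

theorem map_swap_compProd_killedKernel (hQ : IsBrownianLaw 0 Q) (t : ℝ≥0) :
    (volume ⊗ₘ killedKernel Q hD t).map Prod.swap = volume ⊗ₘ killedKernel Q hD t := by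
  ext S hS
  rw [Measure.map_apply measurable_swap hS, ← lintegral_indicator_one hS,
    ← lintegral_indicator_one (measurable_swap hS),
    Measure.lintegral_compProd (measurable_one.indicator hS),
    Measure.lintegral_compProd (measurable_one.indicator (measurable_swap hS)),
    lintegral_volume_killedKernel_symm hD hQ t (measurable_one.indicator hS)]
  rfl

end PathEstimate

/-! ### Self-adjoint contraction semigroups in a C⋆-algebra. -/

namespace PathEstimate

theorem abs_exp_sub_one_sub_le (x : ℝ) : |Real.exp x - 1 - x| ≤ x ^ 2 * Real.exp |x| := by
  have h := Complex.norm_exp_sub_sum_le_norm_mul_exp (x : ℂ) 2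
  rw [Finset.sum_range_succ, Finset.sum_range_one] at h
  have e : Complex.exp (x : ℂ) - ((x : ℂ) ^ 0 / (Nat.factorial 0 : ℂ) +
      (x : ℂ) ^ 1 / (Nat.factorial 1 : ℂ)) = ((Real.exp x - 1 - x : ℝ) : ℂ) := by
    push_cast; simp [sub_sub]
  rw [e, Complex.norm_real, Complex.norm_real, Real.norm_eq_abs, Real.norm_eq_abs, sq_abs] at h
  exact h

/-- Second-order Taylor bound for `t ↦ l ^ t` on `[0, 1]`, uniform in the base. -/
theorem abs_rpow_taylor_le {l t a : ℝ} (hl0 : 0 ≤ l) (hl1 : l ≤ 1) (ht : 0 < t)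
    (ha : |a| ≤ t / 2) :
    |l ^ (t + a) - l ^ t - a * (t⁻¹ * (l ^ t * Real.log (l ^ t)))| ≤ 8 * a ^ 2 / t ^ 2 := by
  rcases hl0.eq_or_lt with rfl | hl
  · have h := abs_le.1 ha
    rw [Real.zero_rpow (by linarith), Real.zero_rpow ht.ne']
    simp; positivity
  -- With `L = -log l ≥ 0` the left side is `exp(-tL) |exp(-aL) - 1 + aL|`, at most `(aL)²
  -- exp(-tL/2)`. For `y = tL/2` this is `4 a² / t²` times `y² exp(-y) ≤ 2`, a bound free of `l`.
  set L := -Real.log l with hL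
  have hL0 : 0 ≤ L := by rw [hL]; exact neg_nonneg.2 (Real.log_nonpos hl0 hl1)
  have hlog : Real.log l = -L := by rw [hL, neg_neg]
  have e1 : l ^ (t + a) = Real.exp (-(t * L)) * Real.exp (-(a * L)) := by
    rw [Real.rpow_def_of_pos hl, hlog, ← Real.exp_add]; congr 1; ring
  have e2 : l ^ t = Real.exp (-(t * L)) := by
    rw [Real.rpow_def_of_pos hl, hlog]; congr 1; ring
  rw [e1, e2, Real.log_exp]
  have e3 : Real.exp (-(t * L)) * Real.exp (-(a * L)) - Real.exp (-(t * L)) -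
      a * (t⁻¹ * (Real.exp (-(t * L)) * -(t * L))) =
      Real.exp (-(t * L)) * (Real.exp (-(a * L)) - 1 - -(a * L)) := by
    field_simp
  rw [e3, abs_mul, abs_of_pos (Real.exp_pos _)]
  have h1 := abs_exp_sub_one_sub_le (-(a * L))
  have h2 : |-(a * L)| ≤ t * L / 2 := by
    rw [abs_neg, abs_mul, abs_of_nonneg hL0]; nlinarith
  have h3 : Real.exp (-(t * L)) * Real.exp |-(a * L)| ≤ Real.exp (-(t * L / 2)) := by
    rw [← Real.exp_add]; exact Real.exp_le_exp.2 (by linarith)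
  set y := t * L / 2 with hy
  have hy0 : 0 ≤ y := by positivity
  have h4 : y ^ 2 * Real.exp (-y) ≤ 2 := by
    have := Real.quadratic_le_exp_of_nonneg hy0
    rw [Real.exp_neg, ← div_eq_mul_inv, div_le_iff₀ (Real.exp_pos _)]
    nlinarith
  calc Real.exp (-(t * L)) * |Real.exp (-(a * L)) - 1 - -(a * L)|
      ≤ Real.exp (-(t * L)) * ((-(a * L)) ^ 2 * Real.exp |-(a * L)|) := by gcongr
    _ = (a * L) ^ 2 * (Real.exp (-(t * L)) * Real.exp |-(a * L)|) := by ring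
    _ ≤ (a * L) ^ 2 * Real.exp (-y) := by gcongr
    _ = 4 * a ^ 2 / t ^ 2 * (y ^ 2 * Real.exp (-y)) := by rw [hy]; field_simp; ring
    _ ≤ 4 * a ^ 2 / t ^ 2 * 2 := by gcongr
    _ = 8 * a ^ 2 / t ^ 2 := by ring

section CStar

variable {𝒜 : Type*} [CStarAlgebra 𝒜] [PartialOrder 𝒜] [StarOrderedRing 𝒜]

theorem continuous_rpow_const_of_pos {t : ℝ} (ht : 0 < t) : Continuous fun l : ℝ => l ^ t :=
  continuous_id.rpow_const fun _ => Or.inr ht.le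

theorem cfc_rpow_add {A : 𝒜} (hA : 0 ≤ A) {s t : ℝ} (hs : 0 < s) (ht : 0 < t) :
    cfc (fun l : ℝ => l ^ (s + t)) A = cfc (fun l : ℝ => l ^ s) A * cfc (fun l : ℝ => l ^ t) A := by
  rw [← cfc_mul _ _ _ (continuous_rpow_const_of_pos hs).continuousOn
    (continuous_rpow_const_of_pos ht).continuousOn]
  exact cfc_congr fun l hl => Real.rpow_add_of_nonneg (spectrum_nonneg_of_nonneg hA hl) hs.le ht.le

theorem cfc_rpow_nonneg {A : 𝒜} (hA : 0 ≤ A) (t : ℝ) : 0 ≤ cfc (fun l : ℝ => l ^ t) A :=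
  cfc_nonneg fun _ hl => Real.rpow_nonneg (spectrum_nonneg_of_nonneg hA hl) t

theorem norm_cfc_rpow_taylor_le {A : 𝒜} (hA : 0 ≤ A) (hA1 : ‖A‖ ≤ 1) {t a : ℝ} (ht : 0 < t)
    (ha : |a| ≤ t / 2) :
    ‖cfc (fun l : ℝ => l ^ (t + a)) A - cfc (fun l : ℝ => l ^ t) A -
      a • cfc (fun l : ℝ => t⁻¹ * (l ^ t * Real.log (l ^ t))) A‖ ≤ 8 * a ^ 2 / t ^ 2 := by
  have hta : 0 < t + a := by have := abs_le.1 ha; linarith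
  have c1 := (continuous_rpow_const_of_pos hta).continuousOn (s := spectrum ℝ A)
  have c2 := (continuous_rpow_const_of_pos ht).continuousOn (s := spectrum ℝ A)
  -- Writing the derivative through `l ^ t * log (l ^ t)` makes its continuity at `l = 0` visible,
  -- as the continuous functional calculus requires.
  have c3 : ContinuousOn (fun l : ℝ => t⁻¹ * (l ^ t * Real.log (l ^ t))) (spectrum ℝ A) :=
    (continuous_const.mul
      (Real.continuous_mul_log.comp (continuous_rpow_const_of_pos ht))).continuousOn
  rw [← cfc_sub _ _ _ c1 c2, ← cfc_const_mul a _ _ c3,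
    ← cfc_sub (fun l : ℝ => l ^ (t + a) - l ^ t)
      (fun l : ℝ => a * (t⁻¹ * (l ^ t * Real.log (l ^ t)))) _ (c1.sub c2)
      (continuousOn_const.mul c3)]
  refine norm_cfc_le (by positivity) fun l hl => ?_
  rw [Real.norm_eq_abs]
  have hl1 : l ≤ 1 := by
    have : Nontrivial 𝒜 := by
      by_contra hn
      have := not_nontrivial_iff_subsingleton.1 hn
      simp [spectrum.of_subsingleton] at hl
    have h := spectrum.norm_le_norm_of_mem hl
    exact (le_abs_self l).trans (h.trans hA1)
  exact abs_rpow_taylor_le (spectrum_nonneg_of_nonneg hA hl) hl1 ht ha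

variable {T : ℝ → 𝒜}

/-- `T t` is the square of the self-adjoint element `T (t / 2)`. -/
theorem semigroup_nonneg (hsa : ∀ t, 0 < t → IsSelfAdjoint (T t))
    (hadd : ∀ s t, 0 < s → 0 < t → T (s + t) = T s * T t) {t : ℝ} (ht : 0 < t) : 0 ≤ T t := by
  have h := star_mul_self_nonneg (T (t / 2))
  rwa [(hsa _ (by positivity)).star_eq, ← hadd _ _ (by positivity) (by positivity),
    add_halves] at h

/-- `T s - T t` is the conjugate of `1 - T (t - s) ≥ 0` by `T (s / 2)`. This monotonicity takes the
place of a continuity assumption on the semigroup. -/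
theorem semigroup_antitone (hsa : ∀ t, 0 < t → IsSelfAdjoint (T t))
    (hnorm : ∀ t, 0 < t → ‖T t‖ ≤ 1)
    (hadd : ∀ s t, 0 < s → 0 < t → T (s + t) = T s * T t) {s t : ℝ} (hs : 0 < s) (hst : s < t) :
    T t ≤ T s := by
  have h1 : 0 ≤ 1 - T (t - s) := sub_nonneg.2
    ((CStarAlgebra.norm_le_one_iff_of_nonneg _
      (semigroup_nonneg hsa hadd (sub_pos.2 hst))).1 (hnorm _ (sub_pos.2 hst)))
  have hs2 : 0 < s / 2 := by positivity
  have h2 := IsSelfAdjoint.conjugate_nonneg h1 (hsa (s / 2) hs2)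
  have e : T (s / 2) * (1 - T (t - s)) * T (s / 2) = T s - T t := by
    have hc : T t = T (s / 2) * T (t - s) * T (s / 2) := by
      rw [← hadd _ _ hs2 (sub_pos.2 hst), ← hadd _ _ (by linarith) hs2]
      congr 1; ring
    have hc' : T s = T (s / 2) * T (s / 2) := by rw [← hadd _ _ hs2 hs2, add_halves]
    rw [hc, hc']; noncomm_ring
  rw [e] at h2
  exact sub_nonneg.1 h2

/-- Both sides are positive square roots of the same positive element, and such a root is unique. -/
theorem semigroup_dyadic (hsa : ∀ t, 0 < t → IsSelfAdjoint (T t))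
    (hadd : ∀ s t, 0 < s → 0 < t → T (s + t) = T s * T t) (n : ℕ) :
    T (1 / 2 ^ n) = cfc (fun l : ℝ => l ^ ((1 : ℝ) / 2 ^ n)) (T 1) := by
  have hA := semigroup_nonneg hsa hadd one_pos
  induction n with
  | zero => simp [cfc_id' ℝ (T 1) (hsa 1 one_pos)]
  | succ n ih =>
    have hp : (0 : ℝ) < 1 / 2 ^ (n + 1) := by positivity
    have e : (1 : ℝ) / 2 ^ (n + 1) + 1 / 2 ^ (n + 1) = 1 / 2 ^ n := by
      rw [pow_succ]; field_simp; norm_num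
    have h1 := hadd _ _ hp hp
    have h2 := cfc_rpow_add hA hp hp
    rw [e] at h1 h2
    rw [← CFC.sqrt_unique (h1.symm) (semigroup_nonneg hsa hadd hp), ih]
    exact CFC.sqrt_unique h2.symm (cfc_rpow_nonneg hA _)

theorem semigroup_dyadic_mul (hsa : ∀ t, 0 < t → IsSelfAdjoint (T t))
    (hadd : ∀ s t, 0 < s → 0 < t → T (s + t) = T s * T t) (n k : ℕ) :
    T ((k + 1) / 2 ^ n) = cfc (fun l : ℝ => l ^ (((k : ℝ) + 1) / 2 ^ n)) (T 1) := by
  have hA := semigroup_nonneg hsa hadd one_pos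
  induction k with
  | zero => simpa using semigroup_dyadic hsa hadd n
  | succ k ih =>
    have e : (((k + 1 : ℕ) : ℝ) + 1) / 2 ^ n = ((k : ℝ) + 1) / 2 ^ n + 1 / 2 ^ n := by
      push_cast; ring
    rw [e, hadd _ _ (by positivity) (by positivity),
      cfc_rpow_add hA (by positivity) (by positivity), ih, semigroup_dyadic hsa hadd n]

theorem exists_dyadic_between {t δ : ℝ} (ht : 0 < t) (hδ : 0 < δ) :
    ∃ n k m : ℕ, ((k : ℝ) + 1) / 2 ^ n < t ∧ t - δ < ((k : ℝ) + 1) / 2 ^ n ∧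
      t < ((m : ℝ) + 1) / 2 ^ n ∧ ((m : ℝ) + 1) / 2 ^ n < t + δ := by
  obtain ⟨n, hn⟩ := exists_pow_lt_of_lt_one (lt_min (half_pos ht) (half_pos hδ))
    (by norm_num : (1 / 2 : ℝ) < 1)
  have hn1 := hn.trans_le (min_le_left _ _)
  have hn2 := hn.trans_le (min_le_right _ _)
  have hp : (0 : ℝ) < 2 ^ n := by positivity
  rw [div_pow, one_pow, div_lt_iff₀ hp] at hn1 hn2
  set j := ⌊t * 2 ^ n⌋₊
  have h1 : (j : ℝ) ≤ t * 2 ^ n := Nat.floor_le (by positivity)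
  have h2 : t * 2 ^ n < j + 1 := Nat.lt_floor_add_one _
  have h3 : 1 < j := by
    have : (1 : ℝ) < j := by nlinarith
    exact_mod_cast this
  -- The lower numerator is `k + 1 = j - 1` rather than `j`: the inequality must be strict even if
  -- `t` is dyadic.
  obtain ⟨k, hk⟩ : ∃ k, j = k + 2 := ⟨j - 2, by omega⟩
  have hk' : (j : ℝ) = k + 2 := by rw [hk]; push_cast; ring
  refine ⟨n, k, j, ?_, ?_, ?_, ?_⟩
  · rw [div_lt_iff₀ hp]; linarith
  · rw [lt_div_iff₀ hp]; nlinarith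
  · rw [lt_div_iff₀ hp]; linarith
  · rw [div_lt_iff₀ hp]; nlinarith

/-- A self-adjoint contraction semigroup consists of the powers of its value at time one. -/
theorem semigroup_eq_cfc_rpow (hsa : ∀ t, 0 < t → IsSelfAdjoint (T t))
    (hnorm : ∀ t, 0 < t → ‖T t‖ ≤ 1)
    (hadd : ∀ s t, 0 < s → 0 < t → T (s + t) = T s * T t) {t : ℝ} (ht : 0 < t) :
    T t = cfc (fun l : ℝ => l ^ t) (T 1) := by
  have hA := semigroup_nonneg hsa hadd one_pos
  have hA1 := hnorm 1 one_pos
  set R : ℝ → 𝒜 := fun t => cfc (fun l : ℝ => l ^ t) (T 1) with hR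
  set D := cfc (fun l : ℝ => t⁻¹ * (l ^ t * Real.log (l ^ t))) (T 1) with hD
  have hlip : ∀ a, |a| ≤ t / 2 → |a| ≤ 1 → ‖R (t + a) - R t‖ ≤ |a| * (8 / t ^ 2 + ‖D‖) := by
    intro a ha ha1
    have h := norm_cfc_rpow_taylor_le hA hA1 ht ha
    have h2 : ‖R (t + a) - R t‖ ≤ ‖R (t + a) - R t - a • D‖ + ‖a • D‖ := by
      simpa using norm_add_le (R (t + a) - R t - a • D) (a • D)
    rw [norm_smul, Real.norm_eq_abs] at h2
    have h3 : 8 * a ^ 2 / t ^ 2 ≤ |a| * (8 / t ^ 2) := by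
      rw [← sq_abs, mul_div_assoc', mul_comm]
      gcongr
      nlinarith [abs_nonneg a]
    linarith
  set M := 8 / t ^ 2 + ‖D‖ with hM
  have hM0 : 0 ≤ M := by positivity
  rw [← sub_eq_zero, ← norm_le_zero_iff]
  refine le_of_forall_pos_le_add fun ε hε => ?_
  -- The distance from `T t` to `R t` will be at most `‖R p - R q‖ + ‖R q - R t‖ ≤ 2 δ M + δ M`.
  obtain ⟨δ, hδ, hδ'⟩ : ∃ δ > 0, 3 * (δ * M) ≤ ε ∧ δ ≤ t / 2 ∧ δ ≤ 1 := by
    refine ⟨min (ε / (3 * (M + 1))) (min (t / 2) 1), by positivity, ?_, ?_, ?_⟩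
    · have h1 : min (ε / (3 * (M + 1))) (min (t / 2) 1) ≤ ε / (3 * (M + 1)) := min_le_left _ _
      have h2 : ε / (3 * (M + 1)) * (3 * (M + 1)) = ε := by field_simp
      have h3 : 0 < ε / (3 * (M + 1)) := by positivity
      nlinarith
    · exact (min_le_right _ _).trans (min_le_left _ _)
    · exact (min_le_right _ _).trans (min_le_right _ _)
  obtain ⟨n, k, m, hk1, hk2, hm1, hm2⟩ := exists_dyadic_between ht hδ
  set p := ((k : ℝ) + 1) / 2 ^ n with hp
  set q := ((m : ℝ) + 1) / 2 ^ n with hq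
  have hp0 : 0 < p := by positivity
  have hTp : T p = R p := semigroup_dyadic_mul hsa hadd n k
  have hTq : T q = R q := semigroup_dyadic_mul hsa hadd n m
  have h1 : T q ≤ T t := semigroup_antitone hsa hnorm hadd ht hm1
  have h2 : T t ≤ T p := semigroup_antitone hsa hnorm hadd hp0 hk1
  -- Since `T q ≤ T t ≤ T p` and `T` agrees with `R` at dyadic times, `0 ≤ T t - R q ≤ R p - R q`,
  -- and the norm is monotone on positive elements.
  have h3 : ‖T t - R q‖ ≤ ‖R p - R q‖ := by
    rw [← hTq, ← hTp]
    exact CStarAlgebra.norm_le_norm_of_nonneg_of_le (sub_nonneg.2 h1) (sub_le_sub_right h2 _)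
  have habs : ∀ a, |a| ≤ δ → ‖R (t + a) - R t‖ ≤ δ * M := fun a ha =>
    (hlip a (ha.trans hδ'.2.1) (ha.trans hδ'.2.2)).trans (by gcongr)
  have h4 : ‖R p - R t‖ ≤ δ * M := by
    have := habs (p - t) (by rw [abs_le]; constructor <;> linarith)
    rwa [add_sub_cancel] at this
  have h5 : ‖R q - R t‖ ≤ δ * M := by
    have := habs (q - t) (by rw [abs_le]; constructor <;> linarith)
    rwa [add_sub_cancel] at this
  have h6 : ‖R p - R q‖ ≤ ‖R p - R t‖ + ‖R q - R t‖ := by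
    simpa using norm_sub_le (R p - R t) (R q - R t)
  have h7 : ‖T t - R t‖ ≤ ‖T t - R q‖ + ‖R q - R t‖ := by
    simpa using norm_add_le (T t - R q) (R q - R t)
  change ‖T t - R t‖ ≤ 0 + ε
  linarith [hδ'.1]

/-- A self-adjoint contraction semigroup is differentiable in operator norm, with a quantitative
second-order remainder. -/
theorem exists_semigroup_taylor (hsa : ∀ t, 0 < t → IsSelfAdjoint (T t))
    (hnorm : ∀ t, 0 < t → ‖T t‖ ≤ 1)
    (hadd : ∀ s t, 0 < s → 0 < t → T (s + t) = T s * T t) :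
    ∃ D : ℝ → 𝒜, ∀ t a, 0 < t → |a| ≤ t / 2 →
      ‖T (t + a) - T t - a • D t‖ ≤ 8 * a ^ 2 / t ^ 2 := by
  refine ⟨fun t => cfc (fun l : ℝ => t⁻¹ * (l ^ t * Real.log (l ^ t))) (T 1), fun t a ht ha => ?_⟩
  have hta : 0 < t + a := by have := abs_le.1 ha; linarith
  rw [semigroup_eq_cfc_rpow hsa hnorm hadd ht, semigroup_eq_cfc_rpow hsa hnorm hadd hta]
  exact norm_cfc_rpow_taylor_le (semigroup_nonneg hsa hadd one_pos) (hnorm 1 one_pos) ht ha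

end CStar

end PathEstimate

/-! ### Symmetric sub-Markov kernels as operators on `L²`. -/

namespace PathEstimate

section KernelOp

variable {α : Type*} [MeasurableSpace α] {ν : Measure α}

/-- A sub-Markov kernel which is symmetric with respect to `ν` and has bounded densities. -/
structure IsSymmSubMarkov (ν : Measure α) (κ : Kernel α α) : Prop where
  univ_le_one : ∀ x, κ x univ ≤ 1
  map_swap : (ν ⊗ₘ κ).map Prod.swap = ν ⊗ₘ κ
  exists_le_smul : ∀ x, ∃ c : ℝ≥0∞, c ≠ ∞ ∧ κ x ≤ c • ν

theorem eLpNorm_two_sq {β E : Type*} [MeasurableSpace β] [NormedAddCommGroup E] (f : β → E)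
    (μ : Measure β) : eLpNorm f 2 μ ^ 2 = ∫⁻ x, ‖f x‖ₑ ^ 2 ∂μ := by
  have h := eLpNorm_nnreal_pow_eq_lintegral (f := f) (μ := μ) (p := 2) two_ne_zero
  simpa using h

/-- The Cauchy–Schwarz inequality against the function `1`, for a measure of mass at most one. -/
theorem enorm_integral_le_eLpNorm_two {β E : Type*} [MeasurableSpace β] [NormedAddCommGroup E]
    [NormedSpace ℝ E] {f : β → E} {μ : Measure β} (hμ : μ univ ≤ 1)
    (hf : AEStronglyMeasurable f μ) : ‖∫ x, f x ∂μ‖ₑ ≤ eLpNorm f 2 μ := by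
  refine (enorm_integral_le_lintegral_enorm f).trans ?_
  rw [← eLpNorm_one_eq_lintegral_enorm]
  refine (eLpNorm_le_eLpNorm_mul_rpow_measure_univ one_le_two hf).trans ?_
  refine mul_le_of_le_one_right' (ENNReal.rpow_le_one hμ ?_)
  norm_num

variable {κ : Kernel α α}

theorem IsSymmSubMarkov.isFiniteMeasure (h : IsSymmSubMarkov ν κ) (x : α) :
    IsFiniteMeasure (κ x) := ⟨(h.univ_le_one x).trans_lt ENNReal.one_lt_top⟩

theorem IsSymmSubMarkov.isFiniteKernel (h : IsSymmSubMarkov ν κ) : IsFiniteKernel κ :=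
  ⟨⟨1, ENNReal.one_lt_top, h.univ_le_one⟩⟩

theorem IsSymmSubMarkov.memLp (h : IsSymmSubMarkov ν κ) {f : α → ℂ} (hf : MemLp f 2 ν) (x : α) :
    MemLp f 2 (κ x) := by
  obtain ⟨c, hc, hle⟩ := h.exists_le_smul x
  exact hf.of_measure_le_smul hc hle

theorem IsSymmSubMarkov.integrable (h : IsSymmSubMarkov ν κ) {f : α → ℂ} (hf : MemLp f 2 ν)
    (x : α) : Integrable f (κ x) :=
  have := h.isFiniteMeasure x
  (h.memLp hf x).integrable one_le_two

/-- Domination of `κ x` by a multiple of `ν` makes integration against `κ x` well defined on `L²`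
classes for every `x`, not only for almost every one. -/
theorem IsSymmSubMarkov.ae_eq (h : IsSymmSubMarkov ν κ) {f g : α → ℂ} (hfg : f =ᵐ[ν] g) (x : α) :
    f =ᵐ[κ x] g := by
  obtain ⟨c, _, hle⟩ := h.exists_le_smul x
  exact (Measure.absolutelyContinuous_of_le_smul hle).ae_le hfg

theorem IsSymmSubMarkov.integral_congr (h : IsSymmSubMarkov ν κ) {f g : α → ℂ} (hfg : f =ᵐ[ν] g)
    (x : α) : ∫ y, f y ∂(κ x) = ∫ y, g y ∂(κ x) :=
  integral_congr_ae (h.ae_eq hfg x)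

/-- Symmetry turns the left side into the integral of `g x * κ x univ`. -/
theorem IsSymmSubMarkov.lintegral_lintegral_le [SigmaFinite ν] (h : IsSymmSubMarkov ν κ) {g : α → ℝ≥0∞}
    (hg : Measurable g) : ∫⁻ x, ∫⁻ y, g y ∂(κ x) ∂ν ≤ ∫⁻ x, g x ∂ν := by
  have := h.isFiniteKernel
  have e1 := Measure.lintegral_compProd (μ := ν) (κ := κ) (hg.comp measurable_snd)
  have e2 := Measure.lintegral_compProd (μ := ν) (κ := κ) (hg.comp measurable_fst)
  simp only [Function.comp_apply] at e1 e2
  rw [← e1]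
  conv_lhs => rw [← h.map_swap]
  rw [lintegral_map (f := fun p : α × α => g p.2) (hg.comp measurable_snd) measurable_swap]
  simp only [Prod.snd_swap, lintegral_const] at e2 ⊢
  rw [e2]
  exact lintegral_mono fun x => mul_le_of_le_one_right' (h.univ_le_one x)

theorem IsSymmSubMarkov.aestronglyMeasurable (h : IsSymmSubMarkov ν κ) {f : α → ℂ}
    (hf : MemLp f 2 ν) : AEStronglyMeasurable (fun x => ∫ y, f y ∂(κ x)) ν := by
  have e : (fun x => ∫ y, f y ∂(κ x)) = fun x => ∫ y, hf.1.mk f y ∂(κ x) :=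
    funext fun x => h.integral_congr hf.1.ae_eq_mk x
  rw [e]
  exact (hf.1.stronglyMeasurable_mk.integral_kernel).aestronglyMeasurable

theorem IsSymmSubMarkov.eLpNorm_le [SigmaFinite ν] (h : IsSymmSubMarkov ν κ) {f : α → ℂ}
    (hf : MemLp f 2 ν) : eLpNorm (fun x => ∫ y, f y ∂(κ x)) 2 ν ≤ eLpNorm f 2 ν := by
  refine (ENNReal.pow_le_pow_left_iff two_ne_zero).1 ?_
  rw [eLpNorm_two_sq, eLpNorm_two_sq]
  have e : ∫⁻ x, ‖f x‖ₑ ^ 2 ∂ν = ∫⁻ x, ‖hf.1.mk f x‖ₑ ^ 2 ∂ν :=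
    lintegral_congr_ae (hf.1.ae_eq_mk.fun_comp fun z => ‖z‖ₑ ^ 2)
  have hm : Measurable fun x => ‖hf.1.mk f x‖ₑ ^ 2 :=
    hf.1.stronglyMeasurable_mk.measurable.enorm.pow_const 2
  rw [e]
  refine le_trans (lintegral_mono fun x => ?_) (h.lintegral_lintegral_le hm)
  rw [← eLpNorm_two_sq, h.integral_congr hf.1.ae_eq_mk x]
  gcongr
  exact enorm_integral_le_eLpNorm_two (h.univ_le_one x)
    hf.1.stronglyMeasurable_mk.aestronglyMeasurable

theorem IsSymmSubMarkov.memLp_integral [SigmaFinite ν] (h : IsSymmSubMarkov ν κ) {f : α → ℂ}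
    (hf : MemLp f 2 ν) : MemLp (fun x => ∫ y, f y ∂(κ x)) 2 ν :=
  ⟨h.aestronglyMeasurable hf, (h.eLpNorm_le hf).trans_lt hf.2⟩

/-- The contraction of `L²` induced by a symmetric sub-Markov kernel. -/
noncomputable def kernelOp [SigmaFinite ν] (h : IsSymmSubMarkov ν κ) : Lp ℂ 2 ν →L[ℂ] Lp ℂ 2 ν :=
  LinearMap.mkContinuous
    { toFun f := (h.memLp_integral (Lp.memLp f)).toLp
      map_add' f g := by
        rw [← MemLp.toLp_add]
        refine MemLp.toLp_congr _ _ (Filter.Eventually.of_forall fun x => ?_)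
        simp only [Pi.add_apply]
        rw [h.integral_congr (Lp.coeFn_add f g) x]
        exact integral_add (h.integrable (Lp.memLp f) x) (h.integrable (Lp.memLp g) x)
      map_smul' c f := by
        simp only [RingHom.id_apply]
        rw [← MemLp.toLp_const_smul]
        refine MemLp.toLp_congr _ _ (Filter.Eventually.of_forall fun x => ?_)
        simp only [Pi.smul_apply]
        rw [h.integral_congr (Lp.coeFn_smul c f) x]
        exact integral_smul c _ }
    1 fun f => by
      rw [one_mul, LinearMap.coe_mk, AddHom.coe_mk, Lp.norm_toLp, Lp.norm_def]
      exact ENNReal.toReal_mono (Lp.eLpNorm_ne_top f) (h.eLpNorm_le (Lp.memLp f))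

theorem kernelOp_ae_eq [SigmaFinite ν] (h : IsSymmSubMarkov ν κ) (f : Lp ℂ 2 ν) :
    kernelOp h f =ᵐ[ν] fun x => ∫ y, f y ∂(κ x) :=
  (h.memLp_integral (Lp.memLp f)).coeFn_toLp

theorem norm_kernelOp_le [SigmaFinite ν] (h : IsSymmSubMarkov ν κ) : ‖kernelOp h‖ ≤ 1 :=
  LinearMap.mkContinuous_norm_le _ zero_le_one _

/-- The kernel that acts first gives the outer operator, so the order is reversed. -/
theorem kernelOp_comp [SigmaFinite ν] {κ₁ κ₂ κ₃ : Kernel α α} (h₁ : IsSymmSubMarkov ν κ₁)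
    (h₂ : IsSymmSubMarkov ν κ₂) (h₃ : IsSymmSubMarkov ν κ₃) (h : κ₃ = κ₂ ∘ₖ κ₁) :
    kernelOp h₃ = kernelOp h₁ * kernelOp h₂ := by
  ext1 f
  apply Lp.ext
  refine (kernelOp_ae_eq h₃ f).trans (Filter.EventuallyEq.trans ?_
    (kernelOp_ae_eq h₁ (kernelOp h₂ f)).symm)
  refine Filter.Eventually.of_forall fun x => ?_
  simp only
  rw [h₁.integral_congr (kernelOp_ae_eq h₂ f) x]
  have hi := h₃.integrable (Lp.memLp f) x
  rw [h] at hi ⊢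
  exact Kernel.integral_comp hi

/-- Both inner products are integrals over `ν ⊗ₘ κ`, of `⟪f y, g x⟫` and of `⟪f x, g y⟫`, and
exchanging the variables preserves this measure. Integrability follows from `‖f x‖ ‖g y‖ ≤ ‖f x‖² +
‖g y‖²` and the sub-Markov bound. -/
theorem isSelfAdjoint_kernelOp [SigmaFinite ν] (h : IsSymmSubMarkov ν κ) : IsSelfAdjoint (kernelOp h) := by
  rw [ContinuousLinearMap.isSelfAdjoint_iff_isSymmetric]
  intro f g
  have := h.isFiniteKernel
  change inner ℂ (kernelOp h f) g = inner ℂ f (kernelOp h g)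
  rw [L2.inner_def, L2.inner_def]
  have hfm : Measurable f := (Lp.stronglyMeasurable f).measurable
  have hgm : Measurable g := (Lp.stronglyMeasurable g).measurable
  have e1 : ∫ x, inner ℂ (kernelOp h f x) (g x) ∂ν = ∫ x, inner ℂ (∫ y, f y ∂(κ x)) (g x) ∂ν :=
    integral_congr_ae (by filter_upwards [kernelOp_ae_eq h f] with x hx; rw [hx])
  have e2 : ∫ x, inner ℂ (f x) (kernelOp h g x) ∂ν = ∫ x, inner ℂ (f x) (∫ y, g y ∂(κ x)) ∂ν :=
    integral_congr_ae (by filter_upwards [kernelOp_ae_eq h g] with x hx; rw [hx])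
  rw [e1, e2]
  have e3 : ∀ x, inner ℂ (∫ y, f y ∂(κ x)) (g x) = ∫ y, inner ℂ (f y) (g x) ∂(κ x) := by
    intro x
    rw [← inner_conj_symm, ← integral_inner (h.integrable (Lp.memLp f) x), ← integral_conj]
    simp_rw [inner_conj_symm]
  have e4 : ∀ x, inner ℂ (f x) (∫ y, g y ∂(κ x)) = ∫ y, inner ℂ (f x) (g y) ∂(κ x) := fun x =>
    (integral_inner (h.integrable (Lp.memLp g) x) (f x)).symm
  simp_rw [e3, e4]
  have hF : Measurable fun p : α × α => (inner ℂ (f p.1) (g p.2) : ℂ) :=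
    (hfm.comp measurable_fst).inner (hgm.comp measurable_snd)
  have hint : Integrable (fun p : α × α => (inner ℂ (f p.1) (g p.2) : ℂ)) (ν ⊗ₘ κ) := by
    refine ⟨hF.aestronglyMeasurable, ?_⟩
    have hle : ∀ p : α × α, ‖(inner ℂ (f p.1) (g p.2) : ℂ)‖ₑ ≤ ‖f p.1‖ₑ ^ 2 + ‖g p.2‖ₑ ^ 2 := by
      intro p
      have h1 : ‖(inner ℂ (f p.1) (g p.2) : ℂ)‖ ≤ ‖f p.1‖ ^ 2 + ‖g p.2‖ ^ 2 :=
        (norm_inner_le_norm _ _).trans (by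
          nlinarith [sq_nonneg (‖f p.1‖ - ‖g p.2‖), sq_nonneg ‖f p.1‖, sq_nonneg ‖g p.2‖])
      simp only [← ofReal_norm, ← ENNReal.ofReal_pow (norm_nonneg _)]
      rw [← ENNReal.ofReal_add (by positivity) (by positivity)]
      exact ENNReal.ofReal_le_ofReal h1
    have hfin : ∀ u : Lp ℂ 2 ν, ∫⁻ x, ‖u x‖ₑ ^ 2 ∂ν < ∞ := fun u => by
      rw [← eLpNorm_two_sq]; exact ENNReal.pow_lt_top (Lp.eLpNorm_lt_top u)
    have mf : Measurable fun x => ‖f x‖ₑ ^ 2 := hfm.enorm.pow_const 2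
    have mg : Measurable fun x => ‖g x‖ₑ ^ 2 := hgm.enorm.pow_const 2
    refine (lintegral_mono hle).trans_lt ?_
    rw [lintegral_add_left (f := fun p : α × α => ‖f p.1‖ₑ ^ 2) (mf.comp measurable_fst),
      ENNReal.add_lt_top]
    have i1 := Measure.lintegral_compProd (μ := ν) (κ := κ) (mf.comp measurable_fst)
    have i2 := Measure.lintegral_compProd (μ := ν) (κ := κ) (mg.comp measurable_snd)
    simp only [Function.comp_apply] at i1 i2
    rw [i1, i2]
    refine ⟨lt_of_le_of_lt (lintegral_mono fun x => ?_) (hfin f),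
      (h.lintegral_lintegral_le mg).trans_lt (hfin g)⟩
    rw [lintegral_const]
    exact mul_le_of_le_one_right' (h.univ_le_one x)
  have hint' : Integrable (fun p : α × α => (inner ℂ (f p.2) (g p.1) : ℂ)) (ν ⊗ₘ κ) := by
    have hi := hint
    rw [← h.map_swap] at hi
    exact (integrable_map_measure (by rw [h.map_swap]; exact hint.1)
      measurable_swap.aemeasurable).1 hi
  rw [← Measure.integral_compProd hint, ← Measure.integral_compProd hint']
  conv_rhs => rw [← h.map_swap]
  rw [integral_map measurable_swap.aemeasurable (by rw [h.map_swap]; exact hint.1)]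
  rfl

/-- Integration against `κ x` as a continuous linear functional on `L²`. -/
theorem exists_kernel_functional (h : IsSymmSubMarkov ν κ) {x : α} {c : ℝ} (hc0 : 0 ≤ c)
    (hc : κ x ≤ ENNReal.ofReal c • ν) :
    ∃ ℓ : Lp ℂ 2 ν →L[ℂ] ℂ, ‖ℓ‖ ≤ √c ∧ ∀ f : Lp ℂ 2 ν, ℓ f = ∫ y, f y ∂(κ x) := by
  let L : Lp ℂ 2 ν →ₗ[ℂ] ℂ :=
    { toFun f := ∫ y, f y ∂(κ x)
      map_add' f g := by
        rw [h.integral_congr (Lp.coeFn_add f g) x]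
        exact integral_add (h.integrable (Lp.memLp f) x) (h.integrable (Lp.memLp g) x)
      map_smul' a f := by
        rw [h.integral_congr (Lp.coeFn_smul a f) x]
        exact integral_smul a _ }
  have hL : ∀ f, ‖L f‖ ≤ √c * ‖f‖ := by
    intro f
    have h1 : ‖L f‖ₑ ≤ eLpNorm f 2 (κ x) :=
      enorm_integral_le_eLpNorm_two (h.univ_le_one x) (h.memLp (Lp.memLp f) x).1
    have h2 : ‖L f‖ₑ ^ 2 ≤ ENNReal.ofReal c * eLpNorm f 2 ν ^ 2 := by
      refine (pow_le_pow_left' h1 2).trans ?_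
      rw [eLpNorm_two_sq, eLpNorm_two_sq, ← smul_eq_mul, ← lintegral_smul_measure]
      exact lintegral_mono' hc le_rfl
    have h3 : ‖L f‖ ^ 2 ≤ c * ‖f‖ ^ 2 := by
      have h4 := ENNReal.toReal_mono (ENNReal.mul_ne_top ENNReal.ofReal_ne_top
        (ENNReal.pow_ne_top (Lp.eLpNorm_ne_top f))) h2
      simpa [ENNReal.toReal_mul, ENNReal.toReal_ofReal hc0, Lp.norm_def] using h4
    refine le_of_sq_le_sq ?_ (by positivity)
    rw [mul_pow, Real.sq_sqrt hc0]
    exact h3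
  exact ⟨L.mkContinuous _ hL, L.mkContinuous_norm_le (Real.sqrt_nonneg _) hL, fun f => rfl⟩

end KernelOp

end PathEstimate

/-! ### Differentiability in time of survival probabilities. -/

namespace PathEstimate

/-- Landau-type interpolation for series: if the terms are small and have small second-order
remainders, then the series is differentiable, with derivative bounded by the geometric means. -/
theorem hasDerivAt_of_landau {f : ℝ → ℝ} {F : ℕ → ℝ → ℝ} {D B η : ℕ → ℝ} {h : ℝ} (hh : 0 < h)
    (hB : ∀ k, 0 ≤ B k) (hη : ∀ k, 0 < η k) (hηh : ∀ k, η k ≤ h)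
    (hF : ∀ k a, |a| ≤ h → |F k a| ≤ B k * η k ^ 2)
    (hrem : ∀ k a, |a| ≤ h → |F k a - F k 0 - a * D k| ≤ B k * a ^ 2)
    (hsum : Summable fun k => B k * η k) (hf : ∀ a, |a| ≤ h → HasSum (fun k => F k a) (f a)) :
    ∃ f', HasDerivAt f f' 0 ∧ |f'| ≤ 4 * ∑' k, B k * η k := by
  have hdiff : ∀ k a, |a| ≤ h → |F k a - F k 0| ≤ 2 * (B k * η k ^ 2) := fun k a ha => by
    have h1 := hF k a ha
    have h2 := hF k 0 (by simpa using hh.le)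
    exact (abs_sub _ _).trans (by linarith)
  -- The expansion is tested at `a = η k`, where the size bound `2 B η²` and the remainder `B η²`
  -- balance.
  have hD : ∀ k, |D k| ≤ 3 * (B k * η k) := by
    intro k
    have h1 := hrem k (η k) (by rw [abs_of_pos (hη k)]; exact hηh k)
    have h2 := hdiff k (η k) (by rw [abs_of_pos (hη k)]; exact hηh k)
    have h3 : |η k * D k| ≤ 3 * (B k * η k ^ 2) := by
      have := abs_sub (F k (η k) - F k 0) (F k (η k) - F k 0 - η k * D k)
      rw [sub_sub_cancel] at this
      linarith
    rw [abs_mul, abs_of_pos (hη k)] at h3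
    have : η k * |D k| ≤ η k * (3 * (B k * η k)) := by nlinarith
    exact le_of_mul_le_mul_left this (hη k)
  -- A summable bound for the difference quotients, uniform in `a`: for `|a| ≤ η k` it comes from
  -- the expansion, for `|a| ≥ η k` from the size of the terms.
  have hslope : ∀ k a, |a| ≤ h → a ≠ 0 → |a⁻¹ * (F k a - F k 0)| ≤ 4 * (B k * η k) := by
    intro k a ha ha0
    have hap : 0 < |a| := abs_pos.2 ha0
    rw [abs_mul, abs_inv, inv_mul_le_iff₀ hap]
    have hBk := mul_nonneg (hB k) (hη k).le
    rcases le_total |a| (η k) with hle | hle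
    · have h1 := hrem k a ha
      have h2 : |F k a - F k 0| ≤ B k * a ^ 2 + |a| * |D k| := by
        have := abs_add_le (F k a - F k 0 - a * D k) (a * D k)
        rw [sub_add_cancel, abs_mul] at this
        linarith
      have h3 : B k * a ^ 2 ≤ |a| * (B k * η k) := by
        rw [← sq_abs]
        nlinarith [mul_le_mul_of_nonneg_left hle (mul_nonneg (hB k) hap.le)]
      nlinarith [hD k]
    · have h1 := hdiff k a ha
      nlinarith [mul_le_mul_of_nonneg_left hle hBk]
  have hDs : Summable fun k => |D k| :=
    Summable.of_nonneg_of_le (fun _ => abs_nonneg _) hD (hsum.mul_left 3)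
  refine ⟨∑' k, D k, ?_, ?_⟩
  · rw [hasDerivAt_iff_tendsto_slope_zero]
    have hev : ∀ᶠ a : ℝ in nhdsWithin 0 {0}ᶜ, |a| ≤ h ∧ a ≠ 0 := by
      have h1 : ∀ᶠ a : ℝ in nhdsWithin 0 {0}ᶜ, |a| ≤ h := by
        refine nhdsWithin_le_nhds ?_
        filter_upwards [Metric.closedBall_mem_nhds (0 : ℝ) hh] with a ha
        simpa using ha
      exact h1.and self_mem_nhdsWithin
    have hlim := tendsto_tsum_of_dominated_convergence (f := fun a k => a⁻¹ * (F k a - F k 0))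
      (g := D) (bound := fun k => 4 * (B k * η k)) (𝓕 := nhdsWithin (0 : ℝ) {0}ᶜ)
      (hsum.mul_left 4) ?_ ?_
    · refine hlim.congr' ?_
      filter_upwards [hev] with a ha
      rw [zero_add, smul_eq_mul, tsum_mul_left,
        ((hf a ha.1).sub (hf 0 (by simpa using hh.le))).tsum_eq]
    · intro k
      rw [tendsto_iff_norm_sub_tendsto_zero]
      refine squeeze_zero' (g := fun a => B k * |a|) (Filter.Eventually.of_forall fun _ =>
        norm_nonneg _) ?_ ?_
      · filter_upwards [hev] with a ha
        have h1 := hrem k a ha.1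
        have hap : 0 < |a| := abs_pos.2 ha.2
        have e : a⁻¹ * (F k a - F k 0) - D k = a⁻¹ * (F k a - F k 0 - a * D k) := by
          field_simp [ha.2]
        rw [e, Real.norm_eq_abs, abs_mul, abs_inv, inv_mul_le_iff₀ hap]
        rw [← sq_abs] at h1
        linarith
      · have : Filter.Tendsto (fun a : ℝ => B k * |a|) (nhds 0) (nhds (B k * |0|)) :=
          (continuous_const.mul continuous_abs).tendsto 0
        rw [abs_zero, mul_zero] at this
        exact this.mono_left nhdsWithin_le_nhds
    · filter_upwards [hev] with a ha k
      exact hslope k a ha.1 ha.2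
  · have h1 : |∑' k, D k| ≤ ∑' k, |D k| := by
      have := norm_tsum_le_tsum_norm (f := D) (by simpa only [Real.norm_eq_abs] using hDs)
      simpa only [Real.norm_eq_abs] using this
    refine h1.trans ?_
    rw [← tsum_mul_left]
    refine hDs.tsum_le_tsum (fun k => (hD k).trans ?_) (hsum.mul_left 4)
    have := mul_nonneg (hB k) (hη k).le
    linarith

/-- Markov's inequality for the finite moment of `(‖z‖ + 1) ^ m`. -/
theorem exists_stdGaussian_tail_le (d m : ℕ) :
    ∃ C : ℝ, 0 < C ∧ ∀ k : ℕ, (stdGaussian (Eucl d)).real {z | (k : ℝ) ≤ ‖z‖} ≤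
      C / ((k : ℝ) + 1) ^ m := by
  have hint : Integrable (fun z : Eucl d => (‖z‖ + 1) ^ m) (stdGaussian (Eucl d)) := by
    have h1 : MemLp (fun z : Eucl d => ‖z‖ + 1) (m : ℝ≥0∞) (stdGaussian (Eucl d)) :=
      ((IsGaussian.memLp_id (stdGaussian (Eucl d)) m (by simp)).norm).add (memLp_const 1)
    have h2 := h1.integrable_norm_pow'
    refine h2.congr (Filter.Eventually.of_forall fun z => ?_)
    simp only
    rw [Real.norm_of_nonneg (by positivity)]
  refine ⟨∫ z, (‖z‖ + 1) ^ m ∂(stdGaussian (Eucl d)) + 1, ?_, fun k => ?_⟩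
  · have : 0 ≤ ∫ z, (‖z‖ + 1) ^ m ∂(stdGaussian (Eucl d)) :=
      integral_nonneg fun z => by positivity
    linarith
  · have h := mul_meas_ge_le_integral_of_nonneg
      (Filter.Eventually.of_forall fun z : Eucl d => by positivity) hint (((k : ℝ) + 1) ^ m)
    rw [le_div_iff₀ (by positivity), mul_comm]
    refine le_trans (mul_le_mul_of_nonneg_left (measureReal_mono fun z hz => ?_)
      (by positivity)) (h.trans (by linarith))
    have hz' : (k : ℝ) ≤ ‖z‖ := hz
    change ((k : ℝ) + 1) ^ m ≤ (‖z‖ + 1) ^ m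
    gcongr

variable {d : ℕ} {Q : Measure (PathSpace d)} [IsProbabilityMeasure Q] {D : Set (Eucl d)}

theorem killedKernel_isSymmSubMarkov (hD : IsOpen D) (hQ : IsBrownianLaw 0 Q) {t : ℝ≥0}
    (ht : 0 < t) : IsSymmSubMarkov volume (killedKernel Q hD t) :=
  ⟨killedKernel_univ_le_one Q hD t, map_swap_compProd_killedKernel hD hQ t,
    fun x => ⟨_, ENNReal.ofReal_ne_top, killedKernel_le_volume hD hQ ht x⟩⟩

theorem killedKernel_add (hD : IsOpen D) (hQ : IsBrownianLaw 0 Q) (s t : ℝ≥0) :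
    killedKernel Q hD (s + t) = killedKernel Q hD t ∘ₖ killedKernel Q hD s := by
  ext x B hB
  rw [Kernel.comp_apply' _ _ _ hB, ← lintegral_indicator_one hB,
    lintegral_killedKernel_add hD hQ s t x (measurable_one.indicator hB)]
  simp_rw [lintegral_indicator_one hB]

/-- The heat semigroup of killed Brownian motion on `L²`. -/
noncomputable def killedSemigroup (hD : IsOpen D) (hQ : IsBrownianLaw 0 Q) (t : ℝ) :
    Lp ℂ 2 (volume : Measure (Eucl d)) →L[ℂ] Lp ℂ 2 (volume : Measure (Eucl d)) :=
  if ht : 0 < t then kernelOp (killedKernel_isSymmSubMarkov hD hQ (Real.toNNReal_pos.2 ht)) else 0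

theorem killedSemigroup_of_pos (hD : IsOpen D) (hQ : IsBrownianLaw 0 Q) {t : ℝ} (ht : 0 < t) :
    killedSemigroup hD hQ t =
      kernelOp (killedKernel_isSymmSubMarkov hD hQ (Real.toNNReal_pos.2 ht)) := dif_pos ht

theorem exists_killedSemigroup_taylor (hD : IsOpen D) (hQ : IsBrownianLaw 0 Q) :
    ∃ G : ℝ → (Lp ℂ 2 (volume : Measure (Eucl d)) →L[ℂ] Lp ℂ 2 (volume : Measure (Eucl d))),
      ∀ t a, 0 < t → |a| ≤ t / 2 →
        ‖killedSemigroup hD hQ (t + a) - killedSemigroup hD hQ t - a • G t‖ ≤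
          8 * a ^ 2 / t ^ 2 := by
  refine exists_semigroup_taylor (fun t ht => ?_) (fun t ht => ?_) (fun s t hs ht => ?_)
  · rw [killedSemigroup_of_pos hD hQ ht]; exact isSelfAdjoint_kernelOp _
  · rw [killedSemigroup_of_pos hD hQ ht]; exact norm_kernelOp_le _
  · rw [killedSemigroup_of_pos hD hQ ht, killedSemigroup_of_pos hD hQ hs,
      killedSemigroup_of_pos hD hQ (add_pos hs ht)]
    refine kernelOp_comp _ _ _ ?_
    rw [Real.toNNReal_add hs.le ht.le, killedKernel_add hD hQ]

/-- Keeping a time `s` outside the operator makes this a bounded functional applied to the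
semigroup. Differentiability in operator norm thereby passes to transition probabilities from every
single point `x`. -/
theorem integral_killedSemigroup_indicator (hD : IsOpen D) (hQ : IsBrownianLaw 0 Q) {s t : ℝ}
    (hs : 0 < s) (ht : 0 < t) (x : Eucl d) {A : Set (Eucl d)} (hA : MeasurableSet A)
    (hA' : volume A ≠ ∞) :
    ∫ y, killedSemigroup hD hQ t (indicatorConstLp 2 hA hA' 1) y
      ∂(killedKernel Q hD s.toNNReal x) =
      ((killedKernel Q hD (s + t).toNNReal x).real A : ℂ) := by
  have h₁ := killedKernel_isSymmSubMarkov hD hQ (Real.toNNReal_pos.2 hs)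
  have h₂ := killedKernel_isSymmSubMarkov hD hQ (Real.toNNReal_pos.2 ht)
  have h₃ := killedKernel_isSymmSubMarkov hD hQ (Real.toNNReal_pos.2 (add_pos hs ht))
  rw [killedSemigroup_of_pos hD hQ ht, h₁.integral_congr (kernelOp_ae_eq h₂ _) x]
  have hi := h₃.integrable (Lp.memLp (indicatorConstLp 2 hA hA' (1 : ℂ))) x
  have e : ∫ y, indicatorConstLp 2 hA hA' (1 : ℂ) y ∂(killedKernel Q hD (s + t).toNNReal x) =
      ((killedKernel Q hD (s + t).toNNReal x).real A : ℂ) := by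
    rw [h₃.integral_congr indicatorConstLp_coeFn x, integral_indicator hA]
    simp
  rw [← e]
  rw [Real.toNNReal_add hs.le ht.le, killedKernel_add hD hQ] at hi ⊢
  exact (Kernel.integral_comp hi).symm

theorem volume_shell_le {x : Eucl d} {ρ : ℝ} (hρ : 0 < ρ) (k : ℕ) :
    volume.real {y : Eucl d | ⌊‖y - x‖ / ρ⌋₊ = k} ≤
      (((k : ℝ) + 1) * ρ) ^ d * volume.real (Metric.ball (0 : Eucl d) 1) ∧
    volume {y : Eucl d | ⌊‖y - x‖ / ρ⌋₊ = k} ≠ ∞ := by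
  have hsub : {y : Eucl d | ⌊‖y - x‖ / ρ⌋₊ = k} ⊆ Metric.ball x (((k : ℝ) + 1) * ρ) := by
    intro y hy
    have h := Nat.lt_floor_add_one (‖y - x‖ / ρ)
    rw [show ⌊‖y - x‖ / ρ⌋₊ = k from hy, div_lt_iff₀ hρ] at h
    rwa [mem_ball_iff_norm]
  have hfin : volume (Metric.ball x (((k : ℝ) + 1) * ρ)) ≠ ∞ := measure_ball_lt_top.ne
  refine ⟨(measureReal_mono hsub hfin).trans (le_of_eq ?_), measure_ne_top_of_subset hsub hfin⟩
  rw [measureReal_def, Measure.addHaar_ball_of_pos volume x (by positivity), finrank_euclideanSpace_fin,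
    ENNReal.toReal_mul, ENNReal.toReal_ofReal (by positivity), measureReal_def]

theorem hasSum_measureReal_fiber {α : Type*} [MeasurableSpace α] (μ : Measure α)
    [IsFiniteMeasure μ] {g : α → ℕ} (hg : Measurable g) :
    HasSum (fun k => μ.real {y | g y = k}) (μ.real univ) := by
  have hU : (⋃ k, {y | g y = k}) = univ := by ext; simp
  have hm : ∀ k, MeasurableSet {y | g y = k} := fun k => hg (measurableSet_singleton k)
  have hd : Pairwise (Function.onFun Disjoint fun k => {y | g y = k}) := by
    intro i j hij
    rw [Function.onFun, Set.disjoint_left]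
    rintro y hi hj
    exact hij (hi.symm.trans hj)
  have h := measure_iUnion hd hm (μ := μ)
  rw [hU] at h
  have hs : ∑' k, μ {y | g y = k} ≠ ∞ := by rw [← h]; exact measure_ne_top _ _
  rw [measureReal_def, h, ENNReal.tsum_toReal_eq fun k => measure_ne_top _ _]
  exact (ENNReal.summable_toReal hs).hasSum

/-- Taylor bound for the transition probabilities of killed Brownian motion. -/
theorem exists_killedKernel_taylor (hD : IsOpen D) (hQ : IsBrownianLaw 0 Q) {t : ℝ} (ht : 0 < t)
    (x : Eucl d) {A : Set (Eucl d)} (hA : MeasurableSet A) (hA' : volume A ≠ ∞) {N : ℝ}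
    (hN0 : 0 ≤ N) (hN : ((√(t / 2)) ^ d)⁻¹ * volume.real A ≤ N ^ 2) :
    ∃ δ : ℝ, ∀ a, |a| ≤ t / 4 →
      |(killedKernel Q hD (t + a).toNNReal x).real A - (killedKernel Q hD t.toNNReal x).real A -
        a * δ| ≤ 32 / t ^ 2 * N * a ^ 2 := by
  obtain ⟨G, hG⟩ := exists_killedSemigroup_taylor hD hQ
  -- Half of the time is spent on the functional, with norm controlled by `(t/2)^(-d/2)`, the other
  -- half on the semigroup; hence `8 a² / (t/2)² = 32 a² / t²` and the range `|a| ≤ t / 4`.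
  have ht2 : 0 < t / 2 := by positivity
  have hsymm := killedKernel_isSymmSubMarkov hD hQ (Real.toNNReal_pos.2 ht2)
  have hle := killedKernel_le_volume hD hQ (Real.toNNReal_pos.2 ht2) x
  rw [Real.coe_toNNReal _ ht2.le] at hle
  obtain ⟨ℓ, hℓ, hℓ'⟩ := exists_kernel_functional hsymm (by positivity) hle
  obtain ⟨h, hh⟩ : ∃ h, h = indicatorConstLp 2 hA hA' (1 : ℂ) := ⟨_, rfl⟩
  have hnorm : ‖ℓ‖ * ‖h‖ ≤ N := by
    have h1 : ‖h‖ = √(volume.real A) := by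
      rw [hh, norm_indicatorConstLp (by norm_num) (by norm_num), norm_one, one_mul,
        Real.sqrt_eq_rpow]
      norm_num
    rw [h1]
    refine (mul_le_mul_of_nonneg_right hℓ (Real.sqrt_nonneg _)).trans ?_
    rw [← Real.sqrt_mul (by positivity)]
    exact Real.sqrt_le_iff.2 ⟨hN0, hN⟩
  have hFℓ : ∀ a, |a| ≤ t / 4 → (killedKernel Q hD (t + a).toNNReal x).real A =
      (ℓ (killedSemigroup hD hQ (t / 2 + a) h)).re := by
    intro a ha
    have ha' := abs_le.1 ha
    rw [hℓ', hh, integral_killedSemigroup_indicator hD hQ ht2 (by linarith) x hA hA',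
      Complex.ofReal_re, ← add_assoc, add_halves]
  refine ⟨(ℓ (G (t / 2) h)).re, fun a ha => ?_⟩
  have h0 := hFℓ 0 (by simpa using by positivity)
  rw [add_zero, add_zero] at h0
  have e : (ℓ (killedSemigroup hD hQ (t / 2 + a) h)).re - (ℓ (killedSemigroup hD hQ (t / 2) h)).re
      - a * (ℓ (G (t / 2) h)).re =
      (ℓ ((killedSemigroup hD hQ (t / 2 + a) - killedSemigroup hD hQ (t / 2) -
        a • G (t / 2)) h)).re := by
    simp only [_root_.sub_apply, _root_.smul_apply, map_sub,
      ContinuousLinearMap.map_smul_of_tower, Complex.sub_re, Complex.real_smul,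
      Complex.re_ofReal_mul]
  rw [hFℓ a ha, h0, e]
  refine (Complex.abs_re_le_norm _).trans ((ℓ.le_opNorm _).trans ?_)
  have h1 := hG (t / 2) a ht2 (by linarith)
  refine (mul_le_mul_of_nonneg_left (ContinuousLinearMap.le_of_opNorm_le _ h1 h)
    (norm_nonneg _)).trans ?_
  calc ‖ℓ‖ * (8 * a ^ 2 / (t / 2) ^ 2 * ‖h‖) = 32 / t ^ 2 * (‖ℓ‖ * ‖h‖) * a ^ 2 := by
        field_simp; ring
    _ ≤ _ := by gcongr

/-- Since `√(2t) = 2 √(t/2)`, the powers of `t` cancel. The summand `1` in the condition on `M`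
makes the base at least one, so that passing to its square is harmless. -/
theorem shell_volume_bound {w M t : ℝ} (hw : 0 ≤ w) (hM : 2 ^ d * w + 1 ≤ M) (ht : 0 < t)
    (hwd : w = volume.real (Metric.ball (0 : Eucl d) 1)) (x : Eucl d) (k : ℕ) :
    ((√(t / 2)) ^ d)⁻¹ * volume.real {y : Eucl d | ⌊‖y - x‖ / √(2 * t)⌋₊ = k} ≤
      (M * ((k : ℝ) + 1) ^ d) ^ 2 := by
  have e : √(2 * t) = 2 * √(t / 2) := by
    rw [show 2 * t = 2 ^ 2 * (t / 2) by ring, Real.sqrt_mul (by positivity),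
      Real.sqrt_sq (by norm_num)]
  have h2 := (volume_shell_le (x := x) (Real.sqrt_pos.2 (by positivity : 0 < 2 * t)) k).1
  rw [← hwd] at h2
  have hst : 0 < √(t / 2) := Real.sqrt_pos.2 (by positivity)
  have h0 : 0 ≤ 2 ^ d * w := by positivity
  have h3 : (1 : ℝ) ≤ ((k : ℝ) + 1) ^ d := one_le_pow₀ (by simp)
  have h4 : 2 ^ d * w ≤ M := by linarith
  have h5 : 1 ≤ M := by linarith
  have h6 : 1 ≤ M * ((k : ℝ) + 1) ^ d := one_le_mul_of_one_le_of_one_le h5 h3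
  calc ((√(t / 2)) ^ d)⁻¹ * volume.real {y : Eucl d | ⌊‖y - x‖ / √(2 * t)⌋₊ = k}
      ≤ ((√(t / 2)) ^ d)⁻¹ * ((((k : ℝ) + 1) * √(2 * t)) ^ d * w) := by gcongr
    _ = (2 ^ d * w) * ((k : ℝ) + 1) ^ d := by
        rw [e, mul_pow, mul_pow]; field_simp
    _ ≤ M * ((k : ℝ) + 1) ^ d := by gcongr
    _ ≤ (M * ((k : ℝ) + 1) ^ d) ^ 2 := by rw [sq]; exact le_mul_of_one_le_right (by positivity) h6

/-- Reaching the `k`-th shell requires a displacement of at least `k √(2t) ≥ k √s`, that is, `k`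
standard units at time `s`. -/
theorem killedKernel_shell_le (hD : IsOpen D) (hQ : IsBrownianLaw 0 Q) {s t : ℝ} (hs : 0 < s)
    (hst : s ≤ 2 * t) (x : Eucl d) (k : ℕ) :
    (killedKernel Q hD s.toNNReal x).real {y | ⌊‖y - x‖ / √(2 * t)⌋₊ = k} ≤
      (stdGaussian (Eucl d)).real {z | (k : ℝ) ≤ ‖z‖} := by
  refine ENNReal.toReal_mono (measure_ne_top _ _) (le_trans (measure_mono fun y hy => ?_)
    (killedKernel_tail hD hQ (Real.toNNReal_pos.2 hs) x k))
  have hρ0 : 0 < √(2 * t) := Real.sqrt_pos.2 (hs.trans_le hst)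
  have hy' : (k : ℝ) ≤ ‖y - x‖ / √(2 * t) := by
    rw [← show ⌊‖y - x‖ / √(2 * t)⌋₊ = k from hy]
    exact Nat.floor_le (by positivity)
  rw [le_div_iff₀ hρ0] at hy'
  change (k : ℝ) * √(s.toNNReal : ℝ) ≤ ‖y - x‖
  refine le_trans ?_ hy'
  rw [Real.coe_toNNReal _ hs.le]
  gcongr

/-- The survival probability of Brownian motion in an open set is differentiable in time, with
derivative bounded by a dimensional constant over the time. -/
theorem exists_hasDerivAt_killedKernel (d : ℕ) : ∃ C : ℝ, 0 < C ∧
    ∀ (Q : Measure (PathSpace d)) [IsProbabilityMeasure Q] (_ : IsBrownianLaw 0 Q)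
      (D : Set (Eucl d)) (hD : IsOpen D) (x : Eucl d) (t : ℝ), 0 < t →
      ∃ f', HasDerivAt (fun s : ℝ => (killedKernel Q hD s.toNNReal x).real univ) f' t ∧
        |f'| ≤ C / t := by
  obtain ⟨Ct, hCt, htail⟩ := exists_stdGaussian_tail_le d (d + 4)
  obtain ⟨w, hw⟩ : ∃ w, w = volume.real (Metric.ball (0 : Eucl d) 1) := ⟨_, rfl⟩
  have hw0 : 0 ≤ w := hw ▸ measureReal_nonneg
  have hw0' : 0 ≤ 2 ^ d * w := by positivity
  obtain ⟨M, hM⟩ : ∃ M, M = 2 ^ d * w + 1 + Ct := ⟨_, rfl⟩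
  have hM0 : 0 < M := by rw [hM]; positivity
  have hS : Summable fun k : ℕ => 1 / ((k : ℝ) + 1) ^ 2 := by
    have := (summable_nat_add_iff 1).2 (Real.summable_one_div_nat_pow.2 one_lt_two)
    simpa using this
  have hS0 : 0 ≤ ∑' k : ℕ, 1 / ((k : ℝ) + 1) ^ 2 := tsum_nonneg fun k => by positivity
  refine ⟨32 * M * ∑' k : ℕ, 1 / ((k : ℝ) + 1) ^ 2 + 1, by positivity, ?_⟩
  intro Q _ hQ D hD x t ht
  have hρ0 : 0 < √(2 * t) := Real.sqrt_pos.2 (by positivity)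
  have hg : Measurable fun y : Eucl d => ⌊‖y - x‖ / √(2 * t)⌋₊ :=
    Nat.measurable_floor.comp ((measurable_id.sub_const x).norm.div_const _)
  have htaylor := fun k : ℕ => exists_killedKernel_taylor hD hQ ht x
    (hg (measurableSet_singleton k)) (volume_shell_le hρ0 k).2
    (by positivity : 0 ≤ M * ((k : ℝ) + 1) ^ d)
    (shell_volume_bound hw0 (by rw [hM]; linarith) ht hw x k)
  choose δ hδ using htaylor
  -- Choice of exponents: the expansion costs `(k+1)^d`, so `η k` of order `t (k+1)^(-d-2)` makes `B
  -- k * η k` of order `(k+1)^(-2) / t`, which is summable. Then `B k * η k ^ 2` is of order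
  -- `(k+1)^(-d-4)`, which is why the Gaussian tail is taken with exponent `d + 4`.
  have e : ∀ k : ℕ, 32 / t ^ 2 * (M * ((k : ℝ) + 1) ^ d) * (t / 4 / ((k : ℝ) + 1) ^ (d + 2)) =
      8 * M / t * (1 / ((k : ℝ) + 1) ^ 2) := fun k => by
    rw [pow_add]; field_simp; norm_num
  obtain ⟨f', hf', hf'le⟩ := hasDerivAt_of_landau
    (f := fun a => (killedKernel Q hD (t + a).toNNReal x).real univ)
    (F := fun k a => (killedKernel Q hD (t + a).toNNReal x).real
      {y | ⌊‖y - x‖ / √(2 * t)⌋₊ = k}) (D := δ)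
    (B := fun k => 32 / t ^ 2 * (M * ((k : ℝ) + 1) ^ d))
    (η := fun k => t / 4 / ((k : ℝ) + 1) ^ (d + 2)) (h := t / 4) (by positivity)
    (fun k => by positivity) (fun k => by positivity)
    (fun k => div_le_self (by positivity) (one_le_pow₀ (by simp)))
    (fun k a ha => by
      have ha' := abs_le.1 ha
      rw [abs_of_nonneg (measureReal_nonneg)]
      refine (killedKernel_shell_le hD hQ (by linarith) (by linarith) x k).trans
        ((htail k).trans ?_)
      have e' : 32 / t ^ 2 * (M * ((k : ℝ) + 1) ^ d) * (t / 4 / ((k : ℝ) + 1) ^ (d + 2)) ^ 2 =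
          2 * M / ((k : ℝ) + 1) ^ (d + 4) := by
        rw [pow_add, pow_add]; field_simp; norm_num
      rw [e']
      gcongr
      rw [hM]; linarith)
    (fun k a ha => by simp only [add_zero]; exact hδ k a ha)
    (by simp_rw [e]; exact hS.mul_left _)
    (fun a _ => hasSum_measureReal_fiber _ hg)
  simp_rw [e] at hf'le
  refine ⟨f', ?_, hf'le.trans ?_⟩
  · have h1 : HasDerivAt (fun s : ℝ => s - t) 1 t := (hasDerivAt_id t).sub_const t
    have h2 := HasDerivAt.comp_of_eq t hf' h1 (sub_self t).symm
    simpa [Function.comp_def] using h2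
  · rw [tsum_mul_left, le_div_iff₀ ht]
    have : 4 * (8 * M / t * ∑' k : ℕ, 1 / ((k : ℝ) + 1) ^ 2) * t =
      32 * M * ∑' k : ℕ, 1 / ((k : ℝ) + 1) ^ 2 := by
      generalize ∑' k : ℕ, 1 / ((k : ℝ) + 1) ^ 2 = S
      field_simp; ring
    linarith

end PathEstimate

/-! ### Exit times of `O_r` and existence of the rate constant. -/

namespace PathEstimate

variable {d : ℕ}

theorem continuous_signedDist (O : Set (Eucl d)) : Continuous (signedDist O) :=
  (Metric.continuous_infDist_pt _).sub (Metric.continuous_infDist_pt _)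

theorem isOpen_signedDist_gt (O : Set (Eucl d)) (r : ℝ) : IsOpen {x | r < signedDist O x} :=
  isOpen_lt continuous_const (continuous_signedDist O)

/-- For closed `A` and a continuous path the infimum defining the hitting time is attained. -/
theorem hitTime_le_iff {A : Set (Eucl d)} (hA : IsClosed A) (ω : PathSpace d) (t : ℝ≥0) :
    hitTime A ω ≤ (t : WithTop ℝ≥0) ↔ ∃ s ≤ t, ω s ∈ A := by
  constructor
  · intro h
    rw [hitTime, hittingAfter] at h
    split_ifs at h with hex
    · have hcl : IsClosed {i : ℝ≥0 | 0 ≤ i ∧ ω i ∈ A} := by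
        have : {i : ℝ≥0 | 0 ≤ i ∧ ω i ∈ A} = ω ⁻¹' A := by ext; simp
        rw [this]; exact hA.preimage ω.continuous
      exact ⟨_, WithTop.coe_le_coe.1 h, (hcl.csInf_mem hex (OrderBot.bddBelow _)).2⟩
    · exact absurd (top_le_iff.1 h) WithTop.coe_ne_top
  · rintro ⟨s, hs, hsA⟩
    by_contra hlt
    exact notMem_of_lt_hittingAfter ((WithTop.coe_le_coe.2 hs).trans_lt (not_le.1 hlt))
      zero_le hsA

theorem exitTime_le_iff (O : Set (Eucl d)) (r : ℝ) (ω : PathSpace d) (t : ℝ≥0) :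
    exitTime O r ω ≤ (t : WithTop ℝ≥0) ↔ ω ∉ stay {x | r < signedDist O x} t := by
  rw [exitTime, hitTime_le_iff (isOpen_signedDist_gt O r).isClosed_compl, mem_stay]
  simp

theorem IsBrownianLaw.eq_map_translate {x : Eucl d} {P Q : Measure (PathSpace d)}
    (hP : IsBrownianLaw x P) (hQ : IsBrownianLaw 0 Q) :
    P = Q.map (PathEstimate.translate x) := by
  have h := hQ.translate x
  rw [add_zero] at h
  exact hP.unique h

theorem exitCDF_eq {x : Eucl d} {P Q : Measure (PathSpace d)} [IsProbabilityMeasure Q]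
    (hP : IsBrownianLaw x P) (hQ : IsBrownianLaw 0 Q) (O : Set (Eucl d)) (r t : ℝ) :
    exitCDF O P r t =
      1 - (killedKernel Q (isOpen_signedDist_gt O r) t.toNNReal x).real univ := by
  have hP' := hP.isProbabilityMeasure
  have e : {ω | exitTime O r ω ≤ ((t.toNNReal : ℝ≥0) : WithTop ℝ≥0)} =
      (stay {x | r < signedDist O x} t.toNNReal)ᶜ := by
    ext ω; exact exitTime_le_iff O r ω _
  have hm := measurableSet_stay (isOpen_signedDist_gt O r) t.toNNReal
  rw [exitCDF, e, probReal_compl_eq_one_sub hm, hP.eq_map_translate hQ, measureReal_def,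
    Measure.map_apply (measurable_translate x) hm, measureReal_def, killedKernel_univ]
  rfl

/-- The derivative bound for survival holds with one constant for all open sets and starting points,
hence uniformly over all `O_r`. -/
theorem exists_isExitRateConst (O : Set (Eucl d)) {P : Eucl d → Measure (PathSpace d)}
    (hP : ∀ x, IsBrownianLaw x (P x)) : ∃ C, IsExitRateConst O P C := by
  obtain ⟨C, hC, h⟩ := exists_hasDerivAt_killedKernel d
  have := (hP 0).isProbabilityMeasure
  refine ⟨C, hC, fun x r t _ ht => ?_⟩
  obtain ⟨f', hf', hle⟩ := h (P 0) (hP 0) _ (isOpen_signedDist_gt O r) x t ht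
  have e : exitCDF O (P x) r =
      fun t => 1 - (killedKernel (P 0) (isOpen_signedDist_gt O r) t.toNNReal x).real univ :=
    funext fun t => exitCDF_eq (hP x) (hP 0) O r t
  have hd : HasDerivAt (exitCDF O (P x) r) (-f') t := by
    rw [e]; exact hf'.const_sub 1
  refine ⟨hd.differentiableAt, ?_⟩
  rw [hd.deriv, ← div_eq_mul_inv]
  exact (neg_le_abs f').trans hle

end PathEstimate

/-! ### Calculus of the barrier function. -/

namespace PathEstimate

/-- The profile of the barrier. -/
noncomputable def barrier (m l w : ℝ) : ℝ := Real.exp (-(2 * m * w)) * max (1 - l * w) 0 ^ 3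

theorem exp_neg_ge_cubic (s : ℝ) : 1 - s + s ^ 2 / 2 - |s| ^ 3 ≤ Real.exp (-s) := by
  have h3 : 0 ≤ |s| ^ 3 := by positivity
  rcases le_total s 0 with h | h
  · have := Real.quadratic_le_exp_of_nonneg (neg_nonneg.2 h)
    nlinarith
  rcases le_total s 1 with h1 | h1
  · have h2 := (abs_le.1 (Real.exp_bound (x := -s) (by rwa [abs_neg, abs_of_nonneg h])
      (n := 3) (by norm_num))).1
    simp only [Finset.sum_range_succ, Finset.sum_range_zero, abs_neg] at h2
    norm_num [Nat.factorial] at h2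
    linarith
  · rw [abs_of_nonneg h]
    have := Real.exp_pos (-s)
    nlinarith [pow_pos (zero_lt_one.trans_le h1) 2]

/-- A second-order lower expansion with remainder uniform in `l ≤ L`; the coefficients are the first
derivative and half the second. Where the positive part vanishes at `ρ` it holds because the barrier
is nonnegative. Elsewhere the positive part may be dropped, the cube being monotone, and the
expansion of the exponential is multiplied by the cube. -/
theorem barrier_taylor {m l L g ρ Δ : ℝ} (hm : 0 ≤ m) (hl : 0 ≤ l) (hlL : l ≤ L) (hρ : 0 ≤ ρ)
    (hg : 0 ≤ g) (hΔ : -g ≤ ρ + Δ) :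
    Real.exp (-(2 * m * ρ)) * (max (1 - l * ρ) 0 ^ 3 -
      (3 * l * max (1 - l * ρ) 0 ^ 2 + 2 * m * max (1 - l * ρ) 0 ^ 3) * Δ +
      (3 * l ^ 2 * max (1 - l * ρ) 0 + 6 * m * l * max (1 - l * ρ) 0 ^ 2 +
        2 * m ^ 2 * max (1 - l * ρ) 0 ^ 3) * Δ ^ 2) -
      (8 * m ^ 3 * (1 + L * g) ^ 3 + (L ^ 3 + 6 * m * L ^ 2 + 6 * m ^ 2 * L)) * |Δ| ^ 3 -
      (2 * m * L ^ 3 + 6 * m ^ 2 * L ^ 2) * |Δ| ^ 4 - 2 * m ^ 2 * L ^ 3 * |Δ| ^ 5 ≤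
    barrier m l (ρ + Δ) := by
  have hL : 0 ≤ L := hl.trans hlL
  have hF : 0 ≤ barrier m l (ρ + Δ) := by unfold barrier; positivity
  have ha := abs_nonneg Δ
  rcases le_total (1 - l * ρ) 0 with hb | hb
  · rw [max_eq_right hb]
    refine le_trans ?_ hF
    have h1 : 0 ≤ (8 * m ^ 3 * (1 + L * g) ^ 3 + (L ^ 3 + 6 * m * L ^ 2 + 6 * m ^ 2 * L)) * |Δ| ^ 3 := by
      positivity
    have h2 : 0 ≤ (2 * m * L ^ 3 + 6 * m ^ 2 * L ^ 2) * |Δ| ^ 4 := by positivity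
    have h3 : 0 ≤ 2 * m ^ 2 * L ^ 3 * |Δ| ^ 5 := by positivity
    simp only [ne_eq, OfNat.ofNat_ne_zero, not_false_eq_true, zero_pow, mul_zero, add_zero,
      zero_mul, sub_zero]
    linarith
  rw [max_eq_left hb]
  obtain ⟨b, hbe⟩ : ∃ b, b = 1 - l * ρ := ⟨_, rfl⟩
  rw [← hbe] at hb ⊢
  have hb1 : b ≤ 1 := by rw [hbe]; linarith [mul_nonneg hl hρ]
  obtain ⟨c, hc⟩ : ∃ c, c = max (1 - l * (ρ + Δ)) 0 ^ 3 := ⟨_, rfl⟩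
  have hc0 : 0 ≤ c := by rw [hc]; positivity
  have hcK : c ≤ (1 + L * g) ^ 3 := by
    rw [hc]
    gcongr
    refine max_le ?_ (by positivity)
    nlinarith [mul_le_mul_of_nonneg_right hlL hg, mul_le_mul_of_nonneg_left hΔ hl]
  have hcb : (b - l * Δ) ^ 3 ≤ c := by
    have e : 1 - l * (ρ + Δ) = b - l * Δ := by rw [hbe]; ring
    rw [hc, e]
    exact (Odd.strictMono_pow (by decide : Odd 3)).monotone (le_max_left _ _)
  have hs := mul_le_mul_of_nonneg_right (exp_neg_ge_cubic (2 * m * Δ)) hc0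
  have e0 : barrier m l (ρ + Δ) =
      Real.exp (-(2 * m * ρ)) * (Real.exp (-(2 * m * Δ)) * c) := by
    rw [barrier, ← hc, ← mul_assoc, ← Real.exp_add]; ring_nf
  have he1 : Real.exp (-(2 * m * ρ)) ≤ 1 := Real.exp_le_one_iff.2 (by
    have := mul_nonneg hm hρ; linarith)
  have habs : |2 * m * Δ| = 2 * m * |Δ| := by rw [abs_mul, abs_of_nonneg (by positivity)]
  rw [habs] at hs
  have hq : 0 ≤ 1 - 2 * m * Δ + (2 * m * Δ) ^ 2 / 2 := by nlinarith [sq_nonneg (1 - 2 * m * Δ)]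
  have hqc := mul_le_mul_of_nonneg_left hcb hq
  have h8 : (2 * m * |Δ|) ^ 3 * c ≤ 8 * m ^ 3 * (1 + L * g) ^ 3 * |Δ| ^ 3 := by
    have := mul_le_mul_of_nonneg_left hcK (by positivity : 0 ≤ (2 * m * |Δ|) ^ 3)
    linarith
  have hA3 : (l ^ 3 + 6 * m * b * l ^ 2 + 6 * m ^ 2 * b ^ 2 * l) * Δ ^ 3 ≤
      (L ^ 3 + 6 * m * L ^ 2 + 6 * m ^ 2 * L) * |Δ| ^ 3 := by
    have h1 : Δ ^ 3 ≤ |Δ| ^ 3 := (le_abs_self _).trans (abs_pow Δ 3).le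
    have h2 : l ^ 3 + 6 * m * b * l ^ 2 + 6 * m ^ 2 * b ^ 2 * l ≤
        L ^ 3 + 6 * m * 1 * L ^ 2 + 6 * m ^ 2 * 1 ^ 2 * L := by gcongr
    have h3 : 0 ≤ l ^ 3 + 6 * m * b * l ^ 2 + 6 * m ^ 2 * b ^ 2 * l := by positivity
    refine (mul_le_mul_of_nonneg_left h1 h3).trans ?_
    refine mul_le_mul_of_nonneg_right ?_ (by positivity)
    linarith
  have hA4 : -((2 * m * L ^ 3 + 6 * m ^ 2 * L ^ 2) * |Δ| ^ 4) ≤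
      (2 * m * l ^ 3 + 6 * m ^ 2 * b * l ^ 2) * Δ ^ 4 := by
    have : 0 ≤ (2 * m * L ^ 3 + 6 * m ^ 2 * L ^ 2) * |Δ| ^ 4 := by positivity
    have : 0 ≤ (2 * m * l ^ 3 + 6 * m ^ 2 * b * l ^ 2) * Δ ^ 4 := by positivity
    linarith
  have hA5 : 2 * m ^ 2 * l ^ 3 * Δ ^ 5 ≤ 2 * m ^ 2 * L ^ 3 * |Δ| ^ 5 := by
    have h1 : Δ ^ 5 ≤ |Δ| ^ 5 := (le_abs_self _).trans (abs_pow Δ 5).le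
    refine (mul_le_mul_of_nonneg_left h1 (by positivity)).trans ?_
    gcongr
  obtain ⟨M, hM⟩ : ∃ M, M = (8 * m ^ 3 * (1 + L * g) ^ 3 + (L ^ 3 + 6 * m * L ^ 2 + 6 * m ^ 2 * L)) *
      |Δ| ^ 3 + (2 * m * L ^ 3 + 6 * m ^ 2 * L ^ 2) * |Δ| ^ 4 + 2 * m ^ 2 * L ^ 3 * |Δ| ^ 5 :=
    ⟨_, rfl⟩
  have hM0 : 0 ≤ M := by rw [hM]; positivity
  obtain ⟨p, hp⟩ : ∃ p, p = b ^ 3 - (3 * l * b ^ 2 + 2 * m * b ^ 3) * Δ +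
      (3 * l ^ 2 * b + 6 * m * l * b ^ 2 + 2 * m ^ 2 * b ^ 3) * Δ ^ 2 := ⟨_, rfl⟩
  have hpM : p - M ≤ Real.exp (-(2 * m * Δ)) * c := by
    have e : (1 - 2 * m * Δ + (2 * m * Δ) ^ 2 / 2) * (b - l * Δ) ^ 3 = p -
      (l ^ 3 + 6 * m * b * l ^ 2 + 6 * m ^ 2 * b ^ 2 * l) * Δ ^ 3 +
      (2 * m * l ^ 3 + 6 * m ^ 2 * b * l ^ 2) * Δ ^ 4 - 2 * m ^ 2 * l ^ 3 * Δ ^ 5 := by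
      rw [hp]; ring
    rw [e] at hqc
    have e2 : (1 - 2 * m * Δ + (2 * m * Δ) ^ 2 / 2 - (2 * m * |Δ|) ^ 3) * c =
      (1 - 2 * m * Δ + (2 * m * Δ) ^ 2 / 2) * c - (2 * m * |Δ|) ^ 3 * c := by ring
    rw [e2] at hs
    linarith
  have h1 := mul_le_mul_of_nonneg_left hpM (Real.exp_pos (-(2 * m * ρ))).le
  have h2 := mul_le_mul_of_nonneg_right he1 hM0
  rw [← e0, mul_sub] at h1
  rw [← hp]
  linarith

variable {E : Type*} [NormedAddCommGroup E] [InnerProductSpace ℝ E]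

/-- The identity `Δ = ν + (‖δ‖² - Δ²) / (2 ‖x‖)` is exact. Replacing `Δ²` by `ν²`, the square of the
radial component, costs only third order. -/
theorem norm_add_sub_norm_le {x δ : E} (hx : 0 < ‖x‖) {ν Δ : ℝ} (hν : ν = inner ℝ x δ / ‖x‖)
    (hΔ : Δ = ‖x + δ‖ - ‖x‖) :
    |Δ| ≤ ‖δ‖ ∧ ν ^ 2 - ‖δ‖ ^ 3 / ‖x‖ ≤ Δ ^ 2 ∧
      Δ ≤ ν + (‖δ‖ ^ 2 - ν ^ 2) / (2 * ‖x‖) + ‖δ‖ ^ 3 / (2 * ‖x‖ ^ 2) := by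
  have h1 : |Δ| ≤ ‖δ‖ := by
    rw [hΔ]; simpa using abs_norm_sub_norm_le (x + δ) x
  have h2 : |ν| ≤ ‖δ‖ := by
    rw [hν, abs_div, abs_of_pos hx, div_le_iff₀ hx, mul_comm]
    exact abs_real_inner_le_norm x δ
  obtain ⟨r, hr⟩ : ∃ r, r = ‖x‖ := ⟨_, rfl⟩
  obtain ⟨a, ha⟩ : ∃ a, a = ‖δ‖ := ⟨_, rfl⟩
  have h3 : Δ = ν + (a ^ 2 - Δ ^ 2) / (2 * r) := by
    have h4 := norm_add_sq_real x δ
    have h5 : ‖x + δ‖ = Δ + ‖x‖ := by rw [hΔ]; ring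
    have h6 : inner ℝ x δ = ν * ‖x‖ := by rw [hν]; field_simp
    rw [h5, h6, ← hr, ← ha] at h4
    rw [← hr] at hx
    field_simp
    linarith
  rw [← hr] at hx
  rw [← hr, ← ha]
  rw [← ha] at h1 h2
  have ha0 : 0 ≤ a := (abs_nonneg _).trans h1
  obtain ⟨θ, hθ⟩ : ∃ θ, θ = (a ^ 2 - Δ ^ 2) / (2 * r) := ⟨_, rfl⟩
  rw [← hθ] at h3
  have hθ0 : 0 ≤ θ := by
    rw [hθ]; exact div_nonneg (sub_nonneg.2 (sq_le_sq.2 (by rwa [abs_of_nonneg ha0]))) (by positivity)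
  have hθ1 : θ ≤ a ^ 2 / (2 * r) := by
    rw [hθ]; gcongr; linarith [sq_nonneg Δ]
  have h7 : ν ^ 2 - a ^ 3 / r ≤ Δ ^ 2 := by
    have e : a ^ 3 / r = 2 * a * (a ^ 2 / (2 * r)) := by field_simp
    rw [e]
    have := (abs_le.1 h2).1
    nlinarith [mul_le_mul_of_nonneg_left hθ1 ha0, mul_nonneg hθ0 (by linarith : 0 ≤ a + ν)]
  refine ⟨h1, h7, ?_⟩
  have h8 : θ ≤ (a ^ 2 - ν ^ 2) / (2 * r) + a ^ 3 / (2 * r ^ 2) := by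
    have e : (a ^ 2 - ν ^ 2) / (2 * r) + a ^ 3 / (2 * r ^ 2) =
      (a ^ 2 - (ν ^ 2 - a ^ 3 / r)) / (2 * r) := by field_simp; ring
    rw [e, hθ]; gcongr
  linarith

/-- The barrier exceeds `1` only for `w < 0`, which needs a step of length at least `κ`. Capping at
`1` therefore costs at most a multiple of `a ^ 3`; this is why the barrier is built around a radius
`g` strictly below `R`. -/
theorem barrier_le_min_one_add {m l L g κ w a : ℝ} (hm : 0 ≤ m) (hl : 0 ≤ l) (hlL : l ≤ L)
    (hg : 0 ≤ g) (hκ : 0 < κ) (ha : 0 ≤ a) (hy : -g ≤ w) (hwa : w < 0 → κ ≤ a) :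
    barrier m l w ≤
      min (barrier m l w) 1 + Real.exp (2 * m * g) * (1 + L * g) ^ 3 / κ ^ 3 * a ^ 3 := by
  have hL : 0 ≤ L := hl.trans hlL
  have hp : 0 ≤ Real.exp (2 * m * g) * (1 + L * g) ^ 3 / κ ^ 3 * a ^ 3 := by positivity
  rcases le_total (barrier m l w) 1 with h | h
  · rw [min_eq_left h]; linarith
  rw [min_eq_right h]
  rcases le_or_gt 0 w with hw | hw
  · have h4 : max (1 - l * w) 0 ≤ 1 := max_le (by linarith [mul_nonneg hl hw]) zero_le_one
    have h5 : Real.exp (-(2 * m * w)) ≤ 1 :=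
      Real.exp_le_one_iff.2 (by have := mul_nonneg hm hw; linarith)
    have : barrier m l w ≤ 1 :=
      mul_le_one₀ h5 (by positivity) (pow_le_one₀ (le_max_right _ _) h4)
    linarith
  · have h4 : max (1 - l * w) 0 ≤ 1 + L * g :=
      max_le (by nlinarith [mul_le_mul_of_nonneg_right hlL hg, mul_le_mul_of_nonneg_left hy hl])
        (by positivity)
    have h5 : Real.exp (-(2 * m * w)) ≤ Real.exp (2 * m * g) :=
      Real.exp_le_exp.2 (by nlinarith [mul_le_mul_of_nonneg_left hy hm])
    have h6 : barrier m l w ≤ Real.exp (2 * m * g) * (1 + L * g) ^ 3 := by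
      unfold barrier
      exact mul_le_mul h5 (pow_le_pow_left₀ (le_max_right _ _) h4 3) (by positivity)
        (Real.exp_pos _).le
    have h8 : Real.exp (2 * m * g) * (1 + L * g) ^ 3 =
        Real.exp (2 * m * g) * (1 + L * g) ^ 3 / κ ^ 3 * κ ^ 3 := by field_simp
    have h9 : Real.exp (2 * m * g) * (1 + L * g) ^ 3 / κ ^ 3 * κ ^ 3 ≤
        Real.exp (2 * m * g) * (1 + L * g) ^ 3 / κ ^ 3 * a ^ 3 :=
      mul_le_mul_of_nonneg_left (pow_le_pow_left₀ hκ.le (hwa hw) 3) (by positivity)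
    linarith

/-- The two preceding expansions and the capping bound combined: below the capped barrier lies a
quadratic in `δ`, up to terms of order three and more, with `C` independent of `x` and `l`. It is
ready for integration against a Gaussian. -/
theorem exists_barrier_increment_le {m L g R : ℝ} (hm : 0 ≤ m) (hL : 0 ≤ L) (hg : 0 ≤ g)
    (hR : g < R) : ∃ C, 0 ≤ C ∧ ∀ (l : ℝ) (x δ : E) (b : ℝ), 0 ≤ l → l ≤ L → R ≤ ‖x‖ →
      b = max (1 - l * (‖x‖ - g)) 0 →
      Real.exp (-(2 * m * (‖x‖ - g))) * (b ^ 3 - (3 * l * b ^ 2 + 2 * m * b ^ 3) *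
        (inner ℝ x δ / ‖x‖ + (‖δ‖ ^ 2 - (inner ℝ x δ / ‖x‖) ^ 2) / (2 * ‖x‖)) +
      (3 * l ^ 2 * b + 6 * m * l * b ^ 2 + 2 * m ^ 2 * b ^ 3) * (inner ℝ x δ / ‖x‖) ^ 2) -
        C * (‖δ‖ ^ 3 + ‖δ‖ ^ 4 + ‖δ‖ ^ 5) ≤ min (barrier m l (‖x + δ‖ - g)) 1 := by
  have hR0 : 0 < R := hg.trans_lt hR
  obtain ⟨C₁, hC₁⟩ : ∃ C₁, C₁ = (8 * m ^ 3 * (1 + L * g) ^ 3 +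
    (L ^ 3 + 6 * m * L ^ 2 + 6 * m ^ 2 * L)) + (2 * m * L ^ 3 + 6 * m ^ 2 * L ^ 2) +
    2 * m ^ 2 * L ^ 3 := ⟨_, rfl⟩
  obtain ⟨C₂, hC₂⟩ : ∃ C₂, C₂ = (3 * L + 2 * m) / (2 * R ^ 2) +
    (3 * L ^ 2 + 6 * m * L + 2 * m ^ 2) / R := ⟨_, rfl⟩
  obtain ⟨C₃, hC₃⟩ : ∃ C₃, C₃ = Real.exp (2 * m * g) * (1 + L * g) ^ 3 / (R - g) ^ 3 := ⟨_, rfl⟩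
  have hRg : 0 < R - g := sub_pos.2 hR
  have h₁ : 0 ≤ C₁ := by rw [hC₁]; positivity
  have h₂ : 0 ≤ C₂ := by rw [hC₂]; positivity
  have h₃ : 0 ≤ C₃ := by rw [hC₃]; positivity
  refine ⟨C₁ + C₂ + C₃, by positivity, fun l x δ b hl hlL hx hb => ?_⟩
  have hr0 : 0 < ‖x‖ := hR0.trans_le hx
  have ha0 : 0 ≤ ‖δ‖ := norm_nonneg _
  obtain ⟨ν, hν⟩ : ∃ ν, ν = inner ℝ x δ / ‖x‖ := ⟨_, rfl⟩
  obtain ⟨Δ, hΔ⟩ : ∃ Δ, Δ = ‖x + δ‖ - ‖x‖ := ⟨_, rfl⟩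
  obtain ⟨ρ, hρ⟩ : ∃ ρ, ρ = ‖x‖ - g := ⟨_, rfl⟩
  obtain ⟨n1, n2, n3⟩ := norm_add_sub_norm_le hr0 hν hΔ
  have hρ0 : 0 ≤ ρ := by rw [hρ]; linarith
  have eρ : ‖x + δ‖ - g = ρ + Δ := by rw [hρ, hΔ]; ring
  have hy : -g ≤ ρ + Δ := by rw [← eρ]; linarith [norm_nonneg (x + δ)]
  have key := barrier_taylor hm hl hlL hρ0 hg hy
  rw [← hν, eρ, ← hρ]
  rw [← hρ] at hb
  rw [← hb] at key
  have hb0 : 0 ≤ b := hb ▸ le_max_right _ _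
  have hb1 : b ≤ 1 := by
    rw [hb]; exact max_le (by linarith [mul_nonneg hl hρ0]) zero_le_one
  obtain ⟨e, he⟩ : ∃ e, e = Real.exp (-(2 * m * ρ)) := ⟨_, rfl⟩
  have he0 : 0 ≤ e := he ▸ (Real.exp_pos _).le
  have he1 : e ≤ 1 := by
    rw [he]; exact Real.exp_le_one_iff.2 (by have := mul_nonneg hm hρ0; linarith)
  obtain ⟨β, hβ⟩ : ∃ β, β = 3 * l * b ^ 2 + 2 * m * b ^ 3 := ⟨_, rfl⟩
  obtain ⟨α, hα⟩ : ∃ α, α = 3 * l ^ 2 * b + 6 * m * l * b ^ 2 + 2 * m ^ 2 * b ^ 3 := ⟨_, rfl⟩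
  have hβ0 : 0 ≤ β := by rw [hβ]; positivity
  have hα0 : 0 ≤ α := by rw [hα]; positivity
  have hβ1 : β ≤ 3 * L + 2 * m := by
    have : β ≤ 3 * L * 1 ^ 2 + 2 * m * 1 ^ 3 := by rw [hβ]; gcongr
    linarith
  have hα1 : α ≤ 3 * L ^ 2 + 6 * m * L + 2 * m ^ 2 := by
    have : α ≤ 3 * L ^ 2 * 1 + 6 * m * L * 1 ^ 2 + 2 * m ^ 2 * 1 ^ 3 := by rw [hα]; gcongr
    linarith
  rw [← he, ← hβ, ← hα] at key ⊢
  obtain ⟨S, hS⟩ : ∃ S, S = ‖δ‖ ^ 3 + ‖δ‖ ^ 4 + ‖δ‖ ^ 5 := ⟨_, rfl⟩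
  have q3 : 0 ≤ ‖δ‖ ^ 3 := by positivity
  have q4 : 0 ≤ ‖δ‖ ^ 4 := by positivity
  have q5 : 0 ≤ ‖δ‖ ^ 5 := by positivity
  have h3S : ‖δ‖ ^ 3 ≤ S := by linarith
  have h4S : ‖δ‖ ^ 4 ≤ S := by linarith
  have h5S : ‖δ‖ ^ 5 ≤ S := by linarith
  rw [← hS]
  have e₁ : (8 * m ^ 3 * (1 + L * g) ^ 3 + (L ^ 3 + 6 * m * L ^ 2 + 6 * m ^ 2 * L)) * |Δ| ^ 3 +
      (2 * m * L ^ 3 + 6 * m ^ 2 * L ^ 2) * |Δ| ^ 4 + 2 * m ^ 2 * L ^ 3 * |Δ| ^ 5 ≤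
      C₁ * S := by
    rw [hC₁, add_mul _ _ S, add_mul _ _ S]
    exact add_le_add (add_le_add (mul_le_mul_of_nonneg_left (h3S.trans' (pow_le_pow_left₀
      (abs_nonneg _) n1 3)) (by positivity)) (mul_le_mul_of_nonneg_left (h4S.trans'
      (pow_le_pow_left₀ (abs_nonneg _) n1 4)) (by positivity))) (mul_le_mul_of_nonneg_left
      (h5S.trans' (pow_le_pow_left₀ (abs_nonneg _) n1 5)) (by positivity))
  have e₂ : (β * (‖δ‖ ^ 3 / (2 * ‖x‖ ^ 2)) + α * (‖δ‖ ^ 3 / ‖x‖)) ≤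
      C₂ * S := by
    have : β * (‖δ‖ ^ 3 / (2 * ‖x‖ ^ 2)) + α * (‖δ‖ ^ 3 / ‖x‖) ≤ (3 * L + 2 * m) *
      (‖δ‖ ^ 3 / (2 * R ^ 2)) + (3 * L ^ 2 + 6 * m * L + 2 * m ^ 2) * (‖δ‖ ^ 3 / R) := by gcongr
    refine this.trans ?_
    have e3 : (3 * L + 2 * m) * (‖δ‖ ^ 3 / (2 * R ^ 2)) +
      (3 * L ^ 2 + 6 * m * L + 2 * m ^ 2) * (‖δ‖ ^ 3 / R) = C₂ * ‖δ‖ ^ 3 := by rw [hC₂]; ring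
    rw [e3]
    exact mul_le_mul_of_nonneg_left h3S h₂
  have e₃ : e * (b ^ 3 - β * (ν + (‖δ‖ ^ 2 - ν ^ 2) / (2 * ‖x‖)) + α * ν ^ 2) ≤
      e * (b ^ 3 - β * Δ + α * Δ ^ 2) +
        (β * (‖δ‖ ^ 3 / (2 * ‖x‖ ^ 2)) + α * (‖δ‖ ^ 3 / ‖x‖)) := by
    have hp : 0 ≤ β * (‖δ‖ ^ 3 / (2 * ‖x‖ ^ 2)) + α * (‖δ‖ ^ 3 / ‖x‖) := by positivity
    have h1 : b ^ 3 - β * (ν + (‖δ‖ ^ 2 - ν ^ 2) / (2 * ‖x‖)) + α * ν ^ 2 ≤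
      b ^ 3 - β * Δ + α * Δ ^ 2 + (β * (‖δ‖ ^ 3 / (2 * ‖x‖ ^ 2)) + α * (‖δ‖ ^ 3 / ‖x‖)) := by
      have h2 := mul_le_mul_of_nonneg_left n3 hβ0
      have h3 := mul_le_mul_of_nonneg_left n2 hα0
      linarith
    have h2 := mul_le_mul_of_nonneg_left h1 he0
    have h3 := mul_le_mul_of_nonneg_right he1 hp
    linarith
  have e₄ : barrier m l (ρ + Δ) ≤
      min (barrier m l (ρ + Δ)) 1 + C₃ * S := by
    refine (barrier_le_min_one_add hm hl hlL hg hRg ha0 hy fun hw => ?_).trans ?_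
    · have := (abs_le.1 n1).1
      rw [hρ] at hw; linarith
    · rw [← hC₃]
      exact add_le_add_right (mul_le_mul_of_nonneg_left h3S h₃) _
  rw [add_mul, add_mul]
  linarith

end PathEstimate

/-! ### The barrier under one Gaussian step. -/

namespace PathEstimate

/-- The inverse width of the barrier at time `t`. -/
noncomputable def barrierRate (t : ℝ) : ℝ := (√(8 * t))⁻¹

theorem barrierRate_pos {t : ℝ} (ht : 0 < t) : 0 < barrierRate t := by
  unfold barrierRate; positivity

theorem barrierRate_sq {t : ℝ} (ht : 0 < t) : barrierRate t ^ 2 = 1 / (8 * t) := by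
  rw [barrierRate, inv_pow, Real.sq_sqrt (by positivity), one_div]

theorem barrierRate_anti {s t : ℝ} (hs : 0 < s) (hst : s ≤ t) : barrierRate t ≤ barrierRate s := by
  unfold barrierRate; gcongr

/-- For `l = (8t)^(-1/2)` the derivative is `-4 l³`, and a convex function lies above its tangent.
-/
theorem barrierRate_add_ge {t h : ℝ} (ht : 0 < t) (hh : 0 ≤ h) :
    barrierRate t - 4 * barrierRate t ^ 3 * h ≤ barrierRate (t + h) := by
  obtain ⟨l, hl⟩ : ∃ l, l = barrierRate t := ⟨_, rfl⟩
  have hl0 : 0 < l := hl ▸ barrierRate_pos ht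
  have hl2 : l ^ 2 = 1 / (8 * t) := hl ▸ barrierRate_sq ht
  have hT := barrierRate_pos (by linarith : 0 < t + h)
  have hT2 := barrierRate_sq (by linarith : 0 < t + h)
  rw [← hl]
  rcases le_total (l - 4 * l ^ 3 * h) 0 with h0 | h0
  · linarith
  refine (sq_le_sq₀ h0 hT.le).1 ?_
  have e : (l - 4 * l ^ 3 * h) ^ 2 = l ^ 2 * (1 - 4 * l ^ 2 * h) ^ 2 := by ring
  rw [e, hT2, hl2]
  have h1 : 0 ≤ 1 - 4 * l ^ 2 * h := by
    have : l * (1 - 4 * l ^ 2 * h) = l - 4 * l ^ 3 * h := by ring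
    exact nonneg_of_mul_nonneg_right (this ▸ h0) hl0
  rw [hl2] at h1
  have e2 : 1 - 4 * (1 / (8 * t)) * h = (2 * t - h) / (2 * t) := by field_simp; ring
  rw [e2] at h1 ⊢
  have h2 : 0 ≤ 2 * t - h := by
    by_contra hc
    exact absurd h1 (not_le.2 (div_neg_of_neg_of_pos (not_le.1 hc) (by positivity)))
  rw [div_pow, div_mul_div_comm, div_le_div_iff₀ (by positivity) (by positivity)]
  have : (2 * t - h) ^ 2 * (t + h) ≤ 4 * t ^ 3 := by
    nlinarith [mul_nonneg (mul_nonneg hh hh) h2, mul_nonneg (mul_nonneg hh hh) ht.le]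
  nlinarith

/-- The barrier is a subsolution of the heat equation with drift `m`. -/
theorem barrier_time_step {m η T t h ρ b : ℝ} (hm : 0 ≤ m) (hη : 0 < η) (ht : η ≤ t) (hh : 0 ≤ h)
    (hT : t + h ≤ T) (hρ : 0 ≤ ρ) (hb : b = max (1 - barrierRate t * ρ) 0) :
    barrier m (barrierRate (t + h)) ρ ≤ Real.exp (-(2 * m * ρ)) *
      (b ^ 3 + 3 * barrierRate t ^ 2 * b * h) +
      (3 * (4 * √(8 * T) * barrierRate η ^ 3) ^ 2 + (4 * √(8 * T) * barrierRate η ^ 3) ^ 3 * T) *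
        h ^ 2 := by
  have ht0 : 0 < t := hη.trans_le ht
  have hT0 : 0 ≤ T := by linarith
  obtain ⟨l, hl⟩ : ∃ l, l = barrierRate t := ⟨_, rfl⟩
  have hl0 : 0 < l := hl ▸ barrierRate_pos ht0
  have hll : l ≤ barrierRate η := hl ▸ barrierRate_anti hη ht
  obtain ⟨M, hM⟩ : ∃ M, M = 4 * √(8 * T) * barrierRate η ^ 3 := ⟨_, rfl⟩
  have hM0 : 0 ≤ M := by rw [hM]; have := barrierRate_pos hη; positivity
  have hb0 : 0 ≤ b := hb ▸ le_max_right _ _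
  have hstep := barrierRate_add_ge ht0 hh
  rw [← hl] at hb hstep ⊢
  rw [← hM]
  have he0 := (Real.exp_pos (-(2 * m * ρ))).le
  have he1 : Real.exp (-(2 * m * ρ)) ≤ 1 := Real.exp_le_one_iff.2 (by
    have := mul_nonneg hm hρ; linarith)
  have hR0 : 0 ≤ (3 * M ^ 2 + M ^ 3 * T) * h ^ 2 := by positivity
  unfold barrier
  rcases le_total (1 - barrierRate (t + h) * ρ) 0 with h0 | h0
  · rw [max_eq_right h0]
    have : 0 ≤ Real.exp (-(2 * m * ρ)) * (b ^ 3 + 3 * l ^ 2 * b * h) := by positivity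
    simp only [ne_eq, OfNat.ofNat_ne_zero, not_false_eq_true, zero_pow, mul_zero]
    linarith
  have hρ1 : ρ ≤ √(8 * T) := by
    have h1 : ρ ≤ √(8 * (t + h)) := by
      have h2 : 0 < √(8 * (t + h)) := by positivity
      have h3 : barrierRate (t + h) * ρ ≤ 1 := by linarith
      rw [barrierRate, inv_mul_le_iff₀ h2] at h3
      linarith
    exact h1.trans (Real.sqrt_le_sqrt (by linarith))
  obtain ⟨c, hc⟩ : ∃ c, c = 4 * l ^ 3 * ρ * h := ⟨_, rfl⟩
  have hc0 : 0 ≤ c := by rw [hc]; positivity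
  have hcM : c ≤ M * h := by
    rw [hc, hM]
    have : l ^ 3 * ρ ≤ barrierRate η ^ 3 * √(8 * T) := mul_le_mul
      (pow_le_pow_left₀ hl0.le hll 3) hρ1 hρ (pow_nonneg (barrierRate_pos hη).le 3)
    nlinarith
  -- The subsolution inequality: the time derivative of the cube is `3 b²` times `4 l³ ρ`, and `4 y
  -- (1 - y) ≤ 1` with `y = l ρ` bounds it by `3 l² b`, half the second space derivative.
  have hbc : b * c ≤ l ^ 2 * h := by
    rcases le_total (1 - l * ρ) 0 with h1 | h1
    · rw [hb, max_eq_right h1, zero_mul]; positivity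
    · rw [hb, max_eq_left h1, hc]
      have e : (1 - l * ρ) * (4 * l ^ 3 * ρ * h) = (l ^ 2 * h) * (4 * (l * ρ * (1 - l * ρ))) := by
        ring
      rw [e]
      have : 4 * (l * ρ * (1 - l * ρ)) ≤ 1 := by nlinarith [sq_nonneg (2 * (l * ρ) - 1)]
      exact mul_le_of_le_one_right (by positivity) this
  have h4 : max (1 - barrierRate (t + h) * ρ) 0 ≤ b + c := by
    refine max_le ?_ (by positivity)
    have h5 := le_max_left (1 - l * ρ) 0
    rw [← hb] at h5
    have h6 := mul_le_mul_of_nonneg_right hstep hρ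
    rw [hc]; linarith
  have h5 : max (1 - barrierRate (t + h) * ρ) 0 ^ 3 ≤
      b ^ 3 + 3 * l ^ 2 * b * h + (3 * M ^ 2 + M ^ 3 * T) * h ^ 2 := by
    refine (pow_le_pow_left₀ (le_max_right _ _) h4 3).trans ?_
    have hb1 : b ≤ 1 := by
      rw [hb]; exact max_le (by linarith [mul_nonneg hl0.le hρ]) zero_le_one
    have t1 : 3 * b * (b * c) ≤ 3 * b * (l ^ 2 * h) := by gcongr
    have t2 : 3 * b * c ^ 2 ≤ 3 * 1 * (M * h) ^ 2 := by gcongr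
    have t3 : c ^ 3 ≤ (M * h) ^ 3 := by gcongr
    have t4 : (M * h) ^ 3 ≤ M ^ 3 * T * h ^ 2 := by
      have : M ^ 3 * h ^ 2 * h ≤ M ^ 3 * h ^ 2 * T := by gcongr; linarith
      nlinarith
    nlinarith
  refine (mul_le_mul_of_nonneg_left h5 he0).trans ?_
  rw [mul_add]
  exact add_le_add_right (mul_le_of_le_one_left hR0 he1) _

variable {d : ℕ}

theorem integral_inner_sq_stdGaussian (x : Eucl d) :
    ∫ z, inner ℝ x z ^ 2 ∂(stdGaussian (Eucl d)) = ‖x‖ ^ 2 := by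
  have h := variance_dual_stdGaussian (innerSL ℝ x)
  rw [variance_of_integral_eq_zero (by fun_prop) (integral_strongDual_stdGaussian _)] at h
  simpa using h

theorem integral_inner_stdGaussian (x : Eucl d) :
    ∫ z, inner ℝ x z ∂(stdGaussian (Eucl d)) = 0 :=
  integral_strongDual_stdGaussian (innerSL ℝ x)

theorem integrable_norm_pow_stdGaussian (n : ℕ) :
    Integrable (fun z => ‖z‖ ^ n) (stdGaussian (Eucl d)) :=
  (IsGaussian.memLp_id (stdGaussian (Eucl d)) n (by simp)).integrable_norm_pow'

theorem integrable_inner_sq_stdGaussian (x : Eucl d) :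
    Integrable (fun z => inner ℝ x z ^ 2) (stdGaussian (Eucl d)) := by
  refine ((integrable_norm_pow_stdGaussian 2).const_mul (‖x‖ ^ 2)).mono' (by fun_prop) ?_
  refine Filter.Eventually.of_forall fun z => ?_
  rw [Real.norm_of_nonneg (sq_nonneg _), ← mul_pow]
  exact sq_le_sq.2 ((abs_real_inner_le_norm x z).trans (le_abs_self _))

theorem integrable_inner_stdGaussian (x : Eucl d) :
    Integrable (fun z => inner ℝ x z) (stdGaussian (Eucl d)) :=
  (innerSL ℝ x).integrable_comp IsGaussian.integrable_id

theorem integral_norm_sq_stdGaussian :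
    ∫ z, ‖z‖ ^ 2 ∂(stdGaussian (Eucl d)) = d := by
  have e : ∀ z : Eucl d, ‖z‖ ^ 2 = ∑ i, inner ℝ (EuclideanSpace.basisFun (Fin d) ℝ i) z ^ 2 :=
    fun z => ((EuclideanSpace.basisFun (Fin d) ℝ).sum_sq_inner_right z).symm
  simp_rw [e]
  rw [integral_finsetSum _ fun i _ => integrable_inner_sq_stdGaussian _]
  simp_rw [integral_inner_sq_stdGaussian]
  simp

theorem integral_gaussian_polynomial (x : Eucl d) (c₀ c₁ c₂ c₃ c₄ c₅ c₆ : ℝ) :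
    Integrable (fun z : Eucl d => c₀ + c₁ * inner ℝ x z + c₂ * inner ℝ x z ^ 2 + c₃ * ‖z‖ ^ 2 +
      c₄ * ‖z‖ ^ 3 + c₅ * ‖z‖ ^ 4 + c₆ * ‖z‖ ^ 5) (stdGaussian (Eucl d)) ∧
    ∫ z, (c₀ + c₁ * inner ℝ x z + c₂ * inner ℝ x z ^ 2 + c₃ * ‖z‖ ^ 2 +
      c₄ * ‖z‖ ^ 3 + c₅ * ‖z‖ ^ 4 + c₆ * ‖z‖ ^ 5) ∂(stdGaussian (Eucl d)) =
    c₀ + c₂ * ‖x‖ ^ 2 + c₃ * d + c₄ * ∫ z, ‖z‖ ^ 3 ∂(stdGaussian (Eucl d)) +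
      c₅ * ∫ z, ‖z‖ ^ 4 ∂(stdGaussian (Eucl d)) + c₆ * ∫ z, ‖z‖ ^ 5 ∂(stdGaussian (Eucl d)) := by
  have i1 := (integrable_inner_stdGaussian x).const_mul c₁
  have i2 := (integrable_inner_sq_stdGaussian x).const_mul c₂
  have i3 := (integrable_norm_pow_stdGaussian (d := d) 2).const_mul c₃
  have i4 := (integrable_norm_pow_stdGaussian (d := d) 3).const_mul c₄
  have i5 := (integrable_norm_pow_stdGaussian (d := d) 4).const_mul c₅
  have i6 := (integrable_norm_pow_stdGaussian (d := d) 5).const_mul c₆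
  have i0 : Integrable (fun _ : Eucl d => c₀) (stdGaussian (Eucl d)) := integrable_const _
  have j1 : Integrable (fun z => c₀ + c₁ * inner ℝ x z) (stdGaussian (Eucl d)) := i0.add i1
  have j2 : Integrable (fun z => c₀ + c₁ * inner ℝ x z + c₂ * inner ℝ x z ^ 2)
    (stdGaussian (Eucl d)) := j1.add i2
  have j3 : Integrable (fun z => c₀ + c₁ * inner ℝ x z + c₂ * inner ℝ x z ^ 2 + c₃ * ‖z‖ ^ 2)
    (stdGaussian (Eucl d)) := j2.add i3
  have j4 : Integrable (fun z => c₀ + c₁ * inner ℝ x z + c₂ * inner ℝ x z ^ 2 + c₃ * ‖z‖ ^ 2 +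
    c₄ * ‖z‖ ^ 3) (stdGaussian (Eucl d)) := j3.add i4
  have j5 : Integrable (fun z => c₀ + c₁ * inner ℝ x z + c₂ * inner ℝ x z ^ 2 + c₃ * ‖z‖ ^ 2 +
    c₄ * ‖z‖ ^ 3 + c₅ * ‖z‖ ^ 4) (stdGaussian (Eucl d)) := j4.add i5
  refine ⟨j5.add i6, ?_⟩
  rw [integral_add j5 i6, integral_add j4 i5, integral_add j3 i4, integral_add j2 i3,
    integral_add j1 i2, integral_add i0 i1]
  simp only [integral_const_mul, integral_inner_stdGaussian, integral_inner_sq_stdGaussian,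
    integral_norm_sq_stdGaussian, integral_const, probReal_univ, smul_eq_mul, one_mul, mul_zero,
    add_zero]

theorem continuous_barrier (m l : ℝ) : Continuous (barrier m l) := by
  unfold barrier; fun_prop

theorem barrier_nonneg (m l w : ℝ) : 0 ≤ barrier m l w := by unfold barrier; positivity

theorem integrable_min_barrier (m l g k : ℝ) (x : Eucl d) :
    Integrable (fun z => min (barrier m l (‖x + k • z‖ - g)) 1) (stdGaussian (Eucl d)) := by
  refine Integrable.mono' (integrable_const (1 : ℝ)) ?_ (Filter.Eventually.of_forall fun z => ?_)
  · have := continuous_barrier m l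
    exact Continuous.aestronglyMeasurable (by fun_prop)
  · rw [Real.norm_of_nonneg (le_min (barrier_nonneg _ _ _) zero_le_one)]
    exact min_le_right _ _

/-- The barrier at distance `‖x‖ - g` is subharmonic in space-time for a Gaussian step, up to an
error of third order in the step size. -/
theorem exists_barrier_one_step {g R η : ℝ} (hd : 1 ≤ d) (hg : 0 ≤ g) (hR : g < R) (hη : 0 < η)
    (T : ℝ) : ∃ C, 0 ≤ C ∧ ∀ (t k : ℝ) (x : Eucl d), η ≤ t → 0 ≤ k → k ≤ 1 → t + k ^ 2 ≤ T →
      R ≤ ‖x‖ → barrier (((d : ℝ) - 1) / (2 * R)) (barrierRate (t + k ^ 2)) (‖x‖ - g) - C * k ^ 3 ≤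
        ∫ z, min (barrier (((d : ℝ) - 1) / (2 * R)) (barrierRate t) (‖x + k • z‖ - g)) 1
          ∂(stdGaussian (Eucl d)) := by
  have hR0 : 0 < R := hg.trans_lt hR
  have hd1 : (1 : ℝ) ≤ d := by exact_mod_cast hd
  obtain ⟨m, hm⟩ : ∃ m, m = ((d : ℝ) - 1) / (2 * R) := ⟨_, rfl⟩
  have hm0 : 0 ≤ m := by rw [hm]; exact div_nonneg (by linarith) (by positivity)
  rw [← hm]
  obtain ⟨C₁, hC₁, h₁⟩ := exists_barrier_increment_le (E := Eucl d) (L := barrierRate η) hm0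
    (barrierRate_pos hη).le hg hR
  obtain ⟨M₃, hM₃⟩ : ∃ M, M = ∫ z, ‖z‖ ^ 3 ∂(stdGaussian (Eucl d)) := ⟨_, rfl⟩
  obtain ⟨M₄, hM₄⟩ : ∃ M, M = ∫ z, ‖z‖ ^ 4 ∂(stdGaussian (Eucl d)) := ⟨_, rfl⟩
  obtain ⟨M₅, hM₅⟩ : ∃ M, M = ∫ z, ‖z‖ ^ 5 ∂(stdGaussian (Eucl d)) := ⟨_, rfl⟩
  have p₃ : 0 ≤ M₃ := hM₃ ▸ integral_nonneg fun z => by positivity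
  have p₄ : 0 ≤ M₄ := hM₄ ▸ integral_nonneg fun z => by positivity
  have p₅ : 0 ≤ M₅ := hM₅ ▸ integral_nonneg fun z => by positivity
  obtain ⟨C₂, hC₂⟩ : ∃ C₂, C₂ = 3 * (4 * √(8 * T) * barrierRate η ^ 3) ^ 2 +
    (4 * √(8 * T) * barrierRate η ^ 3) ^ 3 * |T| := ⟨_, rfl⟩
  have hC₂0 : 0 ≤ C₂ := by
    have := barrierRate_pos hη
    rw [hC₂]; positivity
  refine ⟨C₁ * (M₃ + M₄ + M₅) + C₂, by positivity, fun t k x ht hk hk1 hT hx => ?_⟩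
  have ht0 : 0 < t := hη.trans_le ht
  have hr : 0 < ‖x‖ := hR0.trans_le hx
  obtain ⟨l, hl⟩ : ∃ l, l = barrierRate t := ⟨_, rfl⟩
  have hl0 : 0 < l := hl ▸ barrierRate_pos ht0
  have hll : l ≤ barrierRate η := hl ▸ barrierRate_anti hη ht
  obtain ⟨b, hb⟩ : ∃ b, b = max (1 - l * (‖x‖ - g)) 0 := ⟨_, rfl⟩
  have hb0 : 0 ≤ b := hb ▸ le_max_right _ _
  have hT0 : 0 ≤ T := by nlinarith [sq_nonneg k]
  have hts := barrier_time_step hm0 hη ht (sq_nonneg k) hT (by linarith : 0 ≤ ‖x‖ - g)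
    (b := b) (by rw [← hl]; exact hb)
  rw [← hl] at hts ⊢
  rw [abs_of_nonneg hT0] at hC₂
  rw [← hC₂] at hts
  obtain ⟨e, he⟩ : ∃ e, e = Real.exp (-(2 * m * (‖x‖ - g))) := ⟨_, rfl⟩
  have he0 : 0 ≤ e := he ▸ (Real.exp_pos _).le
  rw [← he] at hts
  obtain ⟨β, hβ⟩ : ∃ β, β = 3 * l * b ^ 2 + 2 * m * b ^ 3 := ⟨_, rfl⟩
  obtain ⟨α, hα⟩ : ∃ α, α = 3 * l ^ 2 * b + 6 * m * l * b ^ 2 + 2 * m ^ 2 * b ^ 3 := ⟨_, rfl⟩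
  have hβ0 : 0 ≤ β := by rw [hβ]; positivity
  obtain ⟨hi, hint⟩ := integral_gaussian_polynomial x (e * b ^ 3) (-(e * β * k / ‖x‖))
    (e * (β / (2 * ‖x‖) + α) * k ^ 2 / ‖x‖ ^ 2) (-(e * β * k ^ 2 / (2 * ‖x‖)))
    (-(C₁ * k ^ 3)) (-(C₁ * k ^ 4)) (-(C₁ * k ^ 5))
  have hmono := integral_mono hi (integrable_min_barrier m l g k x) fun z => by
    refine le_trans (le_of_eq ?_) (h₁ l x (k • z) b hl0.le hll hx hb)
    rw [← he, ← hβ, ← hα, inner_smul_right, norm_smul, Real.norm_of_nonneg hk]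
    field_simp
    ring
  rw [hint, ← hM₃, ← hM₄, ← hM₅] at hmono
  refine le_trans ?_ hmono
  -- The outward drift of the radial part of Brownian motion is at most `m` outside the ball of
  -- radius `R`.
  have hmr : ((d : ℝ) - 1) / (2 * ‖x‖) ≤ m := by
    rw [hm]; exact div_le_div_of_nonneg_left (by linarith) (by positivity) (by linarith)
  have hk2 : 0 ≤ k ^ 2 := sq_nonneg k
  -- The factor `exp(-2 m w)` absorbs the drift: the pure `m²` terms cancel and the mixed term left
  -- over is nonnegative.
  have hab : 3 * l ^ 2 * b ≤ α - β * m := by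
    have : α - β * m = 3 * l ^ 2 * b + 3 * m * l * b ^ 2 := by rw [hα, hβ]; ring
    rw [this]
    have : 0 ≤ 3 * m * l * b ^ 2 := by positivity
    linarith
  have hgen : 3 * l ^ 2 * b ≤ α - β * (((d : ℝ) - 1) / (2 * ‖x‖)) :=
    hab.trans (by linarith [mul_le_mul_of_nonneg_left hmr hβ0])
  have hmain : e * (b ^ 3 + 3 * l ^ 2 * b * k ^ 2) ≤
      e * (b ^ 3 + (α - β * (((d : ℝ) - 1) / (2 * ‖x‖))) * k ^ 2) := by gcongr
  -- The radial component of the step has second moment `k²`, its complement `(d - 1) k²`.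
  have eq1 : e * b ^ 3 + e * (β / (2 * ‖x‖) + α) * k ^ 2 / ‖x‖ ^ 2 * ‖x‖ ^ 2 +
      -(e * β * k ^ 2 / (2 * ‖x‖)) * d =
      e * (b ^ 3 + (α - β * (((d : ℝ) - 1) / (2 * ‖x‖))) * k ^ 2) := by
    field_simp
    ring
  rw [eq1]
  have k4 : k ^ 4 ≤ k ^ 3 := pow_le_pow_of_le_one hk hk1 (by norm_num)
  have k5 : k ^ 5 ≤ k ^ 3 := pow_le_pow_of_le_one hk hk1 (by norm_num)
  have r4 : C₁ * k ^ 4 * M₄ ≤ C₁ * k ^ 3 * M₄ := by gcongr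
  have r5 : C₁ * k ^ 5 * M₅ ≤ C₁ * k ^ 3 * M₅ := by gcongr
  have r2 : C₂ * (k ^ 2) ^ 2 ≤ C₂ * k ^ 3 := by
    rw [← pow_mul]; gcongr
  linarith

end PathEstimate

/-! ### Brownian motion avoiding a ball. -/

namespace PathEstimate

variable {d : ℕ} {Q : Measure (PathSpace d)}

theorem IsBrownianLaw.measure_markov {x : Eucl d} {P : Measure (PathSpace d)}
    (hP : IsBrownianLaw x P) (hQ : IsBrownianLaw 0 Q) (t : ℝ≥0)
    {S : Set (PathSpace d × PathSpace d)} (hS : MeasurableSet S) :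
    P {ω | (stopAt t ω, PathEstimate.incrAt t ω) ∈ S} =
      ∫⁻ ω, Q {ω' | (stopAt t ω, ω') ∈ S} ∂P := by
  have := hQ.isProbabilityMeasure
  have hm : Measurable fun ω : PathSpace d => (stopAt t ω, PathEstimate.incrAt t ω) :=
    (measurable_stopAt t).prodMk (measurable_incrAt t)
  have h := Measure.map_apply (μ := P) hm hS
  rw [hP.map_stopAt_incrAt hQ t, Measure.prod_apply hS, lintegral_map
    (measurable_measure_prodMk_left hS) (measurable_stopAt t)] at h
  exact h.symm

/-- The paths which, started at `x`, are outside the open ball of radius `R` around the origin at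
the first `n` positive multiples of `h`. -/
def avoidAt (R : ℝ) (h : ℝ≥0) (n : ℕ) (x : Eucl d) : Set (PathSpace d) :=
  {ω | ∀ j < n, R ≤ ‖x + ω ((j + 1 : ℕ) * h)‖}

theorem mem_avoidAt_succ {R : ℝ} {h : ℝ≥0} {n : ℕ} {x : Eucl d} {ω : PathSpace d} :
    ω ∈ avoidAt R h (n + 1) x ↔ R ≤ ‖x + ω h‖ ∧ incrAt h ω ∈ avoidAt R h n (x + ω h) := by
  have e : ∀ j : ℕ, x + ω h + incrAt h ω ((j + 1 : ℕ) * h) = x + ω ((j + 1 + 1 : ℕ) * h) := by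
    intro j
    have : h + (j + 1 : ℕ) * h = (j + 1 + 1 : ℕ) * h := by push_cast; ring
    rw [incrAt_apply, this]; abel
  simp only [avoidAt, Set.mem_ofPred_eq, e]
  constructor
  · intro H
    exact ⟨by simpa using H 0 n.succ_pos, fun j hj => H (j + 1) (Nat.succ_lt_succ hj)⟩
  · rintro ⟨H0, H⟩ j hj
    cases j with
    | zero => simpa using H0
    | succ j => exact H j (Nat.succ_lt_succ_iff.1 hj)

theorem measurableSet_avoidAt_uncurry (R : ℝ) (h : ℝ≥0) (n : ℕ) :
    MeasurableSet {p : Eucl d × PathSpace d | p.2 ∈ avoidAt R h n p.1} := by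
  have : {p : Eucl d × PathSpace d | p.2 ∈ avoidAt R h n p.1} =
      ⋂ j : ℕ, ⋂ _ : j < n, {p | R ≤ ‖p.1 + p.2 ((j + 1 : ℕ) * h)‖} := by
    ext p; simp [avoidAt]
  rw [this]
  refine MeasurableSet.iInter fun j => MeasurableSet.iInter fun _ => ?_
  exact measurableSet_le measurable_const
    (measurable_fst.add ((measurable_path_eval _).comp measurable_snd)).norm

/-- The Markov property at time `h`. The bound by `G` is needed only outside the ball, since from
inside the event is empty and `G ≥ 0`. -/
theorem measure_avoidAt_succ_le (hQ : IsBrownianLaw 0 Q) (R : ℝ) (h : ℝ≥0) (n : ℕ) (x : Eucl d)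
    {G : Eucl d → ℝ} (hGc : Continuous G) (hG0 : ∀ y, 0 ≤ G y)
    (hGi : Integrable (fun z => G (x + √(h : ℝ) • z)) (stdGaussian (Eucl d)))
    (hG : ∀ y, R ≤ ‖y‖ → Q.real (avoidAt R h n y) ≤ G y) :
    Q.real (avoidAt R h (n + 1) x) ≤ ∫ z, G (x + √(h : ℝ) • z) ∂(stdGaussian (Eucl d)) := by
  have := hQ.isProbabilityMeasure
  have hev : Measurable fun p : PathSpace d × PathSpace d => (x + p.1 h, p.2) :=
    (((measurable_path_eval h).comp measurable_fst).const_add x).prodMk measurable_snd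
  obtain ⟨S, hS⟩ : ∃ S : Set (PathSpace d × PathSpace d), S =
      {p | R ≤ ‖x + p.1 h‖ ∧ p.2 ∈ avoidAt R h n (x + p.1 h)} := ⟨_, rfl⟩
  have hSm : MeasurableSet S := by
    rw [hS]
    exact (measurableSet_le measurable_const
      (((measurable_path_eval h).comp measurable_fst).const_add x).norm).inter
        (hev (measurableSet_avoidAt_uncurry R h n))
  have hm := hQ.measure_markov hQ h hSm
  have e1 : {ω | (stopAt h ω, incrAt h ω) ∈ S} = avoidAt R h (n + 1) x := by
    ext ω
    simp only [hS, Set.mem_ofPred_eq, stopAt_apply, min_self, mem_avoidAt_succ]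
  rw [e1] at hm
  have e2 : ∀ ω, Q {ω' | (stopAt h ω, ω') ∈ S} ≤ ENNReal.ofReal (G (x + ω h)) := by
    intro ω
    simp only [hS, Set.mem_ofPred_eq, stopAt_apply, min_self]
    by_cases hω : R ≤ ‖x + ω h‖
    · simp only [hω, true_and]
      exact (ofReal_measureReal (μ := Q)).symm.le.trans (ENNReal.ofReal_le_ofReal (hG _ hω))
    · simp [hω]
  have e3 : ∫⁻ ω, ENNReal.ofReal (G (x + ω h)) ∂Q =
      ENNReal.ofReal (∫ z, G (x + √(h : ℝ) • z) ∂(stdGaussian (Eucl d))) := by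
    rw [ofReal_integral_eq_lintegral_ofReal hGi (Filter.Eventually.of_forall fun z => hG0 _)]
    have hGm : Measurable fun y => ENNReal.ofReal (G (x + y)) :=
      (hGc.measurable.comp (measurable_const_add x)).ennreal_ofReal
    rw [← lintegral_map (f := fun y => ENNReal.ofReal (G (x + y))) hGm (measurable_path_eval h),
      hQ.map_eval h, lintegral_map hGm (by fun_prop)]
  have e4 : Q (avoidAt R h (n + 1) x) ≤
      ENNReal.ofReal (∫ z, G (x + √(h : ℝ) • z) ∂(stdGaussian (Eucl d))) := by
    rw [hm, ← e3]; exact lintegral_mono e2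
  exact ENNReal.toReal_le_of_le_ofReal (integral_nonneg fun z => hG0 _) e4

/-- The tangent at `w = 0`; its slope is the origin of `(d - 1) / R + 3 / √(8 s)`. -/
theorem barrier_ge (m l w : ℝ) (hm : 0 ≤ m) (hl : 0 ≤ l) (hw : 0 ≤ w) :
    1 - (2 * m + 3 * l) * w ≤ barrier m l w := by
  have h1 : 1 - 2 * m * w ≤ Real.exp (-(2 * m * w)) := by
    linarith [Real.add_one_le_exp (-(2 * m * w))]
  have h2 : Real.exp (-(2 * m * w)) ≤ 1 := Real.exp_le_one_iff.2 (by
    have := mul_nonneg hm hw; linarith)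
  have hlw := mul_nonneg hl hw
  have h3 : max (1 - l * w) 0 ≤ 1 := max_le (by linarith) zero_le_one
  have h4 : 1 - 3 * (l * w) ≤ max (1 - l * w) 0 ^ 3 := by
    rcases le_total (1 - l * w) 0 with h | h
    · rw [max_eq_right h]; linarith
    · rw [max_eq_left h]; nlinarith [mul_nonneg (mul_nonneg hlw hlw) h]
  have h5 : max (1 - l * w) 0 ^ 3 ≤ 1 := pow_le_one₀ (le_max_right _ _) h3
  unfold barrier
  nlinarith [mul_nonneg (sub_nonneg.2 h2) (sub_nonneg.2 h5)]

/-- Induction over the steps, each losing `C h^(3/2)`. The clock starts at `(R - g)² / 8`, where the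
width of the barrier is exactly `R - g`: it vanishes for `‖x‖ ≥ R`, so the case `n = 0` is trivial.
-/
theorem exists_avoidAt_le (hQ : IsBrownianLaw 0 Q) {g R : ℝ} (hd : 1 ≤ d) (hg : 0 ≤ g)
    (hR : g < R) (s : ℝ) : ∃ C, 0 ≤ C ∧ ∀ (h : ℝ≥0) (n : ℕ) (x : Eucl d),
      (h : ℝ) ≤ 1 → n * (h : ℝ) ≤ s → R ≤ ‖x‖ →
      Q.real (avoidAt R h n x) ≤ 1 - barrier (((d : ℝ) - 1) / (2 * R))
        (barrierRate ((R - g) ^ 2 / 8 + n * h)) (‖x‖ - g) + n * (C * √(h : ℝ) ^ 3) := by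
  have := hQ.isProbabilityMeasure
  have hRg : 0 < R - g := sub_pos.2 hR
  obtain ⟨C, hC, H⟩ := exists_barrier_one_step hd hg hR (by positivity : 0 < (R - g) ^ 2 / 8)
    ((R - g) ^ 2 / 8 + s)
  refine ⟨C, hC, fun h n => ?_⟩
  have hh : √(h : ℝ) ^ 2 = h := Real.sq_sqrt h.2
  induction n with
  | zero =>
    intro x _ _ hx
    have e : barrierRate ((R - g) ^ 2 / 8) = (R - g)⁻¹ := by
      rw [barrierRate]
      congr 1
      rw [show 8 * ((R - g) ^ 2 / 8) = (R - g) ^ 2 by ring, Real.sqrt_sq hRg.le]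
    have hb : barrier (((d : ℝ) - 1) / (2 * R)) (R - g)⁻¹ (‖x‖ - g) = 0 := by
      have : 1 - (R - g)⁻¹ * (‖x‖ - g) ≤ 0 := by
        rw [sub_nonpos, inv_mul_eq_div, one_le_div hRg]; linarith
      rw [barrier, max_eq_right this]; simp
    simp only [Nat.cast_zero, zero_mul, add_zero, e, hb, sub_zero]
    exact measureReal_le_one
  | succ n ih =>
    intro x h1 hns hx
    push_cast at hns
    have hh0 : (0 : ℝ) ≤ h := h.2
    have hns' : n * (h : ℝ) ≤ s := by linarith
    obtain ⟨t, ht⟩ : ∃ t, t = (R - g) ^ 2 / 8 + n * (h : ℝ) := ⟨_, rfl⟩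
    have hstep := H t √(h : ℝ) x (by rw [ht]; have : 0 ≤ n * (h : ℝ) := by positivity
                                     linarith) (Real.sqrt_nonneg _)
      (Real.sqrt_le_one.2 h1) (by rw [hh, ht]; linarith) hx
    have et : t + √(h : ℝ) ^ 2 = (R - g) ^ 2 / 8 + (n + 1 : ℕ) * (h : ℝ) := by
      rw [hh, ht]; push_cast; ring
    rw [et] at hstep
    have hi := integrable_min_barrier (((d : ℝ) - 1) / (2 * R)) (barrierRate t) g √(h : ℝ) x
    have hpos : 0 ≤ n * (C * √(h : ℝ) ^ 3) := by positivity
    have key := measure_avoidAt_succ_le hQ R h n x (G := fun y => 1 - min (barrier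
      (((d : ℝ) - 1) / (2 * R)) (barrierRate t) (‖y‖ - g)) 1 + n * (C * √(h : ℝ) ^ 3))
      (by have := continuous_barrier (((d : ℝ) - 1) / (2 * R)) (barrierRate t); fun_prop)
      (fun y => by
        have := min_le_right (barrier (((d : ℝ) - 1) / (2 * R)) (barrierRate t) (‖y‖ - g)) 1
        linarith)
      (((integrable_const _).sub hi).add (integrable_const _))
      (fun y hy => by
        have := ih y h1 hns' hy
        rw [← ht] at this
        have := min_le_left (barrier (((d : ℝ) - 1) / (2 * R)) (barrierRate t) (‖y‖ - g)) 1
        linarith)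
    have hi2 : Integrable (fun z : Eucl d => 1 - min (barrier (((d : ℝ) - 1) / (2 * R))
      (barrierRate t) (‖x + √(h : ℝ) • z‖ - g)) 1) (stdGaussian (Eucl d)) :=
      (integrable_const _).sub hi
    rw [integral_add hi2 (integrable_const _), integral_sub (integrable_const _) hi] at key
    simp only [integral_const, probReal_univ, smul_eq_mul, one_mul] at key
    push_cast at hstep ⊢
    linarith

/-- A Brownian path started at distance `‖x‖ - R` from a ball of radius `R` avoids this ball with
probability at most proportional to that distance. -/
theorem measureReal_avoid_centered_le (hQ : IsBrownianLaw 0 Q) {R : ℝ} (hd : 1 ≤ d) (hR : 0 < R)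
    {s : ℝ≥0} (hs : 0 < s) {x : Eucl d} (hx : R ≤ ‖x‖) :
    Q.real {ω | ∀ t ≤ s, R ≤ ‖x + ω t‖} ≤
      (((d : ℝ) - 1) / R + 3 / √(8 * (s : ℝ))) * (‖x‖ - R) := by
  have := hQ.isProbabilityMeasure
  have hd1 : (1 : ℝ) ≤ d := by exact_mod_cast hd
  have hs0 : (0 : ℝ) < s := hs
  have hgle : ∀ g, 0 ≤ g → g < R → Q.real {ω | ∀ t ≤ s, R ≤ ‖x + ω t‖} ≤
      (((d : ℝ) - 1) / R + 3 / √(8 * (s : ℝ))) * (‖x‖ - g) := by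
    intro g hg hgR
    obtain ⟨C, hC, H⟩ := exists_avoidAt_le hQ hd hg hgR (s : ℝ)
    obtain ⟨p, hp⟩ : ∃ p, p = Q.real {ω | ∀ t ≤ s, R ≤ ‖x + ω t‖} := ⟨_, rfl⟩
    obtain ⟨B, hB⟩ : ∃ B, B = barrier (((d : ℝ) - 1) / (2 * R))
      (barrierRate ((R - g) ^ 2 / 8 + s)) (‖x‖ - g) := ⟨_, rfl⟩
    have hRg : 0 < R - g := sub_pos.2 hgR
    -- With `n` steps of length `s / n` the accumulated error is `C s √(s / n)`, which tends to
    -- zero.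
    have hn : ∀ n : ℕ, 0 < n → (s : ℝ) ≤ n → p ≤ 1 - B + C * s * √((s : ℝ) / n) := by
      intro n hn0 hsn
      have hn0' : (0 : ℝ) < n := by exact_mod_cast hn0
      have h1 := H (s / n) n x (by push_cast; rw [div_le_one hn0']; exact hsn)
        (by push_cast; field_simp; exact le_rfl) hx
      have e1 : n * (((s / n : ℝ≥0) : ℝ)) = s := by push_cast; field_simp
      have e2 : n * (C * √((s / n : ℝ≥0) : ℝ) ^ 3) = C * s * √((s : ℝ) / n) := by
        have h2 : √((s : ℝ) / n) ^ 2 = s / n := Real.sq_sqrt (by positivity)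
        push_cast
        rw [pow_succ, h2]; field_simp
      rw [e1, e2, ← hB] at h1
      refine le_trans ?_ h1
      rw [hp]
      refine measureReal_mono fun ω hω j hj => hω _ ?_
      rw [← NNReal.coe_le_coe]
      push_cast
      have : (j : ℝ) + 1 ≤ n := by exact_mod_cast hj
      rw [mul_div_assoc', div_le_iff₀ hn0', mul_comm]
      gcongr
    have hlim : Filter.Tendsto (fun n : ℕ => 1 - B + C * s * √((s : ℝ) / n)) Filter.atTop
        (nhds (1 - B)) := by
      have h1 : Filter.Tendsto (fun n : ℕ => (s : ℝ) / n) Filter.atTop (nhds 0) :=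
        tendsto_const_div_atTop_nhds_zero_nat _
      have h2 := ((Real.continuous_sqrt.tendsto 0).comp h1).const_mul (C * (s : ℝ))
      have h3 := h2.const_add (1 - B)
      simpa using h3
    have hpB : p ≤ 1 - B := by
      obtain ⟨N, hN⟩ := exists_nat_ge (s : ℝ)
      refine ge_of_tendsto hlim (Filter.eventually_atTop.2 ⟨N + 1, fun n hn' => hn n (by omega) ?_⟩)
      refine hN.trans ?_
      exact_mod_cast (by omega : N ≤ n)
    rw [← hp]
    have hw : 0 ≤ ‖x‖ - g := by linarith
    have hη : 0 < (R - g) ^ 2 / 8 + (s : ℝ) := by positivity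
    have h5 := barrier_ge (((d : ℝ) - 1) / (2 * R)) (barrierRate ((R - g) ^ 2 / 8 + s)) (‖x‖ - g)
      (div_nonneg (by linarith) (by positivity)) (barrierRate_pos hη).le hw
    rw [← hB] at h5
    have h6 : barrierRate ((R - g) ^ 2 / 8 + s) ≤ barrierRate s :=
      barrierRate_anti hs0 (by have : 0 ≤ (R - g) ^ 2 / 8 := by positivity
                               linarith)
    have h7 : 3 / √(8 * (s : ℝ)) = 3 * barrierRate s := by rw [barrierRate, div_eq_mul_inv]
    have h8 : 2 * (((d : ℝ) - 1) / (2 * R)) = ((d : ℝ) - 1) / R := by field_simp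
    rw [h7, ← h8]
    nlinarith [mul_le_mul_of_nonneg_right h6 hw]
  -- The constant `C` depended on `g`, but it is gone after the limit in `n`; now `g` may tend to
  -- `R`.
  have hlim : Filter.Tendsto (fun g => (((d : ℝ) - 1) / R + 3 / √(8 * (s : ℝ))) * (‖x‖ - g))
      (nhdsWithin R (Iio R)) (nhds ((((d : ℝ) - 1) / R + 3 / √(8 * (s : ℝ))) * (‖x‖ - R))) :=
    (Continuous.tendsto (by fun_prop) R).mono_left nhdsWithin_le_nhds
  refine ge_of_tendsto hlim ?_
  filter_upwards [Ioo_mem_nhdsLT hR] with g hg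
  exact hgle g hg.1.le hg.2

theorem measureReal_avoid_ball_le (hQ : IsBrownianLaw 0 Q) {R : ℝ} (hd : 1 ≤ d) (hR : 0 < R)
    {s : ℝ≥0} (hs : 0 < s) {x z : Eucl d} (hx : R ≤ dist x z) :
    Q.real {ω | ∀ t ≤ s, R ≤ dist (x + ω t) z} ≤
      (((d : ℝ) - 1) / R + 3 / √(8 * (s : ℝ))) * (dist x z - R) := by
  rw [dist_eq_norm] at hx ⊢
  have := measureReal_avoid_centered_le hQ hd hR hs hx
  have e : ∀ (ω : PathSpace d) t, dist (x + ω t) z = ‖x - z + ω t‖ := fun ω t => by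
    rw [dist_eq_norm]; congr 1; abel
  simpa only [e] using this

end PathEstimate

/-! ### Exterior balls, and a Riemann–Stieltjes sum. -/

namespace PathEstimate

variable {d : ℕ} {Q : Measure (PathSpace d)} {O : Set (Eucl d)}

theorem mem_closure_of_signedDist_nonneg (h0 : O.Nonempty) {x : Eucl d}
    (hx : 0 ≤ signedDist O x) : x ∈ closure O := by
  by_contra h
  have h1 : 0 < Metric.infDist x O := (Metric.infDist_pos_iff_notMem_closure h0).1 h
  have h2 : Metric.infDist x Oᶜ = 0 :=
    Metric.infDist_zero_of_mem fun hO => h (subset_closure hO)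
  rw [signedDist, h2] at hx
  linarith

theorem exists_frontier_dist_eq (hO : IsOpen O) (hO_ne : O ≠ univ) {x : Eucl d}
    (hx : x ∈ closure O) : ∃ y ∈ frontier O, dist x y = signedDist O x := by
  have hne : Oᶜ.Nonempty := nonempty_compl.2 hO_ne
  obtain ⟨y, hy, hxy⟩ := hO.isClosed_compl.exists_infDist_eq_dist hne x
  have hq : signedDist O x = dist x y := by
    rw [signedDist, hxy, Metric.infDist_zero_of_mem_closure hx, sub_zero]
  refine ⟨y, ?_, hq.symm⟩
  rw [hO.frontier_eq]
  refine ⟨?_, hy⟩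
  rcases eq_or_ne x y with rfl | hne'
  · exact hx
  have hsub : Metric.ball x (dist x y) ⊆ O := by
    intro w hw
    by_contra hwO
    have := Metric.infDist_le_dist_of_mem (x := x) (show w ∈ Oᶜ from hwO)
    rw [hxy, dist_comm x w] at this
    exact absurd (Metric.mem_ball.1 hw) (not_lt.2 this)
  refine closure_mono hsub ?_
  rw [closure_ball x (dist_ne_zero.2 hne'), Metric.mem_closedBall, dist_comm]

/-- A point of the closure of `O` inside the open ball would yield a point of `O` there, which could
only be `y`; but `y` lies on the boundary of the open set `O`. -/
theorem exists_exterior_ball (hO : IsOpen O) {y : Eucl d} (hy : y ∈ frontier O) {γ' : ℝ}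
    (hγ : ENNReal.ofReal γ' < extBallRadius O y) :
    ∃ R z, γ' < R ∧ dist y z ≤ R ∧ ∀ w ∈ closure O, R ≤ dist w z := by
  obtain ⟨_, ⟨R, rfl, z, -, hz⟩, hR⟩ := lt_sSup_iff.1 hγ
  have hyz : y ∈ closure O ∩ Metric.closedBall z R := by rw [hz]; exact mem_singleton y
  refine ⟨R, z, ?_, hyz.2, fun w hw => ?_⟩
  · rw [← ENNReal.ofReal_coe_nnreal] at hR
    exact lt_of_not_ge fun h => absurd hR (not_lt.2 (ENNReal.ofReal_le_ofReal h))
  · by_contra hlt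
    obtain ⟨o, hoB, hoO⟩ := mem_closure_iff.1 hw _ Metric.isOpen_ball
      (Metric.mem_ball.2 (not_le.1 hlt))
    have : o ∈ closure O ∩ Metric.closedBall z R :=
      ⟨subset_closure hoO, Metric.ball_subset_closedBall hoB⟩
    rw [hz, mem_singleton_iff] at this
    rw [hO.frontier_eq] at hy
    exact hy.2 (this ▸ hoO)

theorem dim_pos (hO_ne : O ≠ univ) (h0 : O.Nonempty) : 1 ≤ d := by
  rcases Nat.eq_zero_or_pos d with rfl | h
  · obtain ⟨x, hx⟩ := h0
    exact absurd (eq_univ_of_forall fun y => Subsingleton.elim x y ▸ hx) hO_ne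
  · exact h

/-- A Brownian path started at `x ∈ closure O` stays in `closure O` with probability at most
proportional to the distance to the boundary, provided that the boundary point next to `x` admits
a large exterior ball. -/
theorem measureReal_mem_closure_le (hQ : IsBrownianLaw 0 Q) (hO : IsOpen O) (hO_ne : O ≠ univ)
    (h0 : O.Nonempty) {γ : ℝ} (hγ : 0 < γ) {s : ℝ≥0} (hs : 0 < s) {x : Eucl d}
    (hx : 0 ≤ signedDist O x) (hsig : ∀ y ∈ sigmaSet O γ, signedDist O x < dist x y) :
    Q.real {ω | ∀ t ≤ s, x + ω t ∈ closure O} ≤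
      (((d : ℝ) - 1) / γ + 3 / √(8 * (s : ℝ))) * signedDist O x := by
  have := hQ.isProbabilityMeasure
  have hd := dim_pos hO_ne h0
  have hd1 : (1 : ℝ) ≤ d := by exact_mod_cast hd
  have hxO := mem_closure_of_signedDist_nonneg h0 hx
  obtain ⟨y, hy, hxy⟩ := exists_frontier_dist_eq hO hO_ne hxO
  have hyr : ENNReal.ofReal γ ≤ extBallRadius O y := by
    by_contra hlt
    exact absurd (hsig y (subset_closure ⟨hy, not_le.1 hlt⟩)) (by rw [hxy]; exact lt_irrefl _)
  -- The supremum defining `δ(y)` need not be attained, so the ball is taken with radius above any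
  -- `γ' < γ`, and `γ'` tends to `γ` at the end.
  have key : ∀ γ', 0 < γ' → γ' < γ → Q.real {ω | ∀ t ≤ s, x + ω t ∈ closure O} ≤
      (((d : ℝ) - 1) / γ' + 3 / √(8 * (s : ℝ))) * signedDist O x := by
    intro γ' hγ' hγγ
    obtain ⟨R, z, hR, hyz, hw⟩ := exists_exterior_ball hO hy
      (((ENNReal.ofReal_lt_ofReal_iff hγ).2 hγγ).trans_le hyr)
    have hR0 : 0 < R := hγ'.trans hR
    have h1 := measureReal_avoid_ball_le hQ hd hR0 hs (hw x hxO)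
    have h2 : dist x z - R ≤ signedDist O x := by
      have := dist_triangle x y z
      rw [hxy] at this; linarith
    have h3 : 0 ≤ dist x z - R := sub_nonneg.2 (hw x hxO)
    calc Q.real {ω | ∀ t ≤ s, x + ω t ∈ closure O}
        ≤ Q.real {ω | ∀ t ≤ s, R ≤ dist (x + ω t) z} :=
          measureReal_mono fun ω hω t ht => hw _ (hω t ht)
      _ ≤ (((d : ℝ) - 1) / R + 3 / √(8 * (s : ℝ))) * (dist x z - R) := h1
      _ ≤ _ := by
        have hd0 : 0 ≤ (d : ℝ) - 1 := by linarith
        gcongr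
  have hlim : Filter.Tendsto
      (fun γ' => (((d : ℝ) - 1) / γ' + 3 / √(8 * (s : ℝ))) * signedDist O x)
      (nhdsWithin γ (Iio γ)) (nhds ((((d : ℝ) - 1) / γ + 3 / √(8 * (s : ℝ))) * signedDist O x)) := by
    refine Filter.Tendsto.mono_left ?_ nhdsWithin_le_nhds
    refine Filter.Tendsto.mul_const _ (Filter.Tendsto.add_const _ ?_)
    exact tendsto_const_nhds.div Filter.tendsto_id hγ.ne'
  refine ge_of_tendsto hlim ?_
  filter_upwards [Ioo_mem_nhdsLT hγ] with γ' h
  exact key γ' h.1 h.2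

theorem sum_inv_sqrt_le (N : ℕ) : ∑ j ∈ Finset.range N, 1 / √((j : ℝ) + 1) ≤ 2 * √N := by
  induction N with
  | zero => simp
  | succ N ih =>
    rw [Finset.sum_range_succ]
    have h1 : 0 < √((N : ℝ) + 1) := by positivity
    have h2 : √(N : ℝ) ≤ √((N : ℝ) + 1) := Real.sqrt_le_sqrt (by linarith)
    have h3 : √(N : ℝ) ^ 2 = N := Real.sq_sqrt (Nat.cast_nonneg N)
    have h4 : √((N : ℝ) + 1) ^ 2 = N + 1 := Real.sq_sqrt (by positivity)
    have h5 : 1 / √((N : ℝ) + 1) ≤ 2 * (√((N : ℝ) + 1) - √N) := by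
      rw [div_le_iff₀ h1]
      nlinarith [Real.sqrt_nonneg (N : ℝ)]
    push_cast
    linarith

/-- A Riemann-Stieltjes sum for a distribution function whose density is at most `C / t`. -/
theorem riemann_stieltjes_sum_le {F : ℝ → ℝ} {C a c u : ℝ} (hF0 : ∀ t, 0 ≤ F t) (hF1 : ∀ t, F t ≤ 1)
    (hmono : Monotone F)
    (hF : ∀ t, 0 < t → DifferentiableAt ℝ F t ∧ deriv F t ≤ C * t⁻¹) (hC : 0 ≤ C) (ha : 0 ≤ a)
    (hc : 0 ≤ c) (hu : 0 < u) (N : ℕ) :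
    ∑ i ∈ Finset.range (2 * N + 1),
        (F ((i + 1 : ℕ) * (u / (2 * (N + 1)))) - F (i * (u / (2 * (N + 1))))) *
          (a + c / √(u - (i + 1 : ℕ) * (u / (2 * (N + 1))))) ≤
      a + c * √2 / √u + 2 * √2 * c * C / √u ∧
    F u - F ((2 * N + 1 : ℕ) * (u / (2 * (N + 1)))) ≤ C / (N + 1) := by
  obtain ⟨h, hh⟩ : ∃ h, h = u / (2 * ((N : ℝ) + 1)) := ⟨_, rfl⟩
  rw [← hh]
  have hN : (0 : ℝ) < N + 1 := by positivity
  have hh0 : 0 < h := by rw [hh]; positivity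
  have huh : u = 2 * (N + 1) * h := by rw [hh]; field_simp
  -- The rate bound is used only on the second half of `[0, u]`, where `C / t ≤ 2 C / u`.
  have hinc : ∀ s : ℝ, u / 2 ≤ s → F (s + h) - F s ≤ 2 * C / u * h := by
    intro s hs
    have hs0 : 0 < s := by linarith
    have h1 := Convex.image_sub_le_mul_sub_of_deriv_le (convex_Icc s (s + h)) (f := F)
      (C := 2 * C / u)
      (fun t ht => (hF t (by linarith [ht.1])).1.continuousAt.continuousWithinAt)
      (fun t ht => by
        rw [interior_Icc] at ht
        exact (hF t (by linarith [ht.1])).1.differentiableWithinAt)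
      (fun t ht => by
        rw [interior_Icc] at ht
        have ht0 : u / 2 ≤ t := by linarith [ht.1]
        refine (hF t (by linarith)).2.trans ?_
        rw [← div_eq_mul_inv, div_le_div_iff₀ (by linarith) hu]
        nlinarith)
      s (left_mem_Icc.2 (by linarith)) (s + h) (right_mem_Icc.2 (by linarith)) (by linarith)
    simpa using h1
  have hterm : ∀ i : ℕ, 0 ≤ F ((i + 1 : ℕ) * h) - F (i * h) := fun i =>
    sub_nonneg.2 (hmono (by push_cast; nlinarith))
  have htel : ∀ n : ℕ, ∑ i ∈ Finset.range n, (F ((i + 1 : ℕ) * h) - F (i * h)) ≤ 1 := by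
    intro n
    rw [Finset.sum_range_sub (fun i : ℕ => F (i * h))]
    linarith [hF1 (n * h), hF0 ((0 : ℕ) * h)]
  constructor
  · simp_rw [mul_add]
    rw [Finset.sum_add_distrib, ← Finset.sum_mul, add_assoc]
    refine add_le_add (mul_le_of_le_one_left ha (htel _)) ?_
    -- There are `2N + 2` mesh intervals, the last one being left out since the weight is infinite
    -- at `u`. On the first half the weight is at most `c √2 / √u` and the total mass at most one.
    rw [show 2 * N + 1 = (N + 1) + N by ring, Finset.sum_range_add]
    refine add_le_add ?_ ?_
    · have h1 : ∀ i ∈ Finset.range (N + 1), (F ((i + 1 : ℕ) * h) - F (i * h)) *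
          (c / √(u - (i + 1 : ℕ) * h)) ≤ (F ((i + 1 : ℕ) * h) - F (i * h)) * (c * √2 / √u) := by
        intro i hi
        refine mul_le_mul_of_nonneg_left ?_ (hterm i)
        have hi' : ((i + 1 : ℕ) : ℝ) ≤ N + 1 := by
          exact_mod_cast Finset.mem_range.1 hi
        have h2 : u / 2 ≤ u - (i + 1 : ℕ) * h := by
          have := mul_le_mul_of_nonneg_right hi' hh0.le
          linarith
        have e : c * √2 / √u = c / √(u / 2) := by
          rw [Real.sqrt_div hu.le]; field_simp
        rw [e]
        have : 0 < √(u / 2) := by positivity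
        gcongr
      refine (Finset.sum_le_sum h1).trans ?_
      rw [← Finset.sum_mul]
      exact mul_le_of_le_one_left (by positivity) (htel _)
    -- On the second half the increments are at most `2 C h / u`, and the weights, in reversed
    -- order, sum like `1 / √j`.
    · have h1 : ∀ j ∈ Finset.range N, (F ((N + 1 + j + 1 : ℕ) * h) - F ((N + 1 + j : ℕ) * h)) *
          (c / √(u - (N + 1 + j + 1 : ℕ) * h)) ≤
          2 * C / u * h * (c / √h) * (1 / √(((N - 1 - j : ℕ) : ℝ) + 1)) := by
        intro j hj
        have hj' := Finset.mem_range.1 hj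
        have e1 : ((N - 1 - j : ℕ) : ℝ) + 1 = N - j := by
          have : N - 1 - j + 1 = N - j := by omega
          rw [← Nat.cast_sub hj'.le, ← this]; push_cast; ring
        have hNj : (0 : ℝ) < N - j := by
          have : (j : ℝ) < N := by exact_mod_cast hj'
          linarith
        have e2 : u - (N + 1 + j + 1 : ℕ) * h = h * (N - j) := by
          rw [huh]; push_cast; ring
        rw [e1, e2, Real.sqrt_mul hh0.le]
        have h3 := hinc ((N + 1 + j : ℕ) * h) (by
          rw [huh]; push_cast
          have : 0 ≤ (j : ℝ) * h := by positivity
          linarith)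
        have e3 : ((N + 1 + j : ℕ) : ℝ) * h + h = (N + 1 + j + 1 : ℕ) * h := by push_cast; ring
        rw [e3] at h3
        have h4 := mul_le_mul_of_nonneg_right h3
          (by positivity : 0 ≤ c / (√h * √((N : ℝ) - j)))
        refine h4.trans (le_of_eq ?_)
        have : 0 < √((N : ℝ) - j) := Real.sqrt_pos.2 hNj
        have : 0 < √h := Real.sqrt_pos.2 hh0
        field_simp
      refine (Finset.sum_le_sum h1).trans ?_
      rw [← Finset.mul_sum, Finset.sum_range_reflect (fun j : ℕ => 1 / √((j : ℝ) + 1))]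
      refine (mul_le_mul_of_nonneg_left (sum_inv_sqrt_le N) (by positivity)).trans ?_
      have hsh : 0 < √h := Real.sqrt_pos.2 hh0
      have hsu : 0 < √u := Real.sqrt_pos.2 hu
      have e1 : √h ^ 2 = h := Real.sq_sqrt hh0.le
      have e2 : √u ^ 2 = u := Real.sq_sqrt hu.le
      have e3 : √(N : ℝ) * √h ≤ √u / √2 := by
        rw [← Real.sqrt_mul (Nat.cast_nonneg N), ← Real.sqrt_div hu.le]
        refine Real.sqrt_le_sqrt ?_
        rw [huh]; nlinarith
      have e4 : 2 * C / u * h * (c / √h) * (2 * √(N : ℝ)) =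
          4 * C * c / u * (√(N : ℝ) * √h) := by
        nth_rewrite 1 [← e1]; field_simp; ring
      rw [e4]
      refine (mul_le_mul_of_nonneg_left e3 (by positivity)).trans (le_of_eq ?_)
      have e5 : √2 ^ 2 = (2 : ℝ) := Real.sq_sqrt (by norm_num)
      nth_rewrite 1 [← e2]
      field_simp
      linear_combination (-2 * C * c) * e5
  · have h3 := hinc ((2 * N + 1 : ℕ) * h) (by rw [huh]; push_cast; nlinarith)
    have e3 : ((2 * N + 1 : ℕ) : ℝ) * h + h = u := by rw [huh]; push_cast; ring
    rw [e3] at h3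
    refine h3.trans (le_of_eq ?_)
    rw [hh]; field_simp

end PathEstimate

/-! ### Paths leaving `O_r` in a short time interval, and oscillation. -/

namespace PathEstimate

variable {d : ℕ} {x : Eucl d} {P Q : Measure (PathSpace d)} {O : Set (Eucl d)}

theorem signedDist_nonneg_of_mem_closure (hx : x ∈ closure O) : 0 ≤ signedDist O x := by
  rw [signedDist, Metric.infDist_zero_of_mem_closure hx, sub_zero]
  exact Metric.infDist_nonneg

theorem IsBrownianLaw.ae_eval_zero (hP : IsBrownianLaw x P) (hQ : IsBrownianLaw 0 Q) :
    ∀ᵐ ω ∂P, ω 0 = x := by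
  have h0 : ∀ᵐ ω ∂Q, ω 0 = 0 := by
    have hm : MeasurableSet {y : Eucl d | y ≠ 0} := (measurableSet_singleton 0).compl
    have h := Measure.map_apply (μ := Q) (measurable_path_eval 0) hm
    rw [hQ.map_eval 0, Measure.map_apply (by fun_prop) hm] at h
    simpa [ae_iff] using h.symm
  have hm : MeasurableSet {ω : PathSpace d | ω 0 = x} :=
    measurable_path_eval 0 (measurableSet_singleton x)
  rw [hP.eq_map_translate hQ, ae_map_iff (measurable_translate x).aemeasurable hm]
  filter_upwards [h0] with ω hω
  simp [hω]

theorem exitCDF_eq_compl_stay (P : Measure (PathSpace d)) (r : ℝ) (t : ℝ≥0) :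
    exitCDF O P r t = P.real (stay {x | r < signedDist O x} t)ᶜ := by
  rw [exitCDF, Real.toNNReal_coe]
  congr 1
  ext ω; exact exitTime_le_iff O r ω _

theorem stay_anti (D : Set (Eucl d)) {s t : ℝ≥0} (hst : s ≤ t) : stay D t ⊆ stay D s :=
  fun _ h => mem_stay.2 fun v hv => mem_stay.1 h v (hv.trans hst)

theorem exitCDF_mono [IsFiniteMeasure P] (r : ℝ) : Monotone (exitCDF O P r) := by
  intro s t hst
  refine measureReal_mono fun ω hω => ?_
  exact le_trans hω (WithTop.coe_le_coe.2 (Real.toNNReal_mono hst))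

theorem measureReal_stay_diff [IsProbabilityMeasure P] (r : ℝ) {s t : ℝ≥0} (hst : s ≤ t) :
    P.real (stay {x | r < signedDist O x} s \ stay {x | r < signedDist O x} t) =
      exitCDF O P r t - exitCDF O P r s := by
  have ht := measurableSet_stay (isOpen_signedDist_gt O r) t
  have hs := measurableSet_stay (isOpen_signedDist_gt O r) s
  rw [measureReal_sdiff (stay_anti _ hst) ht, exitCDF_eq_compl_stay, exitCDF_eq_compl_stay,
    probReal_compl_eq_one_sub ht, probReal_compl_eq_one_sub hs]
  ring

theorem isClosed_forall_mem {C : Set (Eucl d)} (hC : IsClosed C) (t : ℝ≥0) :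
    IsClosed {ω : PathSpace d | ∀ s ≤ t, ω s ∈ C} := by
  have : {ω : PathSpace d | ∀ s ≤ t, ω s ∈ C} = ⋂ s : ℝ≥0, ⋂ _ : s ≤ t, (fun ω => ω s) ⁻¹' C := by
    ext; simp
  rw [this]
  exact isClosed_iInter fun s => isClosed_iInter fun _ => hC.preimage (continuous_eval_const s)

theorem isClosed_forall_le_dist (A : Set (Eucl d)) (ρ : ℝ) :
    IsClosed {y : Eucl d | ∀ a ∈ A, ρ ≤ dist y a} := by
  have : {y : Eucl d | ∀ a ∈ A, ρ ≤ dist y a} = ⋂ a ∈ A, {y | ρ ≤ dist y a} := by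
    ext; simp
  rw [this]
  exact isClosed_biInter fun a _ => isClosed_le continuous_const (by fun_prop)

/-- The contribution to the boundary estimate of the paths leaving `O_r` during `(s, t]`. -/
theorem measureReal_exit_interval_le (hP : IsBrownianLaw x P) (hQ : IsBrownianLaw 0 Q)
    (hO : IsOpen O) (hO_ne : O ≠ univ) (h0 : O.Nonempty) {γ ρ r r' : ℝ} (hγ : 0 < γ) (hρ : r' < ρ)
    (hr' : 0 ≤ r') {s t u : ℝ≥0} (hst : s ≤ t) (htu : t < u) :
    P.real {ω | ω ∈ stay {x | r < signedDist O x} s \ stay {x | r < signedDist O x} t ∧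
      signedDist O (ω t) ≤ r' ∧ (∀ y ∈ sigmaSet O γ, ρ ≤ dist (ω t) y) ∧
      ∀ v ≤ u, ω v ∈ closure O} ≤
    (exitCDF O P r t - exitCDF O P r s) *
      ((((d : ℝ) - 1) / γ + 3 / √(8 * ((u : ℝ) - t))) * r') := by
  have := hP.isProbabilityMeasure
  have := hQ.isProbabilityMeasure
  obtain ⟨A, hA⟩ : ∃ A, A = stay {x | r < signedDist O x} s \ stay {x | r < signedDist O x} t :=
    ⟨_, rfl⟩
  have hAm : MeasurableSet A := hA ▸ (measurableSet_stay (isOpen_signedDist_gt O r) s).diff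
    (measurableSet_stay (isOpen_signedDist_gt O r) t)
  obtain ⟨B, hB⟩ : ∃ B : Set (Eucl d), B = {y | signedDist O y ≤ r' ∧ y ∈ closure O ∧
    ∀ a ∈ sigmaSet O γ, ρ ≤ dist y a} := ⟨_, rfl⟩
  have hBm : MeasurableSet B := by
    rw [hB]
    exact ((isClosed_le (continuous_signedDist O) continuous_const).inter
      (isClosed_closure.inter (isClosed_forall_le_dist _ _))).measurableSet
  obtain ⟨S, hS⟩ : ∃ S : Set (PathSpace d × PathSpace d), S = {p | p.1 ∈ A ∧ p.1 t ∈ B ∧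
    translate (p.1 t) p.2 ∈ {ω : PathSpace d | ∀ v ≤ u - t, ω v ∈ closure O}} := ⟨_, rfl⟩
  have hSm : MeasurableSet S := by
    rw [hS]
    have hev : Measurable fun p : PathSpace d × PathSpace d => p.1 t :=
      (measurable_path_eval t).comp measurable_fst
    have htr : Measurable fun p : PathSpace d × PathSpace d => translate (p.1 t) p.2 :=
      measurable_translate_uncurry.comp (hev.prodMk measurable_snd)
    exact (measurable_fst hAm).inter ((hev hBm).inter
      (htr (isClosed_forall_mem isClosed_closure (u - t)).measurableSet))
  have hmemA : ∀ ω : PathSpace d, stopAt t ω ∈ A ↔ ω ∈ A := by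
    intro ω
    rw [hA, mem_sdiff, mem_sdiff, mem_stay, mem_stay, mem_stay, mem_stay]
    have e1 : (∀ v ≤ s, stopAt t ω v ∈ {x | r < signedDist O x}) ↔
        ∀ v ≤ s, ω v ∈ {x | r < signedDist O x} :=
      forall₂_congr fun v hv => by rw [stopAt_apply, min_eq_left (hv.trans hst)]
    have e2 : (∀ v ≤ t, stopAt t ω v ∈ {x | r < signedDist O x}) ↔
        ∀ v ≤ t, ω v ∈ {x | r < signedDist O x} :=
      forall₂_congr fun v hv => by rw [stopAt_apply, min_eq_left hv]
    rw [e1, e2]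
  obtain ⟨K, hK⟩ : ∃ K, K = (((d : ℝ) - 1) / γ + 3 / √(8 * ((u : ℝ) - t))) * r' := ⟨_, rfl⟩
  have hd1 : (1 : ℝ) ≤ d := by exact_mod_cast dim_pos hO_ne h0
  have hcoef : 0 ≤ ((d : ℝ) - 1) / γ + 3 / √(8 * ((u : ℝ) - t)) :=
    add_nonneg (div_nonneg (by linarith) hγ.le) (by positivity)
  have hK0 : 0 ≤ K := hK ▸ mul_nonneg hcoef hr'
  have hcoe : ((u - t : ℝ≥0) : ℝ) = (u : ℝ) - t := NNReal.coe_sub htu.le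
  -- Given the path up to `t`, the remaining motion starts at `ω t` with `q ≤ r'` and farther than
  -- `r'` from `Σ_γ`, and must stay in the closure of `O` for time `u - t`.
  have hin : ∀ ω, Q {ω' | (stopAt t ω, ω') ∈ S} ≤
      A.indicator (fun _ => ENNReal.ofReal K) ω := by
    intro ω
    simp only [hS, Set.mem_ofPred_eq, hmemA, stopAt_apply, min_self]
    by_cases hω : ω ∈ A ∧ ω t ∈ B
    · rw [indicator_of_mem hω.1]
      have hωB := hω.2
      rw [hB] at hωB
      obtain ⟨b1, b2, b3⟩ := hωB
      have hq := signedDist_nonneg_of_mem_closure b2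
      have h1 := measureReal_mem_closure_le hQ hO hO_ne h0 hγ (tsub_pos_of_lt htu) hq
        fun y hy => (b1.trans_lt hρ).trans_le (b3 y hy)
      rw [hcoe] at h1
      have h2 : Q.real {ω' | ∀ v ≤ u - t, ω t + ω' v ∈ closure O} ≤ K := by
        refine h1.trans ?_
        rw [hK]; gcongr
      refine le_trans (measure_mono fun ω' hω' => ?_)
        ((ofReal_measureReal (μ := Q)).symm.le.trans (ENNReal.ofReal_le_ofReal h2))
      exact hω'.2.2
    · have : {ω' : PathSpace d | ω ∈ A ∧ ω t ∈ B ∧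
          ∀ v ≤ u - t, translate (ω t) ω' v ∈ closure O} = ∅ := by
        ext ω'; simp only [Set.mem_ofPred_eq, mem_empty_iff_false, iff_false]
        exact fun h => hω ⟨h.1, h.2.1⟩
      rw [this]; simp
  have hm := hP.measure_markov hQ t hSm
  have h1 : P {ω | (stopAt t ω, incrAt t ω) ∈ S} ≤ ENNReal.ofReal K * P A := by
    rw [hm]
    refine (lintegral_mono hin).trans ?_
    rw [lintegral_indicator_const hAm]
  have h2 : {ω | ω ∈ A ∧ signedDist O (ω t) ≤ r' ∧ (∀ y ∈ sigmaSet O γ, ρ ≤ dist (ω t) y) ∧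
      ∀ v ≤ u, ω v ∈ closure O} ⊆ {ω | (stopAt t ω, incrAt t ω) ∈ S} := by
    rintro ω ⟨a1, a2, a3, a4⟩
    simp only [hS, Set.mem_ofPred_eq, hmemA, stopAt_apply, min_self, hB]
    refine ⟨a1, ⟨a2, a4 t htu.le, a3⟩, fun v hv => ?_⟩
    have : ω t + (ω (t + v) - ω t) = ω (t + v) := by abel
    rw [translate_apply, incrAt_apply, this]
    exact a4 _ ((add_le_add_right hv t).trans (add_tsub_cancel_of_le htu.le).le)
  rw [← measureReal_stay_diff r hst, ← hA, ← hK]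
  have h3 := (measure_mono h2).trans h1
  rw [← ofReal_measureReal (μ := P) (s := A), ← ENNReal.ofReal_mul hK0] at h3
  rw [mul_comm]
  exact ENNReal.toReal_le_of_le_ofReal (mul_nonneg hK0 measureReal_nonneg) h3

/-- The paths for which `q` oscillates by more than `ε` within time `h` on `[0, u]`. -/
def oscillation (O : Set (Eucl d)) (ε : ℝ) (u h : ℝ≥0) : Set (PathSpace d) :=
  {ω | ∃ s ≤ u, ∃ t ≤ u, dist s t ≤ h ∧ ε < |signedDist O (ω s) - signedDist O (ω t)|}

theorem isOpen_oscillation (O : Set (Eucl d)) (ε : ℝ) (u h : ℝ≥0) :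
    IsOpen (oscillation O ε u h) := by
  have : oscillation O ε u h = ⋃ s : ℝ≥0, ⋃ _ : s ≤ u, ⋃ t : ℝ≥0, ⋃ _ : t ≤ u,
      ⋃ _ : dist s t ≤ h, {ω | ε < |signedDist O (ω s) - signedDist O (ω t)|} := by
    ext; simp only [oscillation, Set.mem_ofPred_eq, mem_iUnion, exists_prop]
  rw [this]
  have := continuous_signedDist O
  refine isOpen_iUnion fun s => isOpen_iUnion fun _ => isOpen_iUnion fun t => isOpen_iUnion fun _ =>
    isOpen_iUnion fun _ => isOpen_lt continuous_const ?_
  exact ((this.comp (continuous_eval_const s)).sub (this.comp (continuous_eval_const t))).abs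

/-- By uniform continuity of `q` along a path on `[0, u]` these decreasing events have empty
intersection. -/
theorem tendsto_measureReal_oscillation [IsProbabilityMeasure P] {ε : ℝ} (hε : 0 < ε) (u : ℝ≥0)
    {h : ℕ → ℝ≥0} (hanti : Antitone h) (hlim : Filter.Tendsto h Filter.atTop (nhds 0)) :
    Filter.Tendsto (fun n => P.real (oscillation O ε u (h n))) Filter.atTop (nhds 0) := by
  have hempty : ⋂ n, oscillation O ε u (h n) = ∅ := by
    rw [eq_empty_iff_forall_notMem]
    intro ω hω
    have hc : ContinuousOn (fun t => signedDist O (ω t)) (Icc 0 u) :=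
      ((continuous_signedDist O).comp ω.continuous).continuousOn
    obtain ⟨δ, hδ, H⟩ := Metric.uniformContinuousOn_iff.1
      (isCompact_Icc.uniformContinuousOn_of_continuous hc) ε hε
    have hlim' : Filter.Tendsto (fun n => (h n : ℝ)) Filter.atTop (nhds 0) := by
      simpa using NNReal.tendsto_coe.2 hlim
    obtain ⟨n, hn⟩ := (hlim'.eventually (gt_mem_nhds hδ)).exists
    obtain ⟨s, hs, t, ht, hst, hlt⟩ := mem_iInter.1 hω n
    have := H s ⟨zero_le, hs⟩ t ⟨zero_le, ht⟩ (hst.trans_lt hn)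
    rw [Real.dist_eq] at this
    linarith
  have h1 := tendsto_measure_iInter_atTop (μ := P)
    (fun n => (isOpen_oscillation O ε u (h n)).measurableSet.nullMeasurableSet)
    (fun m n hmn ω ⟨s, hs, t, ht, hst, hlt⟩ =>
      ⟨s, hs, t, ht, hst.trans (NNReal.coe_le_coe.2 (hanti hmn)), hlt⟩)
    ⟨0, measure_ne_top _ _⟩
  rw [hempty, measure_empty] at h1
  exact (ENNReal.tendsto_toReal ENNReal.zero_ne_top).comp h1

end PathEstimate

/-! ### Decomposition by the exit time and the boundary estimate. -/

namespace PathEstimate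

variable {d : ℕ} {x : Eucl d} {P Q : Measure (PathSpace d)} {O : Set (Eucl d)}

/-- The paths that stay in `closure O` and at distance at least `ρ` from `Σ_γ` up to time `u`,
and come within distance `r` of the boundary. -/
def nearBoundaryAway (O : Set (Eucl d)) (γ ρ r : ℝ) (u : ℝ≥0) : Set (PathSpace d) :=
  {ω | (∀ v ≤ u, ω v ∈ closure O) ∧ (∃ v ≤ u, signedDist O (ω v) ≤ r) ∧
    ∀ v ≤ u, ∀ y ∈ sigmaSet O γ, ρ ≤ dist (ω v) y}

theorem exists_grid_exit {D : Set (Eucl d)} {ω : PathSpace d} {h : ℝ≥0} {n : ℕ}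
    (h0 : ω 0 ∈ D) (hn : ω ∉ stay D (n * h)) :
    ∃ i < n, ω ∈ stay D (i * h) \ stay D ((i + 1 : ℕ) * h) := by
  classical
  have hex : ∃ n : ℕ, ω ∉ stay D (n * h) := ⟨n, hn⟩
  have h1 : Nat.find hex ≠ 0 := by
    intro h
    have := Nat.find_spec hex
    rw [h] at this
    refine this (mem_stay.2 fun s hs => ?_)
    simp only [Nat.cast_zero, zero_mul, nonpos_iff_eq_zero] at hs
    rwa [hs]
  obtain ⟨i, hi⟩ := Nat.exists_eq_succ_of_ne_zero h1
  have h2 : Nat.find hex ≤ n := Nat.find_min' hex hn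
  refine ⟨i, by omega, not_not.1 (Nat.find_min hex (by omega)), ?_⟩
  have := Nat.find_spec hex
  rwa [hi] at this

/-- The path is sorted by the mesh interval in which it leaves `O_r`. Unless `q` oscillates by more
than `ε`, at the right endpoint of that interval `q ≤ r + ε`, so the Markov property at this
deterministic time replaces the strong one at `τ_r`. For the last interval no time remains, and only
its probability is kept. -/
theorem measureReal_nearBoundaryAway_le_sum (hP : IsBrownianLaw x P) (hQ : IsBrownianLaw 0 Q)
    (hO : IsOpen O) (hO_ne : O ≠ univ) (h0 : O.Nonempty) {γ ρ r ε : ℝ} (hγ : 0 < γ)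
    (hρ : r + ε < ρ) (hr : 0 ≤ r) (hε : 0 ≤ ε) (hx : r < signedDist O x) {u h : ℝ≥0} (hh : 0 < h)
    {N : ℕ} (hu : u = (N + 1 : ℕ) * h) :
    P.real (nearBoundaryAway O γ ρ r u) ≤ P.real (oscillation O ε u h) +
      ∑ i ∈ Finset.range N, (exitCDF O P r ((i + 1 : ℕ) * (h : ℝ)) - exitCDF O P r (i * (h : ℝ))) *
        ((((d : ℝ) - 1) / γ + 3 / √(8 * ((u : ℝ) - (i + 1 : ℕ) * (h : ℝ)))) * (r + ε)) +
      (exitCDF O P r u - exitCDF O P r (N * (h : ℝ))) := by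
  have := hP.isProbabilityMeasure
  obtain ⟨D, hD⟩ : ∃ D, D = {x | r < signedDist O x} := ⟨_, rfl⟩
  obtain ⟨G, hG⟩ : ∃ G : ℕ → Set (PathSpace d), G = fun i : ℕ =>
    {ω | ω ∈ stay D (i * h) \ stay D ((i + 1 : ℕ) * h) ∧
      signedDist O (ω ((i + 1 : ℕ) * h)) ≤ r + ε ∧
      (∀ y ∈ sigmaSet O γ, ρ ≤ dist (ω ((i + 1 : ℕ) * h)) y) ∧
      ∀ v ≤ u, ω v ∈ closure O} := ⟨_, rfl⟩
  have hle : ∀ i : ℕ, i < N + 1 → ((i + 1 : ℕ) : ℝ≥0) * h ≤ u := fun i hi => by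
    rw [hu]
    have : ((i + 1 : ℕ) : ℝ≥0) ≤ (N + 1 : ℕ) := Nat.cast_le.2 hi
    gcongr
  have hsub : nearBoundaryAway O γ ρ r u ⊆ ({ω | ω 0 ≠ x} ∪ oscillation O ε u h ∪
      ⋃ i ∈ Finset.range N, G i) ∪ (stay D (N * h) \ stay D u) := by
    rintro ω ⟨a1, ⟨s, hs, hsr⟩, a3⟩
    by_cases hω0 : ω 0 = x
    swap
    · exact Or.inl (Or.inl (Or.inl hω0))
    by_cases hosc : ω ∈ oscillation O ε u h
    · exact Or.inl (Or.inl (Or.inr hosc))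
    have hnot : ω ∉ stay D ((N + 1 : ℕ) * h) := fun hst => by
      rw [← hu] at hst
      have := mem_stay.1 hst s hs
      rw [hD] at this
      exact absurd hsr (not_le.2 this)
    obtain ⟨i, hi, hiD⟩ := exists_grid_exit (by rw [hω0, hD]; exact hx) hnot
    rcases Nat.lt_succ_iff_lt_or_eq.1 hi with hiN | rfl
    · refine Or.inl (Or.inr (mem_biUnion (Finset.mem_coe.2 (Finset.mem_range.2 hiN)) ?_))
      rw [hG]
      refine ⟨hiD, ?_, a3 _ (hle i hi), a1⟩
      obtain ⟨d1, d2⟩ := hiD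
      rw [mem_stay] at d1 d2
      push Not at d2
      obtain ⟨v, hv, hvD⟩ := d2
      have hvi : (i : ℝ≥0) * h < v := lt_of_not_ge fun hc => hvD (d1 v hc)
      rw [hD] at hvD
      have hvr : signedDist O (ω v) ≤ r := not_lt.1 hvD
      by_contra hlt
      refine hosc ⟨v, hv.trans (hle i hi), _, hle i hi, ?_, ?_⟩
      · have h1 : (i : ℝ) * h < v := by exact_mod_cast hvi
        have h2 : (v : ℝ) ≤ ((i : ℝ) + 1) * h := by exact_mod_cast hv
        rw [NNReal.dist_eq, abs_le]
        push_cast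
        constructor <;> linarith
      · rw [abs_sub_comm]
        exact lt_of_lt_of_le (by linarith) (le_abs_self _)
    · right
      rw [hu]; exact hiD
  have hnull : P.real {ω | ω 0 ≠ x} = 0 := by
    rw [measureReal_def, show P {ω | ω 0 ≠ x} = 0 from hP.ae_eval_zero hQ, ENNReal.toReal_zero]
  refine (measureReal_mono hsub).trans ((measureReal_union_le _ _).trans (add_le_add
    ((measureReal_union_le _ _).trans (add_le_add ((measureReal_union_le _ _).trans
      (by rw [hnull, zero_add])) ((measureReal_biUnion_finset_le _ _).trans
        (Finset.sum_le_sum fun i hi => ?_)))) ?_))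
  · have hi' := Finset.mem_range.1 hi
    have htu : ((i + 1 : ℕ) : ℝ≥0) * h < u := by
      rw [hu]
      have : ((i + 1 : ℕ) : ℝ≥0) < (N + 1 : ℕ) := Nat.cast_lt.2 (by omega)
      gcongr
    have hst : (i : ℝ≥0) * h ≤ (i + 1 : ℕ) * h := by
      have : (i : ℝ≥0) ≤ (i + 1 : ℕ) := Nat.cast_le.2 (by omega)
      gcongr
    have := measureReal_exit_interval_le (r := r) hP hQ hO hO_ne h0 hγ hρ (by linarith) hst htu
    rw [hG, hD]
    simpa using this
  · have hst : (N : ℝ≥0) * h ≤ u := by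
      rw [hu]
      have : (N : ℝ≥0) ≤ (N + 1 : ℕ) := Nat.cast_le.2 (by omega)
      gcongr
    have := measureReal_stay_diff (O := O) (P := P) r hst
    rw [hD, this]
    simp

theorem measureReal_nearBoundaryAway_le (hP : IsBrownianLaw x P) (hQ : IsBrownianLaw 0 Q)
    (hO : IsOpen O) (hO_ne : O ≠ univ) (h0 : O.Nonempty) {γ ρ r C : ℝ} (hγ : 0 < γ)
    (hρ : r < ρ) (hr : 0 ≤ r) (hx : r < signedDist O x) (hC : 0 ≤ C)
    (hF : ∀ t, 0 < t → DifferentiableAt ℝ (exitCDF O P r) t ∧ deriv (exitCDF O P r) t ≤ C * t⁻¹)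
    {u : ℝ≥0} (hu : 0 < u) :
    P.real (nearBoundaryAway O γ ρ r u) ≤
      (((d : ℝ) - 1) / γ + (3 * C + 3 / 2) / √(u : ℝ)) * r := by
  have := hP.isProbabilityMeasure
  have hd1 : (1 : ℝ) ≤ d := by exact_mod_cast dim_pos hO_ne h0
  have hu0 : (0 : ℝ) < u := hu
  obtain ⟨p, hp⟩ : ∃ p, p = P.real (nearBoundaryAway O γ ρ r u) := ⟨_, rfl⟩
  obtain ⟨K, hK⟩ : ∃ K, K = ((d : ℝ) - 1) / γ + (3 * C + 3 / 2) / √(u : ℝ) := ⟨_, rfl⟩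
  -- The mesh tends to zero for fixed `ε`; only afterwards does `ε`.
  have hε : ∀ ε, 0 < ε → ε < ρ - r → p ≤ K * (r + ε) := by
    intro ε hε hερ
    obtain ⟨h, hh⟩ : ∃ h : ℕ → ℝ≥0, h = fun N : ℕ => u / (2 * ((N : ℝ≥0) + 1)) := ⟨_, rfl⟩
    have hcoe : ∀ N, (h N : ℝ) = u / (2 * ((N : ℝ) + 1)) := fun N => by rw [hh]; push_cast; rfl
    have hlim0 : Filter.Tendsto (fun n : ℕ => 1 / ((n : ℝ) + 1)) Filter.atTop (nhds 0) :=
      tendsto_one_div_add_atTop_nhds_zero_nat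
    have hanti : Antitone h := by
      intro m n hmn
      rw [hh]
      have : (m : ℝ≥0) ≤ n := Nat.cast_le.2 hmn
      simp only
      gcongr
    have hlim : Filter.Tendsto h Filter.atTop (nhds 0) := by
      rw [← NNReal.tendsto_coe]
      have := hlim0.const_mul ((u : ℝ) / 2)
      rw [mul_zero] at this
      refine this.congr fun n => ?_
      rw [hcoe]; field_simp
    have hosc := tendsto_measureReal_oscillation (O := O) (P := P) hε u hanti hlim
    have hb : ∀ N : ℕ, p ≤ P.real (oscillation O ε u (h N)) + K * (r + ε) +
        C * (1 / ((N : ℝ) + 1)) := by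
      intro N
      have hhN : 0 < h N := by rw [hh]; positivity
      have huN : u = (2 * N + 1 + 1 : ℕ) * h N := by
        rw [hh, ← NNReal.coe_inj]; push_cast; field_simp; ring
      have h1 := measureReal_nearBoundaryAway_le_sum hP hQ hO hO_ne h0 hγ
        (by linarith : r + ε < ρ) hr hε.le hx hhN huN
      obtain ⟨h2, h3⟩ := riemann_stieltjes_sum_le (F := exitCDF O P r) (C := C)
        (a := ((d : ℝ) - 1) / γ) (c := 3 / √8) (u := u) (fun t => measureReal_nonneg)
        (fun t => measureReal_le_one) (exitCDF_mono r) hF hC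
        (div_nonneg (by linarith) hγ.le) (by positivity) hu0 N
      rw [← hcoe] at h2 h3
      have hs8 : √8 = 2 * √2 := by
        rw [show (8 : ℝ) = 2 ^ 2 * 2 by norm_num, Real.sqrt_mul (by norm_num),
          Real.sqrt_sq (by norm_num)]
      -- With `c = 3 / √8` one has `c √2 = 3/2` and `2 √2 c C = 3 C`.
      have e1 : ((d : ℝ) - 1) / γ + 3 / √8 * √2 / √(u : ℝ) +
          2 * √2 * (3 / √8) * C / √(u : ℝ) = K := by
        rw [hK, hs8]; field_simp; ring
      rw [e1] at h2
      have e2 : ∀ i : ℕ, (exitCDF O P r ((i + 1 : ℕ) * (h N : ℝ)) - exitCDF O P r (i * (h N : ℝ))) *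
          ((((d : ℝ) - 1) / γ + 3 / √(8 * ((u : ℝ) - (i + 1 : ℕ) * (h N : ℝ)))) * (r + ε)) =
          (exitCDF O P r ((i + 1 : ℕ) * (h N : ℝ)) - exitCDF O P r (i * (h N : ℝ))) *
          (((d : ℝ) - 1) / γ + 3 / √8 / √((u : ℝ) - (i + 1 : ℕ) * (h N : ℝ))) * (r + ε) := by
        intro i
        rw [Real.sqrt_mul (by norm_num), div_div, mul_assoc]
      simp_rw [e2] at h1
      rw [← Finset.sum_mul, ← hp] at h1
      have h4 := mul_le_mul_of_nonneg_right h2 (by linarith : 0 ≤ r + ε)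
      rw [mul_one_div]
      linarith
    have hlim2 : Filter.Tendsto (fun N : ℕ => P.real (oscillation O ε u (h N)) + K * (r + ε) +
        C * (1 / ((N : ℝ) + 1))) Filter.atTop (nhds (0 + K * (r + ε) + C * 0)) :=
      (hosc.add_const _).add (hlim0.const_mul C)
    have := ge_of_tendsto' hlim2 hb
    linarith
  rw [← hp, ← hK]
  have hlim : Filter.Tendsto (fun ε => K * (r + ε)) (nhdsWithin 0 (Ioi 0)) (nhds (K * (r + 0))) :=
    (Continuous.tendsto (by fun_prop) 0).mono_left nhdsWithin_le_nhds
  rw [add_zero] at hlim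
  refine ge_of_tendsto hlim ?_
  filter_upwards [Ioo_mem_nhdsGT (sub_pos.2 hρ)] with ε h
  exact hε ε h.1 h.2

theorem signedDist_iInf_spec (O : Set (Eucl d)) (ω : PathSpace d) (u : ℝ≥0) :
    (∀ v ≤ u, (⨅ t : Icc (0 : ℝ≥0) u, signedDist O (ω t)) ≤ signedDist O (ω v)) ∧
    ∃ v ≤ u, signedDist O (ω v) = ⨅ t : Icc (0 : ℝ≥0) u, signedDist O (ω t) := by
  have hc : Continuous fun t : Icc (0 : ℝ≥0) u => signedDist O (ω t) :=
    (continuous_signedDist O).comp (ω.continuous.comp continuous_subtype_val)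
  have : Nonempty (Icc (0 : ℝ≥0) u) := ⟨⟨0, le_rfl, zero_le⟩⟩
  have hcpt := isCompact_range hc
  refine ⟨fun v hv => ciInf_le hcpt.bddBelow (⟨v, zero_le, hv⟩ : Icc (0 : ℝ≥0) u), ?_⟩
  obtain ⟨v, hv⟩ := hcpt.sInf_mem (range_nonempty _)
  exact ⟨v, v.2.2, hv⟩

theorem forall_lt_dist_of_lt_hitTime {γ : ℝ} {u : ℝ≥0} {ω : PathSpace d}
    (h : (u : WithTop ℝ≥0) < hitTime (sigmaNhd O γ) ω) {v : ℝ≥0} (hv : v ≤ u) {y : Eucl d}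
    (hy : y ∈ sigmaSet O γ) : γ < dist (ω v) y := by
  by_contra hle
  refine notMem_of_lt_hittingAfter ((WithTop.coe_le_coe.2 hv).trans_lt h) zero_le ⟨y, ?_, hy⟩
  rw [Metric.mem_closedBall, dist_comm]
  exact not_lt.1 hle

/-- On the compact interval `[0, u]` the infimum of `q` is attained, and a path that misses the
closed `γ`-neighbourhood of `Σ_γ` keeps a positive margin from it. The margin supplies the strict
inequality `r < ρ` even when `r = γ`. -/
theorem nearBoundaryEvent_subset (h0 : O.Nonempty) (γ r : ℝ) (u : ℝ≥0) :
    nearBoundaryEvent O γ r u ⊆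
      ⋃ m : ℕ, nearBoundaryAway O γ (γ + 1 / ((m : ℝ) + 1)) r u := by
  rintro ω ⟨a1, a2, a3⟩
  obtain ⟨s1, v0, hv0, s2⟩ := signedDist_iInf_spec O ω u
  have hex : ∃ m : ℕ, ∀ v ≤ u, ∀ y ∈ sigmaSet O γ, γ + 1 / ((m : ℝ) + 1) ≤ dist (ω v) y := by
    -- `Metric.infDist` to the empty set is `0`, so that case is separate.
    rcases (sigmaSet O γ).eq_empty_or_nonempty with he | hne
    · exact ⟨0, fun v _ y hy => by rw [he] at hy; exact absurd hy (notMem_empty y)⟩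
    have hc : ContinuousOn (fun t : ℝ≥0 => Metric.infDist (ω t) (sigmaSet O γ)) (Icc 0 u) :=
      ((Metric.continuous_infDist_pt _).comp ω.continuous).continuousOn
    obtain ⟨w, hw, hmin⟩ := isCompact_Icc.exists_isMinOn (nonempty_Icc.2 zero_le) hc
    obtain ⟨y, hy, hwy⟩ := isClosed_closure.exists_infDist_eq_dist hne (ω w)
    have hlt : γ < Metric.infDist (ω w) (sigmaSet O γ) := by
      have := forall_lt_dist_of_lt_hitTime a3 hw.2 hy
      rwa [← hwy] at this
    obtain ⟨m, hm⟩ := exists_nat_one_div_lt (sub_pos.2 hlt)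
    refine ⟨m, fun v hv y hy => ?_⟩
    have h1 := isMinOn_iff.1 hmin v ⟨zero_le, hv⟩
    have h2 := Metric.infDist_le_dist_of_mem (x := ω v) hy
    linarith
  obtain ⟨m, hm⟩ := hex
  exact mem_iUnion.2 ⟨m, fun v hv => mem_closure_of_signedDist_nonneg h0 (a1.trans (s1 v hv)),
    ⟨v0, hv0, s2.le.trans a2⟩, hm⟩

theorem nearBoundaryAway_anti {γ ρ ρ' r : ℝ} (h : ρ ≤ ρ') (u : ℝ≥0) :
    nearBoundaryAway O γ ρ' r u ⊆ nearBoundaryAway O γ ρ r u :=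
  fun _ ⟨a1, a2, a3⟩ => ⟨a1, a2, fun v hv y hy => h.trans (a3 v hv y hy)⟩

theorem measureReal_nearBoundaryEvent_le (hP : IsBrownianLaw x P) (hQ : IsBrownianLaw 0 Q)
    (hO : IsOpen O) (hO_ne : O ≠ univ) (h0 : O.Nonempty) {γ r C : ℝ} (hγ : 0 < γ) (hr : 0 < r)
    (hrγ : r ≤ γ) (hx : x ∈ closure O) (hC : 0 ≤ C)
    (hF : ∀ t, 0 < t → DifferentiableAt ℝ (exitCDF O P r) t ∧ deriv (exitCDF O P r) t ≤ C * t⁻¹)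
    {u : ℝ≥0} (hu : 0 < u) :
    P.real (nearBoundaryEvent O γ r u) ≤
      (((d : ℝ) - 1) / γ + (3 * C + 3 / 2) / √(u : ℝ)) * r := by
  have := hP.isProbabilityMeasure
  have := hQ.isProbabilityMeasure
  have hd1 : (1 : ℝ) ≤ d := by exact_mod_cast dim_pos hO_ne h0
  have hu0 : (0 : ℝ) < u := hu
  have hd0 : 0 ≤ ((d : ℝ) - 1) / γ := div_nonneg (by linarith) hγ.le
  obtain ⟨K, hK⟩ : ∃ K, K = (((d : ℝ) - 1) / γ + (3 * C + 3 / 2) / √(u : ℝ)) * r := ⟨_, rfl⟩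
  have hK0 : 0 ≤ K := by rw [hK]; positivity
  rw [← hK]
  -- Three cases: a start inside `O_r`, where the decomposition by the exit time applies; a start
  -- with `q ≤ r` outside `A_γ`, where the survival bound applies directly; a start in `A_γ`, where
  -- the event is null.
  rcases lt_or_ge r (signedDist O x) with hqx | hqx
  · have hm : ∀ m : ℕ, P (nearBoundaryAway O γ (γ + 1 / ((m : ℝ) + 1)) r u) ≤
        ENNReal.ofReal K := by
      intro m
      have hpos : 0 < 1 / ((m : ℝ) + 1) := by positivity
      rw [← ofReal_measureReal (μ := P), hK]
      exact ENNReal.ofReal_le_ofReal (measureReal_nearBoundaryAway_le hP hQ hO hO_ne h0 hγ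
        (by linarith) hr.le hqx hC hF hu)
    have hmono : Monotone fun m : ℕ => nearBoundaryAway O γ (γ + 1 / ((m : ℝ) + 1)) r u := by
      intro m n hmn
      refine nearBoundaryAway_anti ?_ u
      have : (m : ℝ) ≤ n := by exact_mod_cast hmn
      gcongr
    have h1 : P (nearBoundaryEvent O γ r u) ≤ ENNReal.ofReal K := by
      refine (measure_mono (nearBoundaryEvent_subset h0 γ r u)).trans ?_
      rw [hmono.measure_iUnion]
      exact iSup_le hm
    exact ENNReal.toReal_le_of_le_ofReal hK0 h1
  by_cases hsig : ∀ y ∈ sigmaSet O γ, γ < dist x y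
  · have hq0 := signedDist_nonneg_of_mem_closure hx
    have h1 := measureReal_mem_closure_le hQ hO hO_ne h0 hγ hu hq0
      fun y hy => (hqx.trans hrγ).trans_lt (hsig y hy)
    have hmeas := (isClosed_forall_mem (d := d) (isClosed_closure (s := O)) u).measurableSet
    have h2 : P.real (nearBoundaryEvent O γ r u) ≤
        Q.real {ω | ∀ v ≤ u, x + ω v ∈ closure O} := by
      have h3 : nearBoundaryEvent O γ r u ⊆ {ω | ∀ v ≤ u, ω v ∈ closure O} :=
        fun ω hω v hv => mem_closure_of_signedDist_nonneg h0
          (hω.1.trans ((signedDist_iInf_spec O ω u).1 v hv))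
      refine (measureReal_mono h3).trans (le_of_eq ?_)
      rw [hP.eq_map_translate hQ, map_measureReal_apply (measurable_translate x) hmeas]
      rfl
    refine h2.trans (h1.trans ?_)
    -- Here `√8 ≥ 2` suffices.
    have h4 : 3 / √(8 * (u : ℝ)) ≤ (3 * C + 3 / 2) / √(u : ℝ) := by
      have h5 : √8 * √(u : ℝ) = √(8 * (u : ℝ)) := (Real.sqrt_mul (by norm_num) _).symm
      have h6 : 2 ≤ √8 := Real.le_sqrt_of_sq_le (by norm_num)
      have h7 : 0 < √(u : ℝ) := by positivity
      rw [← h5, div_le_div_iff₀ (by positivity) h7]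
      nlinarith [mul_nonneg hC h7.le, mul_le_mul_of_nonneg_right h6 h7.le,
        mul_nonneg hC (mul_nonneg (Real.sqrt_nonneg 8) h7.le)]
    rw [hK]
    gcongr
  · push Not at hsig
    obtain ⟨y, hy, hyx⟩ := hsig
    have h1 : nearBoundaryEvent O γ r u ⊆ {ω | ω 0 ≠ x} := by
      rintro ω ⟨-, -, a3⟩ h2
      have := forall_lt_dist_of_lt_hitTime a3 (v := 0) zero_le hy
      rw [h2] at this
      linarith
    refine (measureReal_mono h1).trans ?_
    rw [measureReal_def, show P {ω | ω 0 ≠ x} = 0 from hP.ae_eval_zero hQ, ENNReal.toReal_zero]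
    exact hK0

end PathEstimate

theorem mainTheorem5 {d : ℕ} (O : Set (PathEstimate.Eucl d)) (hO : IsOpen O)
    (hO_ne : O ≠ Set.univ) (h0 : (0 : PathEstimate.Eucl d) ∈ O)
    (P : PathEstimate.Eucl d → Measure (PathEstimate.PathSpace d))
    (hP : ∀ x, PathEstimate.IsBrownianLaw x (P x)) :
    (∃ C₁ : ℝ, PathEstimate.IsExitRateConst O P C₁) ∧
    ∀ C₁ : ℝ, PathEstimate.IsExitRateConst O P C₁ →
      ∀ (γ r : ℝ) (u : ℝ≥0) (x : PathEstimate.Eucl d),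
        0 < γ → 0 < u → 0 < r → r ≤ γ → x ∈ closure O →
        (P x).real (PathEstimate.nearBoundaryEvent O γ r u) ≤
          (((d : ℝ) - 1) / γ + (4 * C₁ + 2) * (u : ℝ) ^ (-(1 / 2) : ℝ)) * r := by
  refine ⟨PathEstimate.exists_isExitRateConst O hP, ?_⟩
  rintro C₁ ⟨hC₁, hF⟩ γ r u x hγ hu hr hrγ hx
  refine (PathEstimate.measureReal_nearBoundaryEvent_le (hP x) (hP 0) hO hO_ne ⟨0, h0⟩ hγ hr hrγ hx
    hC₁.le (fun t ht => hF x r t hr ht) hu).trans ?_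
  have hu0 : (0 : ℝ) < u := hu
  rw [Real.rpow_neg hu0.le, ← Real.sqrt_eq_rpow, ← div_eq_mul_inv]
  -- The proof gives `3 C₁ + 3/2`, which is below `4 C₁ + 2`.
  gcongr
  · norm_num
  · norm_num
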